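/- Let $k$ be a field, $q\in k\setminus\{0,1\}$, $U\subset k\setminus\{0\}$ a finite set, made into a graph with an edge $u\to u'$ whenever $u'=qu$, and $n\ge 0$. Let $b\in 1+t+t^2k[[t]]$ and assume one of the following: (i) $d(h)=1$ and $\hbar:=0$ ($b$ and $k$ arbitrary); or (ii) $\operatorname{char}k=0$, $d(h)=e^h$, $b(t)=e^t$ and $\hbar:=h$. Put $\mathsf q=q\,d(h)\in k[[h]]$. For $\mathbf u\in U^n$ let $s_r\mathbf u$ be $\mathbf u$ with the entries $u_r,u_{r+1}$ exchanged. **Hecke side.** Let $H_h$ be the affine Hecke algebra over $k[[h]]$ with generators $X_1^{\pm1},\dots,X_n^{\pm1},T_1,\dots,T_{n-1}$ and relations: the $X_i^{\pm 1}$ commute; $T_r^2=(\mathsf q-1)T_r+\mathsf q$; $T_rX_rT_r=\mathsf qX_{r+1}$; $T_rT_{r+1}T_r=T_{r+1}T_rT_{r+1}$; $T_rX_s=X_sT_r$ for $s\ne r,r+1$; $T_rT_s=T_sT_r$ for $s\neq r\pm1$. Let $\mathcal I\subset k[[h]][X_i^{\pm1}]$ be the ideal generated by $h$ and the elements $\prod_{u\in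 U}(X_i-u)$, and $\widehat H_h$ the completion of $H_h$ with respect to the ideals $H_h\mathcal I^mH_h$. For $\mathbf u\in U^n$ let $e_{\mathbf u}\in\widehat H_h$ be the idempotent that acts by left multiplication as the projection onto the simultaneous topological stable kernel of the operators $X_j-u_j$, in the decomposition of $\widehat H_h$ into these stable kernels. Let $\widehat{\mathcal P}^-=\widehat H_h\otimes_{H_h}\mathcal P^-$, where $\mathcal P^-$ is the $H_h$-module generated by $\mathbb 1$ subject to $T_r\mathbb 1=-\mathbb 1$ for all $r$. Put $$\Phi_r=T_r+\sum_{u_r\ne u_{r+1}}\frac{1-\mathsf q}{1-X_rX_{r+1}^{-1}}e_{\mathbf u}+\sum_{u_r=u_{r+1}}e_{\mathbf u}.$$ **KLR side.** For $u,v\in U$ let $Q_{u,v}(a,b)=0$ if $u=v$; otherwise $Q_{u,v}(a,b)$ is the product of a factor $a-b+\hbar$ if $v=qu$ and a factor $b-a+\hbar$ if $u=qv$ (so it is $1$ if neither holds, and has both factors if $u=-v$, $q=-1$). Let $R_h$ be the $k[[h]]$-algebra with generators $e_{\mathbf u}$ $(\mathbf u\in U^n)$, $y_1,\dots,y_n$,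 $\psi_1,\dots,\psi_{n-1}$ and relations: $e_{\mathbf u}e_{\mathbf v}=\delta_{\mathbf u\mathbf v}e_{\mathbf u}$; $\sum_{\mathbf u}e_{\mathbf u}=1$; $y_re_{\mathbf u}=e_{\mathbf u}y_r$; $\psi_re_{\mathbf u}=e_{s_r\mathbf u}\psi_r$; $y_ry_s=y_sy_r$; $\psi_ry_s=y_s\psi_r$ for $s\ne r,r+1$; $\psi_r\psi_s=\psi_s\psi_r$ for $s\ne r\pm1$; $$\psi_ry_{r+1}e_{\mathbf u}=(y_r\psi_r-\delta_{u_r,u_{r+1}})e_{\mathbf u},\qquad y_{r+1}\psi_re_{\mathbf u}=(\psi_ry_r-\delta_{u_r,u_{r+1}})e_{\mathbf u},$$ $$\psi_r^2e_{\mathbf u}=Q_{u_r,u_{r+1}}(y_r,y_{r+1})e_{\mathbf u},$$ $$(\psi_r\psi_{r+1}\psi_r-\psi_{r+1}\psi_r\psi_{r+1})e_{\mathbf u}=\begin{cases}\dfrac{Q_{u_r,u_{r+1}}(y_r,y_{r+1})-Q_{u_r,u_{r+1}}(y_{r+2},y_{r+1})}{y_r-y_{r+2}}\,e_{\mathbf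 u}&u_r=u_{r+2},\\0&\text{otherwise.}\end{cases}$$ Let $\widehat R_h$ be the completion of $R_h$ with respect to the ideals $R_hI^mR_h$, where $I=(h,y_1,\dots,y_n)$. Let $\widehat P=\widehat R_h\otimes_{R_h}P$, where $P$ is the $R_h$-module generated by $\mathbb 1$ subject to $$\psi_re_{\mathbf u}\mathbb 1=\begin{cases}0&u_r=u_{r+1}\\(y_{r+1}-y_r+\hbar)e_{s_r\mathbf u}\mathbb 1&u_{r+1}=qu_r\\e_{s_r\mathbf u}\mathbb 1&\text{otherwise.}\end{cases}$$ Finally, in the fraction field of $k[[h,y_1,\dots,y_n]]$, let $$\varphi_r^{\mathbf u}=\frac{u_rb(y_r)-\mathsf qu_{r+1}b(y_{r+1})}{u_{r+1}b(y_{r+1})-u_rb(y_r)},\qquad A_r^{\mathbf u}=\begin{cases}\varphi_r^{\mathbf u}\,(y_{r+1}-y_r)&u_r=u_{r+1}\\ \varphi_r^{\mathbf u}/(y_{r+1}-y_r+\hbar)&u_r=qu_{r+1}\\ \varphi_r^{\mathbf u}&\text{otherwise.}\end{cases}$$ **Proposition.** The idempotents $e_{\mathbf u}\in\widehat H_h$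 exist and $1-X_rX_{r+1}^{-1}$ is invertible on $e_{\mathbf u}\widehat H_h$ if $u_r\ne u_{r+1}$, so that $\Phi_r$ is defined; all $A_r^{\mathbf u}$ are power series, that is, lie in $k[[h,y_1,\dots,y_n]]$; and there are a $k[[h]]$-linear isomorphism $\gamma_p\colon\widehat{\mathcal P}^-\to\widehat P$ with $$\gamma_p\Big(\prod_i(u_i^{-1}X_i)^{a_i}\,e_{\mathbf u}\mathbb 1\Big)=\prod_ib(y_i)^{a_i}\,e_{\mathbf u}\mathbb 1\qquad(a\in\mathbb Z^n,\ \mathbf u\in U^n)$$ and an isomorphism $\gamma\colon\widehat H_h\to\widehat R_h$ of topological $k[[h]]$-algebras such that $$\gamma(X_r)=\sum_{\mathbf u}u_rb(y_r)e_{\mathbf u},\qquad\gamma(\Phi_r)=\sum_{\mathbf u}A_r^{s_r\mathbf u}\psi_re_{\mathbf u},$$ and $\gamma_p(xv)=\gamma(x)\gamma_p(v)$ for all $x\in\widehat H_h$, $v\in\widehat{\mathcal P}^-$. -/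

import Mathlib

noncomputable section

open scoped Pointwise

namespace TypeO

/-! ### Completion of an algebra along the powers of an ideal -/

section Completion

variable (K : Type*) [CommRing K] {A : Type*} [Ring A] [Algebra K A]

/-- Let `G` be a set of pairwise commuting elements of `A` and `I` the ideal that `G` generates in
a commutative subalgebra containing `G`. Then `I ^ m` is generated by the set `G ^ m` of `m`-fold
products, and this is the two-sided ideal `A · I ^ m · A`. -/
def powIdeal (G : Set A) (m : ℕ) : Ideal A := (TwoSidedIdeal.span (G ^ m)).asIdeal

instance (G : Set A) (m : ℕ) : (powIdeal G m).IsTwoSided :=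
  inferInstanceAs ((TwoSidedIdeal.span (G ^ m)).asIdeal).IsTwoSided

/-- The inverse limit of the quotients `A ⧸ (A · I ^ m · A)`: the sequences `x` such that, for
every `m`, one element of `A` represents all of `x 0, …, x m`. -/
def complSubalgebra (G : Set A) : Subalgebra K (∀ m : ℕ, A ⧸ powIdeal G m) where
  carrier := {x | ∀ m, ∃ a : A, ∀ l ≤ m, Ideal.Quotient.mk (powIdeal G l) a = x l}
  mul_mem' := by
    intro x y hx hy m
    obtain ⟨a, ha⟩ := hx m
    obtain ⟨b, hb⟩ := hy m
    exact ⟨a * b, fun l hl => by rw [map_mul, ha l hl, hb l hl]; rfl⟩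
  add_mem' := by
    intro x y hx hy m
    obtain ⟨a, ha⟩ := hx m
    obtain ⟨b, hb⟩ := hy m
    exact ⟨a + b, fun l hl => by rw [map_add, ha l hl, hb l hl]; rfl⟩
  algebraMap_mem' := fun c m => ⟨algebraMap K A c, fun _ _ => rfl⟩

/-- The completion of `A` with respect to the ideals `A · I ^ m · A`. -/
def Compl (G : Set A) : Type _ := complSubalgebra K G

instance (G : Set A) : Ring (Compl K G) := inferInstanceAs (Ring (complSubalgebra K G))

instance (G : Set A) : Algebra K (Compl K G) := inferInstanceAs (Algebra K (complSubalgebra K G))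

/-- The component modulo `A · I ^ m · A` of an element of the completion. -/
def Compl.proj {G : Set A} (m : ℕ) (x : Compl K G) : A ⧸ powIdeal G m := x.1 m

/-- The inverse limit topology, every quotient `A ⧸ (A · I ^ m · A)` being discrete. -/
instance (G : Set A) : TopologicalSpace (Compl K G) :=
  ⨅ m : ℕ, TopologicalSpace.induced (Compl.proj K m) ⊥

/-- The canonical map from `A` to its completion. -/
def toCompl (G : Set A) : A →ₐ[K] Compl K G :=
  AlgHom.codRestrict (AlgHom.pi fun m => Ideal.Quotient.mkₐ K (powIdeal G m))
    (complSubalgebra K G) fun a _ => ⟨a, fun _ _ => rfl⟩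

/-- The left ideal `Â · L` of the completion `Â` generated by a left ideal `L` of `A`. -/
def complIdeal (G : Set A) (L : Submodule A A) : Submodule (Compl K G) (Compl K G) :=
  Submodule.span (Compl K G) (toCompl K G '' (L : Set A))

/-- The completion `Â ⊗_A (A ⧸ L)` of the cyclic module `A ⧸ L`, that is, `Â ⧸ (Â · L)`. -/
def ComplCyclic (G : Set A) (L : Submodule A A) : Type _ := Compl K G ⧸ complIdeal K G L

instance (G : Set A) (L : Submodule A A) : AddCommGroup (ComplCyclic K G L) :=
  inferInstanceAs (AddCommGroup (Compl K G ⧸ complIdeal K G L))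

instance (G : Set A) (L : Submodule A A) : Module (Compl K G) (ComplCyclic K G L) :=
  inferInstanceAs (Module (Compl K G) (Compl K G ⧸ complIdeal K G L))

instance (G : Set A) (L : Submodule A A) : Module K (ComplCyclic K G L) :=
  inferInstanceAs (Module K (Compl K G ⧸ complIdeal K G L))

/-- The canonical map from the completed algebra to the completed cyclic module, `x ↦ x · 𝟙`. -/
def toCyclic (G : Set A) (L : Submodule A A) : Compl K G →ₗ[Compl K G] ComplCyclic K G L :=
  (complIdeal K G L).mkQ

theorem mem_powIdeal_of_mem_pow {G : Set A} {l j : ℕ} (h : l ≤ j) {a : A} (ha : a ∈ G ^ j) :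
    a ∈ powIdeal G l := by
  obtain ⟨i, rfl⟩ := Nat.exists_eq_add_of_le h
  rw [pow_add] at ha
  obtain ⟨x, hx, y, _, rfl⟩ := Set.mem_mul.1 ha
  exact TwoSidedIdeal.mul_mem_right _ _ _ (TwoSidedIdeal.subset_span hx)

end Completion

/-! ### Indices -/

section Indices

variable {n : ℕ}

/-- The strand `r`, for `r` one of the `n - 1` pairs of neighbouring strands. -/
def lo (r : Fin (n - 1)) : Fin n := ⟨r, by omega⟩

/-- The strand `r + 1`, for `r` one of the `n - 1` pairs of neighbouring strands. -/
def hi (r : Fin (n - 1)) : Fin n := ⟨r + 1, by omega⟩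

/-- The sequence obtained from `u` by exchanging the entries `r` and `r + 1`. -/
def swp {α : Type*} (r : Fin (n - 1)) (u : Fin n → α) : Fin n → α :=
  u ∘ Equiv.swap (lo r) (hi r)

/-- The integer power of an invertible element `x` with inverse `x'`. -/
def zpw {M : Type*} [Monoid M] (x x' : M) : ℤ → M
  | Int.ofNat m => x ^ m
  | Int.negSucc m => x' ^ (m + 1)

end Indices

variable {k : Type*} [Field k]

/-! ### The affine Hecke algebra over `k[[h]]` with parameter `𝗊 ∈ k[[h]]` -/

/-- Generators of the affine Hecke algebra of rank `n`. -/
inductive HGen (n : ℕ) : Type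
  | X (i : Fin n)
  | Xinv (i : Fin n)
  | T (r : Fin (n - 1))

section HeckeRel

variable (Q : PowerSeries k) (n : ℕ)

local notation "F" => FreeAlgebra (PowerSeries k) (HGen n)

/-- A generator in the free algebra. -/
abbrev hg (g : HGen n) : F := FreeAlgebra.ι (PowerSeries k) g

/-- Relations of the affine Hecke algebra. -/
inductive HRel : F → F → Prop
  | X_Xinv (i) : HRel (hg n (.X i) * hg n (.Xinv i)) 1
  | Xinv_X (i) : HRel (hg n (.Xinv i) * hg n (.X i)) 1
  | X_comm (i j) : HRel (hg n (.X i) * hg n (.X j)) (hg n (.X j) * hg n (.X i))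
  | T_sq (r) : HRel (hg n (.T r) * hg n (.T r))
      (algebraMap _ F (Q - 1) * hg n (.T r) + algebraMap _ F Q)
  | T_X_T (r) : HRel (hg n (.T r) * hg n (.X (lo r)) * hg n (.T r))
      (algebraMap _ F Q * hg n (.X (hi r)))
  | braid (r s : Fin (n - 1)) (h : (r : ℕ) + 1 = s) :
      HRel (hg n (.T r) * hg n (.T s) * hg n (.T r)) (hg n (.T s) * hg n (.T r) * hg n (.T s))
  | T_X_comm (r i) (h₁ : i ≠ lo r) (h₂ : i ≠ hi r) :
      HRel (hg n (.T r) * hg n (.X i)) (hg n (.X i) * hg n (.T r))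
  | T_comm (r s : Fin (n - 1)) (h₁ : (r : ℕ) + 1 ≠ s) (h₂ : (s : ℕ) + 1 ≠ r) :
      HRel (hg n (.T r) * hg n (.T s)) (hg n (.T s) * hg n (.T r))

end HeckeRel

/-- The affine Hecke algebra of rank `n` over `k[[h]]` with parameter `Q`. -/
def Hecke (Q : PowerSeries k) (n : ℕ) : Type _ := RingQuot (HRel Q n)

namespace Hecke

variable (Q : PowerSeries k) (n : ℕ)

instance : Ring (Hecke Q n) := inferInstanceAs (Ring (RingQuot (HRel Q n)))

instance : Algebra (PowerSeries k) (Hecke Q n) :=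
  inferInstanceAs (Algebra (PowerSeries k) (RingQuot (HRel Q n)))

/-- The image of a generator. -/
def gen (g : HGen n) : Hecke Q n :=
  RingQuot.mkAlgHom (PowerSeries k) (HRel Q n) (FreeAlgebra.ι (PowerSeries k) g)

/-- Generators of the ideal `𝓘`: the element `h` and the products `∏_{u ∈ U} (X_i - u)`. The
factors commute, so their order in the product is immaterial. -/
def idealGens (U : Finset k) : Set (Hecke Q n) :=
  {algebraMap (PowerSeries k) _ PowerSeries.X} ∪
    Set.range fun i : Fin n =>
      Polynomial.aeval (gen Q n (.X i))
        ((∏ u ∈ U, (Polynomial.X - Polynomial.C u)).map (PowerSeries.C (R := k)))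

variable (U : Finset k)

/-- The completed affine Hecke algebra. -/
abbrev Hat : Type _ :=
  Compl (PowerSeries k) (idealGens Q n U)

/-- A generator in the completed affine Hecke algebra. -/
abbrev hgen (g : HGen n) : Hat Q n U := toCompl (PowerSeries k) (idealGens Q n U) (gen Q n g)

/-- The simultaneous topological stable kernel of the left multiplications by `X_j - u_j`. -/
def weightSpace (u : Fin n → U) : Set (Hat Q n U) :=
  {g | ∀ (j : Fin n) (m : ℕ), ∃ N₀ : ℕ, ∀ N ≥ N₀,
    Compl.proj (PowerSeries k) m
      ((hgen Q n U (.X j) - algebraMap (PowerSeries k) _ (PowerSeries.C (u j : k))) ^ N * g) = 0}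

/-- The left multiplications by the `e u` are the projections onto the weight spaces in a direct
sum decomposition of the completed affine Hecke algebra. This determines `e`. -/
structure IsWeightIdempotents (e : (Fin n → U) → Hat Q n U) : Prop where
  complete_orthogonal : CompleteOrthogonalIdempotents e
  mem_weightSpace_iff : ∀ u g, g ∈ weightSpace Q n U u ↔ e u * g = g

/-- For `u_r ≠ u_{r+1}`, the element that acts by left multiplication as `1 - X_r X_{r+1}⁻¹` on
the weight space of `u` and as the identity on the other weight spaces. -/
def denom (e : (Fin n → U) → Hat Q n U) (r : Fin (n - 1)) (u : Fin n → U) : Hat Q n U :=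
  (1 - hgen Q n U (.X (lo r)) * hgen Q n U (.Xinv (hi r))) * e u + (1 - e u)

open Classical in
/-- The intertwiner
`Φ_r = T_r + ∑_{u_r ≠ u_{r+1}} (1 - 𝗊) / (1 - X_r X_{r+1}⁻¹) e_u + ∑_{u_r = u_{r+1}} e_u`. -/
def Phi (e : (Fin n → U) → Hat Q n U) (r : Fin (n - 1)) : Hat Q n U :=
  hgen Q n U (.T r) + ∑ u : Fin n → U,
    if u (lo r) = u (hi r) then e u else (1 - Q) • (Ring.inverse (denom Q n U e r u) * e u)

/-- The left ideal generated by the `T_r + 1`; the quotient of the affine Hecke algebra by it is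
the signed polynomial representation, generated by `𝟙` subject to `T_r 𝟙 = - 𝟙`. -/
def signIdeal : Submodule (Hecke Q n) (Hecke Q n) :=
  Submodule.span _ (Set.range fun r : Fin (n - 1) => gen Q n (.T r) + 1)

/-- The completed signed polynomial representation. -/
abbrev PolyHat : Type _ := ComplCyclic (PowerSeries k) (idealGens Q n U) (signIdeal Q n)

/-- The map `x ↦ x 𝟙` to the completed signed polynomial representation. -/
abbrev toPoly : Hat Q n U →ₗ[Hat Q n U] PolyHat Q n U :=
  toCyclic (PowerSeries k) (idealGens Q n U) (signIdeal Q n)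

/-- The Laurent monomial `X_1 ^ a_1 ⋯ X_n ^ a_n`. -/
def Xpow (a : Fin n → ℤ) : Hat Q n U :=
  (List.ofFn fun i => zpw (hgen Q n U (.X i)) (hgen Q n U (.Xinv i)) (a i)).prod

end Hecke

/-! ### The KLR algebra over `k[[h]]` of the graph with vertex set `U` and edges `u ⟶ q u` -/

/-- Generators of the KLR algebra of rank `n`. -/
inductive KGen (U : Finset k) (n : ℕ) : Type _
  | e (u : Fin n → U)
  | y (i : Fin n)
  | psi (r : Fin (n - 1))

section KLRRel

variable (q : k) (c : PowerSeries k) (U : Finset k) (n : ℕ)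

local notation "F" => FreeAlgebra (PowerSeries k) (KGen U n)

/-- A generator in the free algebra. -/
abbrev kg (g : KGen U n) : F := FreeAlgebra.ι (PowerSeries k) g

open Classical in
/-- `Q_{u,v}(a, b)`: zero for `u = v`, and otherwise the product of a factor `a - b + c` if there
is an edge `u ⟶ v` and of a factor `b - a + c` if there is an edge `v ⟶ u`. -/
def Qpol {A : Type*} [Ring A] [Algebra (PowerSeries k) A] (u v : k) (a b : A) : A :=
  if u = v then 0 else
    (if v = q * u then a - b + algebraMap _ A c else 1) *
      (if u = q * v then b - a + algebraMap _ A c else 1)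

open Classical in
/-- The divided difference `(Q_{u,v}(y₁, y₂) - Q_{w,v}(y₃, y₂)) / (y₁ - y₃)` for `w = u` (and zero
for `w ≠ u`), the error term in the braid relation. -/
def Bpol {A : Type*} [Ring A] (u v w : k) (y₁ y₂ y₃ : A) : A :=
  if u ≠ w ∨ u = v then 0
  else if v = q * u ∧ u = q * v then 2 * y₂ - y₁ - y₃
  else if v = q * u then 1
  else if u = q * v then -1
  else 0

open Classical in
/-- Relations of the KLR algebra. -/
inductive KRel : F → F → Prop
  | e_mul_e (u v) : KRel (kg U n (.e u) * kg U n (.e v)) (if u = v then kg U n (.e u) else 0)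
  | sum_e : KRel (∑ u : Fin n → U, kg U n (.e u)) 1
  | y_e (i u) : KRel (kg U n (.y i) * kg U n (.e u)) (kg U n (.e u) * kg U n (.y i))
  | psi_e (r u) : KRel (kg U n (.psi r) * kg U n (.e u)) (kg U n (.e (swp r u)) * kg U n (.psi r))
  | y_comm (i j) : KRel (kg U n (.y i) * kg U n (.y j)) (kg U n (.y j) * kg U n (.y i))
  | psi_y_comm (r i) (h₁ : i ≠ lo r) (h₂ : i ≠ hi r) :
      KRel (kg U n (.psi r) * kg U n (.y i)) (kg U n (.y i) * kg U n (.psi r))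
  | psi_comm (r s : Fin (n - 1)) (h₁ : (r : ℕ) + 1 ≠ s) (h₂ : (s : ℕ) + 1 ≠ r) :
      KRel (kg U n (.psi r) * kg U n (.psi s)) (kg U n (.psi s) * kg U n (.psi r))
  | psi_y_hi (r u) : KRel (kg U n (.psi r) * kg U n (.y (hi r)) * kg U n (.e u))
      ((kg U n (.y (lo r)) * kg U n (.psi r) - if u (lo r) = u (hi r) then 1 else 0) *
        kg U n (.e u))
  | y_hi_psi (r u) : KRel (kg U n (.y (hi r)) * kg U n (.psi r) * kg U n (.e u))
      ((kg U n (.psi r) * kg U n (.y (lo r)) - if u (lo r) = u (hi r) then 1 else 0) *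
        kg U n (.e u))
  | psi_sq (r u) : KRel (kg U n (.psi r) * kg U n (.psi r) * kg U n (.e u))
      (Qpol q c (u (lo r)) (u (hi r)) (kg U n (.y (lo r))) (kg U n (.y (hi r))) * kg U n (.e u))
  | braid (r s : Fin (n - 1)) (h : (r : ℕ) + 1 = s) (u) :
      KRel (kg U n (.psi r) * kg U n (.psi s) * kg U n (.psi r) * kg U n (.e u))
        ((kg U n (.psi s) * kg U n (.psi r) * kg U n (.psi s) +
          Bpol q (u (lo r)) (u (hi r)) (u (hi s))
            (kg U n (.y (lo r))) (kg U n (.y (hi r))) (kg U n (.y (hi s)))) * kg U n (.e u))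

end KLRRel

/-- The KLR algebra of rank `n` over `k[[h]]` for the graph `U`, with deformation parameter
`c ∈ k[[h]]`. -/
def KLR (q : k) (c : PowerSeries k) (U : Finset k) (n : ℕ) : Type _ := RingQuot (KRel q c U n)

namespace KLR

variable (q : k) (c : PowerSeries k) (U : Finset k) (n : ℕ)

instance : Ring (KLR q c U n) := inferInstanceAs (Ring (RingQuot (KRel q c U n)))

instance : Algebra (PowerSeries k) (KLR q c U n) :=
  inferInstanceAs (Algebra (PowerSeries k) (RingQuot (KRel q c U n)))

/-- The image of a generator. -/
def gen (g : KGen U n) : KLR q c U n :=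
  RingQuot.mkAlgHom (PowerSeries k) (KRel q c U n) (FreeAlgebra.ι (PowerSeries k) g)

/-- Generators of the ideal `I`: the elements `h` and `y_i`. -/
def idealGens : Set (KLR q c U n) :=
  {algebraMap (PowerSeries k) _ PowerSeries.X} ∪ Set.range fun i : Fin n => gen q c U n (.y i)

/-- The completed KLR algebra. -/
abbrev Hat : Type _ :=
  Compl (PowerSeries k) (idealGens q c U n)

/-- A generator in the completed KLR algebra. -/
abbrev kgen (g : KGen U n) : Hat q c U n :=
  toCompl (PowerSeries k) (idealGens q c U n) (gen q c U n g)

open Classical in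
/-- The vector of the polynomial representation to which `ψ_r` sends `e_u 𝟙`, as an element of the
KLR algebra: `0` if `u_r = u_{r+1}`, `(y_{r+1} - y_r + c) e_{s_r u}` if there is an edge
`u_r ⟶ u_{r+1}`, and `e_{s_r u}` otherwise. -/
def psiOne (r : Fin (n - 1)) (u : Fin n → U) : KLR q c U n :=
  if u (lo r) = u (hi r) then 0
  else if (u (hi r) : k) = q * u (lo r) then
    (gen q c U n (.y (hi r)) - gen q c U n (.y (lo r)) + algebraMap _ _ c) *
      gen q c U n (.e (swp r u))
  else gen q c U n (.e (swp r u))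

/-- The left ideal of the relations of the polynomial representation, which is generated by `𝟙`. -/
def polyIdeal : Submodule (KLR q c U n) (KLR q c U n) :=
  Submodule.span _ (Set.range fun p : Fin (n - 1) × (Fin n → U) =>
    gen q c U n (.psi p.1) * gen q c U n (.e p.2) - psiOne q c U n p.1 p.2)

/-- The completed polynomial representation. -/
abbrev PolyHat : Type _ := ComplCyclic (PowerSeries k) (idealGens q c U n) (polyIdeal q c U n)

/-- The map `x ↦ x 𝟙` to the completed polynomial representation. -/
abbrev toPoly : Hat q c U n →ₗ[Hat q c U n] PolyHat q c U n :=
  toCyclic (PowerSeries k) (idealGens q c U n) (polyIdeal q c U n)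

variable {n}

/-- `k[[h, y_1, …, y_n]]`; the variable with index `none` is `h`. -/
abbrev Ser (k : Type*) (n : ℕ) : Type _ := MvPowerSeries (Option (Fin n)) k

/-- The element of the KLR algebra given by a monomial in `h, y_1, …, y_n` with a coefficient. -/
def term (d : Option (Fin n) →₀ ℕ) (t : k) : KLR q c U n :=
  PowerSeries.monomial (d none) t • (List.ofFn fun i => gen q c U n (.y i) ^ d (some i)).prod

/-- The sum of the terms of total degree less than `m` of a power series in `h, y_1, …, y_n`. -/
def partialSum (f : Ser k n) (m : ℕ) : KLR q c U n :=
  ∑ d ∈ (Finsupp.finite_of_degree_lt m).toFinset, term q c U d (MvPowerSeries.coeff d f)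

theorem term_mem {l : ℕ} (d : Option (Fin n) →₀ ℕ) (hd : l ≤ d.degree) (t : k) :
    term q c U d t ∈ powIdeal (idealGens q c U n) l := by
  have key : ∀ (L : List (Fin n)), (L.map fun i => gen q c U n (.y i) ^ d (some i)).prod ∈
      idealGens q c U n ^ (L.map fun i => d (some i)).sum := by
    intro L
    induction L with
    | nil => simp
    | cons i L ih =>
      simp only [List.map_cons, List.prod_cons, List.sum_cons, pow_add]
      exact Set.mul_mem_mul (Set.pow_mem_pow (Or.inr ⟨i, rfl⟩)) ih
  have hdeg : d.degree = d none + ((List.finRange n).map fun i => d (some i)).sum := by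
    rw [Finsupp.degree_eq_sum, Fintype.sum_option]
    rw [← List.ofFn_eq_map, List.sum_ofFn]
  have hx : (algebraMap (PowerSeries k) (KLR q c U n) PowerSeries.X) ^ d none ∈
      idealGens q c U n ^ d none := Set.pow_mem_pow (Or.inl rfl)
  have hm := Set.mul_mem_mul hx (key (List.finRange n))
  rw [← pow_add] at hm
  replace hm := mem_powIdeal_of_mem_pow (hd.trans hdeg.le) hm
  have : term q c U d t = algebraMap (PowerSeries k) (KLR q c U n) (PowerSeries.C t) *
      ((algebraMap (PowerSeries k) (KLR q c U n) PowerSeries.X) ^ d none *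
        ((List.finRange n).map fun i => gen q c U n (.y i) ^ d (some i)).prod) := by
    rw [term, List.ofFn_eq_map, Algebra.smul_def, ← mul_assoc, ← map_pow, ← map_mul,
      PowerSeries.monomial_eq_mk]
    congr 2
    ext j
    simp [PowerSeries.coeff_X_pow]
  rw [this]
  exact Ideal.mul_mem_left _ _ hm

/-- The value in the completed KLR algebra of a power series in `h, y_1, …, y_n`: modulo
`R · I ^ m · R`, the terms of total degree at least `m` vanish. -/
def ev (f : Ser k n) : Hat q c U n :=
  ⟨fun m => Ideal.Quotient.mk _ (partialSum q c U f m), fun m => ⟨partialSum q c U f m, by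
    intro l hl
    rw [Ideal.Quotient.eq, partialSum, partialSum, ← Finset.sum_sdiff
      (s₁ := (Finsupp.finite_of_degree_lt (σ := Option (Fin n)) l).toFinset)
      (s₂ := (Finsupp.finite_of_degree_lt (σ := Option (Fin n)) m).toFinset)
      (by intro d; simp only [Set.Finite.mem_toFinset, Set.mem_ofPred_eq]; omega),
      add_sub_cancel_right]
    refine Ideal.sum_mem _ fun d hd => term_mem q c U d ?_ _
    simp only [Finset.mem_sdiff, Set.Finite.mem_toFinset, Set.mem_ofPred_eq] at hd
    omega⟩⟩

/-- The power series `b(y_i)`. -/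
def atY (b : PowerSeries k) (i : Fin n) : Ser k n := PowerSeries.subst (MvPowerSeries.X (some i)) b

/-- The power series `d(h)`. -/
def atH (d : PowerSeries k) : Ser k n := PowerSeries.subst (MvPowerSeries.X none) d

variable {U}

/-- The power series `u_i b(y_i)`. -/
def eigen (b : PowerSeries k) (u : Fin n → U) (i : Fin n) : Ser k n :=
  MvPowerSeries.C (u i : k) * atY b i

/-- The fraction
`φ_r = (u_r b(y_r) - 𝗊 u_{r+1} b(y_{r+1})) / (u_{r+1} b(y_{r+1}) - u_r b(y_r))`. -/
def phiFrac (Q b : PowerSeries k) (r : Fin (n - 1)) (u : Fin n → U) : FractionRing (Ser k n) :=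
  algebraMap _ _ (eigen b u (lo r) - atH Q * eigen b u (hi r)) /
    algebraMap _ _ (eigen b u (hi r) - eigen b u (lo r))

open Classical in
/-- The fraction `A_r^u`. -/
def AFrac (Q b : PowerSeries k) (r : Fin (n - 1)) (u : Fin n → U) : FractionRing (Ser k n) :=
  if u (lo r) = u (hi r) then
    phiFrac Q b r u *
      algebraMap _ _ (MvPowerSeries.X (some (hi r)) - MvPowerSeries.X (some (lo r)) : Ser k n)
  else if (u (lo r) : k) = q * u (hi r) then
    phiFrac Q b r u / algebraMap _ _
      (MvPowerSeries.X (some (hi r)) - MvPowerSeries.X (some (lo r)) + atH c : Ser k n)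
  else phiFrac Q b r u

end KLR

end TypeO

end

/-!
The isomorphism is an explicit change of generators over a common commutative subring, the ring
`Col n U` of *coloured power series*: families of power series in `h, y_1, …, y_n`, one for every
weight `u ∈ U ^ n`.

Both completed algebras contain values of coloured power series. In the completed KLR algebra,
`colEv` sends `f` to `∑_u f_u(h, y) e_u`. In the completed affine Hecke algebra, `colVal` is the
extension by continuity of the map that recovers a polynomial in `h, X_1, …, X_n` from its
expansions `X_i = u_i b(y_i)` at the weights: by the Chinese remainder theorem these polynomials are
dense in `Col n U` (`exists_sub_colPoly_mem`), and the polynomials whose expansions vanish to order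
`m` at all weights lie in the `m`-th power of the ideal `𝓘` (`mem_span_pow_of_colPoly`). The
idempotents `e_u` of the affine Hecke algebra are the values of the indicator functions `colE u`.

Over coloured power series, both algebras have relations of the same shape, `IsTwisted`: commutation
relations with a twisted derivation, quadratic relations and braid relations with lower order terms.
The generators are to be related by `T_r = A_r ψ_r + B_r`, with `A_r` an invertible coloured power
series (`exists_isTransition`). In the representations by difference operators on families of
fractions, where `T_r` is a Demazure–Lusztig operator and `ψ_r` a divided difference operator,
this is an identity of rational functions. To carry the relations over to an arbitrary ring, it is
not necessary to know that the polynomial representation is faithful there: by the commutation,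
quadratic and braid relations, the left span of the at most six reduced words in two generators
is stable under the generators, so a relation between the new generators is a combination of
these words. The same holds, with the same coefficients, for the difference operators; there the
words are linearly independent, by the independence of the automorphisms of a field, and the
relation holds, so the coefficients vanish (`IsTwisted.transfer`). To have the same coefficients on
both sides, the argument is run in the product of the two rings. The intertwiner is
`Φ_r = T_r - B_r = A_r ψ_r`.

This provides homomorphisms in both directions, `heckeToKLR` and `klrToHecke`. They agree with the
identity of `Col n U` on the values of coloured power series, by continuity, and hence are mutually
inverse. On the generator of the polynomial representations `T_r = -1` and `ψ_r = κ_r` for a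
coloured power series `κ_r`, and `A_r κ_r + B_r + 1 = 0` (`IsTransition.mul_colKappa`), so that the
isomorphism matches the two left ideals of relations.
-/

noncomputable section

open scoped Pointwise

namespace TypeO

/-! ### Twisted extensions of a commutative ring and local normal forms -/

section Twisted

variable {S B E : Type*} [CommRing S] [Ring B] [Ring E] {N : ℕ}

/-- Quadratic relations, braid relations and commutation relations with scalars, shared by the
affine Hecke algebra and the KLR algebra. The scalars form a commutative ring `S`, mapped to `B` by
`ι`, on which `s r` acts by an endomorphism and `D r` by a twisted derivation; the relations of the
elements `τ r` have the lower order terms `a r`, `b r`, `c r r'` in `S`. -/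
structure IsTwisted (s : Fin N → S →+* S) (D : Fin N → S → S) (a b : Fin N → S)
    (c : Fin N → Fin N → S) (ι : S →+* B) (τ : Fin N → B) : Prop where
  comm : ∀ r f, τ r * ι f = ι (s r f) * τ r + ι (D r f)
  sq : ∀ r, τ r * τ r = ι (a r) * τ r + ι (b r)
  braid : ∀ r r' : Fin N, (r : ℕ) + 1 = r' →
    τ r * τ r' * τ r = τ r' * τ r * τ r' + ι (c r r')
  far : ∀ r r' : Fin N, (r : ℕ) + 1 ≠ r' → (r' : ℕ) + 1 ≠ r → τ r * τ r' = τ r' * τ r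

/-- The reduced words in at most two neighbouring or two distant `τ r` are linearly independent
over `S`. -/
structure IsLocallyFree (ι : S →+* E) (τ : Fin N → E) : Prop where
  one : ∀ r c₀ c₁, ι c₀ + ι c₁ * τ r = 0 → c₀ = 0 ∧ c₁ = 0
  far : ∀ r r' : Fin N, r ≠ r' → (r : ℕ) + 1 ≠ r' → (r' : ℕ) + 1 ≠ r → ∀ c₀ c₁ c₂ c₃,
    ι c₀ + ι c₁ * τ r + ι c₂ * τ r' + ι c₃ * (τ r * τ r') = 0 →
      c₀ = 0 ∧ c₁ = 0 ∧ c₂ = 0 ∧ c₃ = 0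
  braid : ∀ r r' : Fin N, (r : ℕ) + 1 = r' → ∀ c₀ c₁ c₂ c₃ c₄ c₅,
    ι c₀ + ι c₁ * τ r + ι c₂ * τ r' + ι c₃ * (τ r * τ r') + ι c₄ * (τ r' * τ r) +
      ι c₅ * (τ r * τ r' * τ r) = 0 →
      c₀ = 0 ∧ c₁ = 0 ∧ c₂ = 0 ∧ c₃ = 0 ∧ c₄ = 0 ∧ c₅ = 0

/-- The combinations of the words `w i` with coefficients in `S` on the left. -/
def leftSpan {I : Type*} [Fintype I] (ι : S →+* B) (w : I → B) : AddSubgroup B where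
  carrier := {x | ∃ c : I → S, x = ∑ i, ι (c i) * w i}
  zero_mem' := ⟨0, by simp⟩
  add_mem' := by
    rintro _ _ ⟨c, rfl⟩ ⟨c', rfl⟩
    exact ⟨c + c', by simp [add_mul, Finset.sum_add_distrib]⟩
  neg_mem' := by
    rintro _ ⟨c, rfl⟩
    exact ⟨-c, by simp⟩

section leftSpan

variable {I : Type*} [Fintype I] {ι : S →+* B} {w : I → B}

theorem word_mem_leftSpan (i : I) : w i ∈ leftSpan ι w := by
  classical
  exact ⟨Pi.single i 1, by simp [Pi.single_apply, apply_ite ι, ite_mul]⟩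

theorem smul_mem_leftSpan (f : S) {x : B} (hx : x ∈ leftSpan ι w) : ι f * x ∈ leftSpan ι w := by
  obtain ⟨c, rfl⟩ := hx
  exact ⟨fun i => f * c i, by simp [Finset.mul_sum, mul_assoc]⟩

/-- If the products of `t` with the words lie in the left span, and `t` commutes with scalars up to
scalars, then `t` maps the left span to itself. -/
theorem mul_mem_leftSpan {t : B} {s : S → S} {D : S → S}
    (ht : ∀ f, t * ι f = ι (s f) * t + ι (D f)) (hw : ∀ i, t * w i ∈ leftSpan ι w) {x : B}
    (hx : x ∈ leftSpan ι w) : t * x ∈ leftSpan ι w := by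
  obtain ⟨c, rfl⟩ := hx
  rw [Finset.mul_sum]
  refine sum_mem fun i _ => ?_
  rw [← mul_assoc, ht, add_mul, mul_assoc]
  exact add_mem (smul_mem_leftSpan _ (hw i)) (smul_mem_leftSpan _ (word_mem_leftSpan i))

theorem affine_mul_mem_leftSpan {t : B} (ht : ∀ x ∈ leftSpan ι w, t * x ∈ leftSpan ι w) (f g : S) :
    ∀ x ∈ leftSpan ι w, (ι f * t + ι g) * x ∈ leftSpan ι w := by
  intro x hx
  rw [add_mul, mul_assoc]
  exact add_mem (smul_mem_leftSpan _ (ht x hx)) (smul_mem_leftSpan _ hx)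

end leftSpan

variable {s : Fin N → S →+* S} {D : Fin N → S → S} {a b : Fin N → S} {c : Fin N → Fin N → S}
  {ι : S →+* B} {τ : Fin N → B}

namespace IsTwisted

/-- The reduced words in `τ r`. -/
def words₁ (τ : Fin N → B) (r : Fin N) : Fin 2 → B := ![1, τ r]

/-- The reduced words in two distant `τ r`, `τ r'`. -/
def words₂ (τ : Fin N → B) (r r' : Fin N) : Fin 4 → B := ![1, τ r, τ r', τ r * τ r']

/-- The reduced words in two neighbouring `τ r`, `τ r'`. -/
def words₃ (τ : Fin N → B) (r r' : Fin N) : Fin 6 → B :=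
  ![1, τ r, τ r', τ r * τ r', τ r' * τ r, τ r * τ r' * τ r]

/-- By the quadratic relation, the span of the reduced words in `τ r` is stable. -/
theorem mul_mem_words₁ (h : IsTwisted s D a b c ι τ) (r : Fin N) :
    ∀ x ∈ leftSpan ι (words₁ τ r), τ r * x ∈ leftSpan ι (words₁ τ r) := by
  intro x hx
  have h0 : 1 ∈ leftSpan ι (words₁ τ r) := word_mem_leftSpan (w := words₁ τ r) 0
  have h1 : τ r ∈ leftSpan ι (words₁ τ r) := word_mem_leftSpan (w := words₁ τ r) 1
  refine mul_mem_leftSpan (h.comm r) (fun i => ?_) hx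
  fin_cases i
  · simpa [words₁] using h1
  · simpa [words₁, h.sq] using
      add_mem (smul_mem_leftSpan (a r) h1) (smul_mem_leftSpan (b r) h0)

/-- By the quadratic and commutation relations, the span of the reduced words in two distant
generators is stable. -/
theorem mul_mem_words₂ (h : IsTwisted s D a b c ι τ) {r r' : Fin N} (h₁ : (r : ℕ) + 1 ≠ r')
    (h₂ : (r' : ℕ) + 1 ≠ r) :
    (∀ x ∈ leftSpan ι (words₂ τ r r'), τ r * x ∈ leftSpan ι (words₂ τ r r')) ∧
      ∀ x ∈ leftSpan ι (words₂ τ r r'), τ r' * x ∈ leftSpan ι (words₂ τ r r') := by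
  have m0 : 1 ∈ leftSpan ι (words₂ τ r r') := word_mem_leftSpan (w := words₂ τ r r') 0
  have m1 : τ r ∈ leftSpan ι (words₂ τ r r') := word_mem_leftSpan (w := words₂ τ r r') 1
  have m2 : τ r' ∈ leftSpan ι (words₂ τ r r') := word_mem_leftSpan (w := words₂ τ r r') 2
  have m3 : τ r * τ r' ∈ leftSpan ι (words₂ τ r r') := word_mem_leftSpan (w := words₂ τ r r') 3
  have key : ∀ x ∈ leftSpan ι (words₂ τ r r'), τ r * x ∈ leftSpan ι (words₂ τ r r') := by
    refine fun x hx => mul_mem_leftSpan (h.comm r) (fun i => ?_) hx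
    fin_cases i
    · simpa [words₂] using m1
    · simpa [words₂, h.sq] using
        add_mem (smul_mem_leftSpan (a r) m1) (smul_mem_leftSpan (b r) m0)
    · simpa [words₂] using m3
    · have : τ r * (τ r * τ r') = ι (a r) * (τ r * τ r') + ι (b r) * τ r' := by
        rw [← mul_assoc, h.sq, add_mul, mul_assoc]
      simpa [words₂, this] using
        add_mem (smul_mem_leftSpan (a r) m3) (smul_mem_leftSpan (b r) m2)
  refine ⟨key, fun x hx => mul_mem_leftSpan (h.comm r') (fun i => ?_) hx⟩
  have hsq : τ r' * τ r' ∈ leftSpan ι (words₂ τ r r') := by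
    rw [h.sq]
    simpa using add_mem (smul_mem_leftSpan (a r') m2) (smul_mem_leftSpan (b r') m0)
  fin_cases i
  · simpa [words₂] using m2
  · simpa [words₂, ← h.far r r' h₁ h₂] using m3
  · simpa [words₂] using hsq
  · have : τ r' * (τ r * τ r') = τ r * (τ r' * τ r') := by
      rw [← mul_assoc, ← h.far r r' h₁ h₂, mul_assoc]
    simpa [words₂, this] using key _ hsq

/-- By the quadratic and braid relations, the span of the reduced words in two neighbouring
generators is stable. -/
theorem mul_mem_words₃ (h : IsTwisted s D a b c ι τ) {r r' : Fin N} (h₁ : (r : ℕ) + 1 = r') :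
    (∀ x ∈ leftSpan ι (words₃ τ r r'), τ r * x ∈ leftSpan ι (words₃ τ r r')) ∧
      ∀ x ∈ leftSpan ι (words₃ τ r r'), τ r' * x ∈ leftSpan ι (words₃ τ r r') := by
  set M := leftSpan ι (words₃ τ r r') with hM
  have m0 : 1 ∈ M := word_mem_leftSpan (w := words₃ τ r r') 0
  have m1 : τ r ∈ M := word_mem_leftSpan (w := words₃ τ r r') 1
  have m2 : τ r' ∈ M := word_mem_leftSpan (w := words₃ τ r r') 2
  have m3 : τ r * τ r' ∈ M := word_mem_leftSpan (w := words₃ τ r r') 3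
  have m4 : τ r' * τ r ∈ M := word_mem_leftSpan (w := words₃ τ r r') 4
  have m5 : τ r * τ r' * τ r ∈ M := word_mem_leftSpan (w := words₃ τ r r') 5
  have sm : ∀ f, ∀ x ∈ M, ι f * x ∈ M := fun f x hx => smul_mem_leftSpan f hx
  have sq : ∀ t x, τ t * (τ t * x) = ι (a t) * (τ t * x) + ι (b t) * x := by
    intro t x
    rw [← mul_assoc, h.sq, add_mul, mul_assoc]
  have key : ∀ x ∈ M, τ r * x ∈ M := by
    refine fun x hx => mul_mem_leftSpan (h.comm r) (fun i => ?_) hx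
    change _ ∈ M
    fin_cases i
    · simpa [words₃] using m1
    · simpa [words₃, h.sq] using
        add_mem (sm (a r) _ m1) (sm (b r) _ m0)
    · simpa [words₃] using m3
    · simpa [words₃, sq] using
        add_mem (sm (a r) _ m3) (sm (b r) _ m2)
    · simpa [words₃, mul_assoc] using m5
    · simpa [words₃, sq, mul_assoc] using
        add_mem (sm (a r) _ m5) (sm (b r) _ m4)
  refine ⟨key, fun x hx => mul_mem_leftSpan (h.comm r') (fun i => ?_) hx⟩
  have hbr : τ r' * (τ r * τ r') = τ r * τ r' * τ r - ι (c r r') := by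
    rw [h.braid r r' h₁, add_sub_cancel_right, mul_assoc]
  have hc : ι (c r r') ∈ M := by simpa using sm (c r r') _ m0
  change _ ∈ M
  fin_cases i
  · simpa [words₃] using m2
  · simpa [words₃] using m4
  · simpa [words₃, h.sq] using
      add_mem (sm (a r') _ m2) (sm (b r') _ m0)
  · simpa [words₃, hbr] using sub_mem m5 hc
  · simpa [words₃, sq] using
      add_mem (sm (a r') _ m4) (sm (b r') _ m1)
  -- `τ r' (τ r τ r' τ r) = (τ r τ r' τ r) τ r` up to lower order terms
  · have e1 : τ r' * (τ r * τ r' * τ r) = τ r * (τ r' * (τ r * τ r)) - ι (c r r') * τ r := by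
      rw [← mul_assoc, hbr, sub_mul]
      simp only [mul_assoc]
    have e2 : τ r' * (τ r * τ r) = ι (s r' (a r)) * (τ r' * τ r) + ι (D r' (a r)) * τ r +
        (ι (s r' (b r)) * τ r' + ι (D r' (b r)) * 1) := by
      rw [h.sq, mul_add, ← mul_assoc, h.comm, h.comm, add_mul, mul_assoc, mul_one]
    have m6 : τ r' * (τ r * τ r) ∈ M := by
      rw [e2]
      exact add_mem (add_mem (sm _ _ m4) (sm _ _ m1))
        (add_mem (sm _ _ m2) (sm _ _ m0))
    have := sub_mem (key _ m6) (sm (c r r') _ m1)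
    rw [← e1] at this
    simpa [words₃] using this

theorem prod (h : IsTwisted s D a b c ι τ) {ιE : S →+* E} {τE : Fin N → E}
    (hE : IsTwisted s D a b c ιE τE) :
    IsTwisted s D a b c (ι.prod ιE) fun r => (τ r, τE r) where
  comm r f := Prod.ext (h.comm r f) (hE.comm r f)
  sq r := Prod.ext (h.sq r) (hE.sq r)
  braid r r' h₁ := Prod.ext (h.braid r r' h₁) (hE.braid r r' h₁)
  far r r' h₁ h₂ := Prod.ext (h.far r r' h₁ h₂) (hE.far r r' h₁ h₂)

/-- Transfer of relations. The relations of the `A r τ r + C r` follow from those of the `τ r` as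
soon as they do so in one ring `E` in which the reduced words are independent: the difference of the
two sides of a relation has, in `B × E`, a normal form, whose coefficients vanish since they do so
in the component `E`. -/
theorem transfer (h : IsTwisted s D a b c ι τ) {ιE : S →+* E} {τE : Fin N → E}
    (hE : IsTwisted s D a b c ιE τE) (hfree : IsLocallyFree ιE τE) {A C : Fin N → S}
    {D' : Fin N → S → S} {a' b' : Fin N → S} {c' : Fin N → Fin N → S}
    (hE' : IsTwisted s D' a' b' c' ιE fun r => ιE (A r) * τE r + ιE (C r)) :
    IsTwisted s D' a' b' c' ι fun r => ι (A r) * τ r + ι (C r) := by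
  have hP := h.prod hE
  -- an element of the span of the words in `B × E` vanishes if its component in `E` does
  have zero₁ : ∀ r, ∀ x ∈ leftSpan (ι.prod ιE) (words₁ (fun r => (τ r, τE r)) r),
      x.2 = 0 → x.1 = 0 := by
    rintro r x ⟨d, rfl⟩ hx
    simp only [Fin.sum_univ_succ, words₁] at hx ⊢
    simp at hx ⊢
    obtain ⟨h0, h1⟩ := hfree.one r _ _ hx
    simp [h0, h1]
  have zero₂ : ∀ r r' : Fin N, r ≠ r' → (r : ℕ) + 1 ≠ r' → (r' : ℕ) + 1 ≠ r →
      ∀ x ∈ leftSpan (ι.prod ιE) (words₂ (fun r => (τ r, τE r)) r r'), x.2 = 0 → x.1 = 0 := by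
    rintro r r' h₀ h₁ h₂ x ⟨d, rfl⟩ hx
    simp only [Fin.sum_univ_four, words₂] at hx ⊢
    simp at hx ⊢
    obtain ⟨h0, h1, h2, h3⟩ := hfree.far r r' h₀ h₁ h₂ _ _ _ _ hx
    simp [h0, h1, h2, h3]
  have zero₃ : ∀ r r' : Fin N, (r : ℕ) + 1 = r' →
      ∀ x ∈ leftSpan (ι.prod ιE) (words₃ (fun r => (τ r, τE r)) r r'), x.2 = 0 → x.1 = 0 := by
    rintro r r' h₁ x ⟨d, rfl⟩ hx
    simp only [Fin.sum_univ_six, words₃] at hx ⊢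
    simp at hx ⊢
    obtain ⟨h0, h1, h2, h3, h4, h5⟩ := hfree.braid r r' h₁ _ _ _ _ _ _ hx
    simp [h0, h1, h2, h3, h4, h5]
  set j := ι.prod ιE with hj
  set t : Fin N → B × E := fun r => (τ r, τE r) with ht
  refine ⟨fun r f => ?_, fun r => ?_, fun r r' h₁ => ?_, fun r r' h₁ h₂ => ?_⟩
  -- in each case the difference of the two sides, applied to the word `1`, lies in the span
  · have m0 : 1 ∈ leftSpan j (words₁ t r) := word_mem_leftSpan (w := words₁ t r) 0
    have hτ := affine_mul_mem_leftSpan (hP.mul_mem_words₁ r) (A r) (C r)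
    have hf := smul_mem_leftSpan (ι := j) (w := words₁ t r) f m0
    have hD := smul_mem_leftSpan (ι := j) (w := words₁ t r) (D' r f) m0
    have := zero₁ r _ (sub_mem (hτ _ hf) (add_mem (smul_mem_leftSpan (s r f) (hτ _ m0)) hD)) (by
      have := hE'.comm r f
      simpa [hj, ht, sub_eq_zero] using this)
    simpa [hj, ht, sub_eq_zero] using this
  · have m0 : 1 ∈ leftSpan j (words₁ t r) := word_mem_leftSpan (w := words₁ t r) 0
    have hτ := affine_mul_mem_leftSpan (hP.mul_mem_words₁ r) (A r) (C r)
    have hD := smul_mem_leftSpan (ι := j) (w := words₁ t r) (b' r) m0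
    have := zero₁ r _ (sub_mem (hτ _ (hτ _ m0))
      (add_mem (smul_mem_leftSpan (a' r) (hτ _ m0)) hD)) (by
      have := hE'.sq r
      simpa [hj, ht, sub_eq_zero] using this)
    simpa [hj, ht, sub_eq_zero] using this
  · have m0 : 1 ∈ leftSpan j (words₃ t r r') := word_mem_leftSpan (w := words₃ t r r') 0
    have hτ := affine_mul_mem_leftSpan (hP.mul_mem_words₃ h₁).1 (A r) (C r)
    have hτ' := affine_mul_mem_leftSpan (hP.mul_mem_words₃ h₁).2 (A r') (C r')
    have hD := smul_mem_leftSpan (ι := j) (w := words₃ t r r') (c' r r') m0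
    have := zero₃ r r' h₁ _ (sub_mem (hτ _ (hτ' _ (hτ _ m0)))
      (add_mem (hτ' _ (hτ _ (hτ' _ m0))) hD)) (by
      have := hE'.braid r r' h₁
      simpa [hj, ht, sub_eq_zero, mul_assoc] using this)
    simpa [hj, ht, sub_eq_zero, mul_assoc] using this
  · obtain rfl | h₀ := eq_or_ne r r'
    · rfl
    have m0 : 1 ∈ leftSpan j (words₂ t r r') := word_mem_leftSpan (w := words₂ t r r') 0
    have hτ := affine_mul_mem_leftSpan (hP.mul_mem_words₂ h₁ h₂).1 (A r) (C r)
    have hτ' := affine_mul_mem_leftSpan (hP.mul_mem_words₂ h₁ h₂).2 (A r') (C r')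
    have := zero₂ r r' h₀ h₁ h₂ _ (sub_mem (hτ _ (hτ' _ m0)) (hτ' _ (hτ _ m0))) (by
      have := hE'.far r r' h₁ h₂
      simpa [hj, ht, sub_eq_zero] using this)
    simpa [hj, ht, sub_eq_zero] using this

end IsTwisted

end Twisted

/-! ### Difference operators on coloured functions -/

section Operators

variable {n : ℕ} {α L : Type*} [Field L]

/-- The permutation exchanging the strands `r` and `r + 1`. -/
def adj (r : Fin (n - 1)) : Equiv.Perm (Fin n) := Equiv.swap (lo r) (hi r)

theorem lo_ne_hi (r : Fin (n - 1)) : lo r ≠ hi r := by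
  simp [lo, hi, Fin.ext_iff]

@[simp] theorem adj_lo (r : Fin (n - 1)) : adj r (lo r) = hi r := Equiv.swap_apply_left _ _

@[simp] theorem adj_hi (r : Fin (n - 1)) : adj r (hi r) = lo r := Equiv.swap_apply_right _ _

theorem adj_of_ne {r : Fin (n - 1)} {i : Fin n} (h₁ : i ≠ lo r) (h₂ : i ≠ hi r) : adj r i = i :=
  Equiv.swap_apply_of_ne_of_ne h₁ h₂

theorem adj_mul_self (r : Fin (n - 1)) : adj r * adj r = 1 := Equiv.swap_mul_self _ _

theorem hi_eq_lo {r r' : Fin (n - 1)} (h : (r : ℕ) + 1 = r') : hi r = lo r' := by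
  simp [lo, hi, h]

/-- The action of permutations of the strands on coloured functions that is induced by an action on
the values: it permutes the colours and the values simultaneously. -/
def act {R : Type*} [CommRing R] (σ : Equiv.Perm (Fin n) →* RingAut R) (w : Equiv.Perm (Fin n)) :
    ((Fin n → α) → R) →+* ((Fin n → α) → R) where
  toFun f u := σ w (f (u ∘ w))
  map_zero' := by ext; simp
  map_one' := by ext; simp
  map_add' _ _ := by ext; simp
  map_mul' _ _ := by ext; simp

variable (σ : Equiv.Perm (Fin n) →* RingAut L)

theorem act_apply {R : Type*} [CommRing R] (σ : Equiv.Perm (Fin n) →* RingAut R)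
    (w : Equiv.Perm (Fin n)) (f : (Fin n → α) → R) (u : Fin n → α) :
    act σ w f u = σ w (f (u ∘ w)) := rfl

theorem act_mul {R : Type*} [CommRing R] (σ : Equiv.Perm (Fin n) →* RingAut R)
    (w w' : Equiv.Perm (Fin n)) (f : (Fin n → α) → R) :
    act σ (w * w') f = act σ w (act σ w' f) := by
  ext u
  simp [act_apply, Function.comp_assoc]

theorem act_one {R : Type*} [CommRing R] (σ : Equiv.Perm (Fin n) →* RingAut R)
    (f : (Fin n → α) → R) : act σ 1 f = f := by
  ext u
  simp [act_apply]

theorem act_adj_adj {R : Type*} [CommRing R] (σ : Equiv.Perm (Fin n) →* RingAut R)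
    (r : Fin (n - 1)) (f : (Fin n → α) → R) :
    act σ (adj r) (act σ (adj r) f) = f := by
  rw [← act_mul, adj_mul_self, act_one]

/-- Multiplication operators on coloured functions. -/
abbrev mulOp : ((Fin n → α) → L) →+* AddMonoid.End ((Fin n → α) → L) := Module.toAddMonoidEnd _ _

/-- The action of a permutation, as an operator on coloured functions. -/
def permOp (w : Equiv.Perm (Fin n)) : AddMonoid.End ((Fin n → α) → L) := (act σ w).toAddMonoidHom

/-- The operator `P_{r,r+1} s_r + M_{r,r+1}` on coloured functions. -/
def diffOp (P M : Fin n → Fin n → (Fin n → α) → L) (r : Fin (n - 1)) :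
    AddMonoid.End ((Fin n → α) → L) :=
  mulOp (P (lo r) (hi r)) * permOp σ (adj r) + mulOp (M (lo r) (hi r))

theorem op_ext {x y : AddMonoid.End ((Fin n → α) → L)} (h : ∀ g u, x g u = y g u) : x = y :=
  DFunLike.ext _ _ fun g => funext (h g)

theorem op_add_apply (x y : AddMonoid.End ((Fin n → α) → L)) (g : (Fin n → α) → L) :
    (x + y) g = x g + y g := rfl

theorem op_mul_apply (x y : AddMonoid.End ((Fin n → α) → L)) (g : (Fin n → α) → L) :
    (x * y) g = x (y g) := rfl

theorem mulOp_apply (f g : (Fin n → α) → L) : mulOp f g = f * g := rfl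

theorem permOp_apply (w : Equiv.Perm (Fin n)) (g : (Fin n → α) → L) :
    permOp σ w g = act σ w g := rfl

theorem permOp_mul (w w' : Equiv.Perm (Fin n)) :
    permOp (α := α) σ (w * w') = permOp σ w * permOp σ w' := by
  refine op_ext fun g u => ?_
  exact congrFun (act_mul σ w w' g) u

theorem diffOp_apply (P M : Fin n → Fin n → (Fin n → α) → L) (r : Fin (n - 1))
    (g : (Fin n → α) → L) :
    diffOp σ P M r g = P (lo r) (hi r) * act σ (adj r) g + M (lo r) (hi r) * g := rfl

theorem sum_op_apply {N : ℕ} {G : Type*} [AddCommGroup G] (x : Fin N → AddMonoid.End G) (g : G) :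
    (∑ i, x i) g = ∑ i, x i g :=
  map_sum (AddMonoidHom.eval g : AddMonoid.End G →+ G) x Finset.univ

/-- Dedekind's independence of characters, for coloured functions. -/
theorem mulOp_permOp_independent (hσ : Function.Injective σ) {N : ℕ}
    {w : Fin N → Equiv.Perm (Fin n)} (hw : Function.Injective w) {d : Fin N → (Fin n → α) → L}
    (h : ∑ i, mulOp (d i) * permOp σ (w i) = 0) (i : Fin N) : d i = 0 := by
  have hinj : Function.Injective fun i => ((σ (w i) : L ≃+* L) : L →* L) := by
    intro i j hij
    refine hw (hσ (RingEquiv.ext fun z => ?_))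
    exact DFunLike.congr_fun hij z
  have hli := (linearIndependent_monoidHom L L).comp _ hinj
  rw [Fintype.linearIndependent_iff] at hli
  ext u
  refine hli (fun i => d i u) (funext fun z => ?_) i
  have := congrFun (DFunLike.congr_fun h (fun _ => z)) u
  rw [sum_op_apply] at this
  simpa [mulOp_apply, permOp_apply, act_apply] using this

/-- A family of coloured functions indexed by pairs of strands and permuted accordingly. -/
def IsEquivariant (P : Fin n → Fin n → (Fin n → α) → L) : Prop :=
  ∀ w i j, act σ w (P i j) = P (w i) (w j)

section free

variable {σ} {P M : Fin n → Fin n → (Fin n → α) → L}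

theorem eq_zero_of_mul_eq_zero {f g : (Fin n → α) → L} (hg : ∀ u, g u ≠ 0) (h : f * g = 0) :
    f = 0 := by
  ext u
  exact (mul_eq_zero.1 (congrFun h u)).resolve_right (hg u)

theorem act_ne_zero {f : (Fin n → α) → L} (hf : ∀ u, f u ≠ 0) (w : Equiv.Perm (Fin n))
    (u : Fin n → α) : act σ w f u ≠ 0 := by
  simpa [act_apply] using hf _

/-- Reduced words in difference operators are triangular with respect to the permutations, with
invertible diagonal coefficients, and therefore independent. -/
theorem isLocallyFree_diffOp (hσ : Function.Injective σ)
    (hP : ∀ i j, i ≠ j → ∀ u, P i j u ≠ 0) : IsLocallyFree mulOp (diffOp σ P M) := by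
  refine ⟨fun r c₀ c₁ h => ?_, fun r r' h₀ h₁ h₂ c₀ c₁ c₂ c₃ h => ?_,
    fun r r' h₁ c₀ c₁ c₂ c₃ c₄ c₅ h => ?_⟩
  · have hp := hP _ _ (lo_ne_hi r)
    have hw : Function.Injective ![1, adj r] := by
      intro i j hij
      have := DFunLike.congr_fun hij (lo r)
      have e1 := lo_ne_hi r
      have e2 := e1.symm
      clear hij
      fin_cases i <;> fin_cases j <;> simp_all
    have := mulOp_permOp_independent σ hσ hw (d := ![c₀ + c₁ * M (lo r) (hi r),
      c₁ * P (lo r) (hi r)]) (by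
      rw [← h]
      refine op_ext fun g u => ?_
      simp [op_add_apply, op_mul_apply, diffOp_apply, mulOp_apply, permOp_apply, act_apply]
      ring)
    have h1 : c₁ = 0 := eq_zero_of_mul_eq_zero hp (this 1)
    have h0 := this 0
    simp [h1] at h0
    exact ⟨h0, h1⟩
  · have hp := hP _ _ (lo_ne_hi r)
    have hp' := hP _ _ (lo_ne_hi r')
    have n1 := lo_ne_hi r
    have n2 := lo_ne_hi r'
    have n3 : lo r ≠ lo r' := by simpa [lo, Fin.ext_iff] using h₀
    have n4 : lo r ≠ hi r' := by simp [lo, hi, Fin.ext_iff]; omega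
    have n5 : hi r ≠ lo r' := by simp [lo, hi, Fin.ext_iff]; omega
    have n6 : hi r ≠ hi r' := by simpa [hi, Fin.ext_iff] using h₀
    have s1 := adj_of_ne n3 n4
    have s2 := adj_of_ne n5 n6
    have s3 := adj_of_ne n3.symm n5.symm
    have s4 := adj_of_ne n4.symm n6.symm
    have hw : Function.Injective ![1, adj r, adj r', adj r * adj r'] := by
      intro i j hij
      have e1 := DFunLike.congr_fun hij (lo r)
      have e2 := DFunLike.congr_fun hij (lo r')
      have n1' := n1.symm
      have n2' := n2.symm
      clear hij
      fin_cases i <;> fin_cases j <;> simp_all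
    -- the entries are the coefficients of `1`, `s_r`, `s_r'`, `s_r s_r'` after multiplying out
    have := mulOp_permOp_independent σ hσ hw (d := ![
      c₀ + c₁ * M (lo r) (hi r) + c₂ * M (lo r') (hi r') + c₃ * M (lo r) (hi r) * M (lo r') (hi r'),
      c₁ * P (lo r) (hi r) + c₃ * P (lo r) (hi r) * act σ (adj r) (M (lo r') (hi r')),
      c₂ * P (lo r') (hi r') + c₃ * M (lo r) (hi r) * P (lo r') (hi r'),
      c₃ * (P (lo r) (hi r) * act σ (adj r) (P (lo r') (hi r')))]) (by
      rw [← h]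
      refine op_ext fun g u => ?_
      simp [op_add_apply, op_mul_apply, Fin.sum_univ_four, diffOp_apply, mulOp_apply, permOp_apply,
        permOp_mul, act_one]
      ring)
    have h3 : c₃ = 0 := eq_zero_of_mul_eq_zero
      (fun u => mul_ne_zero (hp u) (act_ne_zero hp' _ u)) (this 3)
    have h2 := this 2
    have h1 := this 1
    have h0 := this 0
    simp [h3] at h2 h1 h0
    have h2 := eq_zero_of_mul_eq_zero hp' h2
    have h1 := eq_zero_of_mul_eq_zero hp h1
    simp [h1, h2] at h0
    exact ⟨h0, h1, h2, h3⟩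
  · have hp := hP _ _ (lo_ne_hi r)
    have hp' := hP _ _ (lo_ne_hi r')
    have hij := lo_ne_hi r
    have hjk := lo_ne_hi r'
    have hik : lo r ≠ hi r' := by simp [lo, hi, Fin.ext_iff]; omega
    rw [← hi_eq_lo h₁] at hjk hp'
    have s1 : adj r' (lo r) = lo r := adj_of_ne (by rwa [← hi_eq_lo h₁]) hik
    have s2 : adj r (hi r') = hi r' := adj_of_ne hik.symm hjk.symm
    have s3 : adj r' (hi r) = hi r' := by rw [hi_eq_lo h₁, adj_lo]
    have s4 : adj r' (hi r') = hi r := by rw [hi_eq_lo h₁, adj_hi]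
    have hw : Function.Injective
        ![1, adj r, adj r', adj r * adj r', adj r' * adj r, adj r * adj r' * adj r] := by
      intro i j hij'
      have e1 := DFunLike.congr_fun hij' (lo r)
      have e2 := DFunLike.congr_fun hij' (hi r)
      have n1 := hij.symm
      have n2 := hik.symm
      have n3 := hjk.symm
      clear hp hp' hP h hσ hij'
      fin_cases i <;> fin_cases j <;> simp_all
    -- the entries are the coefficients of the six permutations after multiplying out
    have := mulOp_permOp_independent σ hσ hw (d := ![
      c₀ + c₁ * M (lo r) (hi r) + c₂ * M (lo r') (hi r') + c₃ * M (lo r) (hi r) * M (lo r') (hi r')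
        + c₄ * M (lo r') (hi r') * M (lo r) (hi r) + c₅ * (M (lo r) (hi r) * M (lo r') (hi r') *
          M (lo r) (hi r) + P (lo r) (hi r) * act σ (adj r) (M (lo r') (hi r') * P (lo r) (hi r))),
      c₁ * P (lo r) (hi r) + c₃ * P (lo r) (hi r) * act σ (adj r) (M (lo r') (hi r')) +
        c₄ * M (lo r') (hi r') * P (lo r) (hi r) + c₅ * (P (lo r) (hi r) *
          act σ (adj r) (M (lo r') (hi r') * M (lo r) (hi r)) +
            M (lo r) (hi r) * M (lo r') (hi r') * P (lo r) (hi r)),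
      c₂ * P (lo r') (hi r') + c₃ * M (lo r) (hi r) * P (lo r') (hi r') +
        c₄ * P (lo r') (hi r') * act σ (adj r') (M (lo r) (hi r)) +
        c₅ * M (lo r) (hi r) * P (lo r') (hi r') * act σ (adj r') (M (lo r) (hi r)),
      c₃ * (P (lo r) (hi r) * act σ (adj r) (P (lo r') (hi r'))) +
        c₅ * P (lo r) (hi r) * act σ (adj r) (P (lo r') (hi r') *
          act σ (adj r') (M (lo r) (hi r))),
      c₄ * (P (lo r') (hi r') * act σ (adj r') (P (lo r) (hi r))) +
        c₅ * M (lo r) (hi r) * P (lo r') (hi r') * act σ (adj r') (P (lo r) (hi r)),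
      c₅ * (P (lo r) (hi r) * act σ (adj r) (P (lo r') (hi r') *
        act σ (adj r') (P (lo r) (hi r))))]) (by
      rw [← h]
      refine op_ext fun g u => ?_
      simp [op_add_apply, op_mul_apply, Fin.sum_univ_six, diffOp_apply, mulOp_apply, permOp_apply,
        permOp_mul, act_one, act_adj_adj, mul_add, add_mul]
      ring)
    rw [hi_eq_lo h₁] at hp'
    have h5 : c₅ = 0 := eq_zero_of_mul_eq_zero (fun u => mul_ne_zero (hp u)
      (act_ne_zero (fun u => mul_ne_zero (hp' u) (act_ne_zero hp _ u)) _ u)) (this 5)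
    have h4 := this 4
    have h3 := this 3
    have h2 := this 2
    have h1 := this 1
    have h0 := this 0
    simp [h5] at h4 h3 h2 h1 h0
    have h4 := eq_zero_of_mul_eq_zero
      (fun u => mul_ne_zero (hp' u) (act_ne_zero hp (adj r') u)) h4
    have h3 := eq_zero_of_mul_eq_zero
      (fun u => mul_ne_zero (hp u) (act_ne_zero hp' (adj r) u)) h3
    simp [h4, h3] at h2 h1 h0
    have h2 := eq_zero_of_mul_eq_zero hp' h2
    have h1 := eq_zero_of_mul_eq_zero hp h1
    simp [h1, h2] at h0
    exact ⟨h0, h1, h2, h3, h4, h5⟩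

/-- Criterion for the difference operators of an equivariant pair `P`, `M` to satisfy quadratic and
braid relations. The hypotheses are what remains of these relations after comparing the coefficients
of the permutations. -/
theorem isTwisted_diffOp (hP : IsEquivariant σ P) (hM : IsEquivariant σ M)
    {a b : Fin n → Fin n → (Fin n → α) → L} {c : Fin n → Fin n → Fin n → (Fin n → α) → L}
    (ha : ∀ i j, i ≠ j → M j i + M i j = a i j)
    (hb : ∀ i j, i ≠ j → P i j * P j i + M i j * M i j = a i j * M i j + b i j)
    (h₁ : ∀ i j l, i ≠ j → i ≠ l → j ≠ l →
      P i j * (M i l * M j i + M i j * M j l) = P i j * (M j l * M i l))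
    (h₂ : ∀ i j l, i ≠ j → i ≠ l → j ≠ l →
      P j l * (M i l * M l j + M j l * M i j) = P j l * (M i j * M i l))
    (hc : ∀ i j l, i ≠ j → i ≠ l → j ≠ l →
      M i j * M j l * M i j + P i j * M i l * P j i =
        M j l * M i j * M j l + P j l * M i l * P l j + c i j l) :
    IsTwisted (fun r => act σ (adj r)) (fun r f => M (lo r) (hi r) * (f - act σ (adj r) f))
      (fun r => a (lo r) (hi r)) (fun r => b (lo r) (hi r))
      (fun r r' => c (lo r) (hi r) (hi r')) mulOp (diffOp σ P M) := by
  refine ⟨fun r f => ?_, fun r => ?_, fun r r' h => ?_, fun r r' h h' => ?_⟩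
  · refine op_ext fun g u => ?_
    simp [op_add_apply, op_mul_apply, diffOp_apply, mulOp_apply, -map_sub]
    ring
  · refine op_ext fun g u => ?_
    have e1 := congrFun (ha _ _ (lo_ne_hi r)) u
    have e2 := congrFun (hb _ _ (lo_ne_hi r)) u
    simp only [Pi.add_apply, Pi.mul_apply] at e1 e2
    simp [op_add_apply, op_mul_apply, diffOp_apply, mulOp_apply, act_adj_adj, hP _ _ _, hM _ _ _]
    linear_combination (P (lo r) (hi r) u * act σ (adj r) g u) * e1 + g u * e2
  · refine op_ext fun g u => ?_
    have hij := lo_ne_hi r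
    have hjk := lo_ne_hi r'
    have hik : lo r ≠ hi r' := by simp [lo, hi, Fin.ext_iff]; omega
    rw [← hi_eq_lo h] at hjk
    have s1 : adj r' (lo r) = lo r := adj_of_ne (by rwa [← hi_eq_lo h]) hik
    have s2 : adj r (hi r') = hi r' := adj_of_ne hik.symm hjk.symm
    have s3 : adj r' (hi r) = hi r' := by rw [hi_eq_lo h, adj_lo]
    have s4 : adj r' (hi r') = hi r := by rw [hi_eq_lo h, adj_hi]
    have e1 := congrFun (h₁ _ _ _ hij hik hjk) u
    have e2 := congrFun (h₂ _ _ _ hij hik hjk) u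
    have e3 := congrFun (hc _ _ _ hij hik hjk) u
    have hbr : adj r * (adj r' * adj r) = adj r' * (adj r * adj r') := by
      rw [adj, adj, ← hi_eq_lo h, ← mul_assoc, ← mul_assoc, Equiv.swap_comm (lo r) (hi r),
        Equiv.swap_comm (hi r) (hi r'), Equiv.swap_mul_swap_mul_swap hjk.symm hik.symm,
        Equiv.swap_comm (hi r') (hi r), Equiv.swap_comm (hi r) (lo r),
        Equiv.swap_mul_swap_mul_swap hij hik, Equiv.swap_comm]
    have e4 : act σ (adj r) (act σ (adj r') (act σ (adj r) g)) u =
        act σ (adj r') (act σ (adj r) (act σ (adj r') g)) u := by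
      rw [← act_mul, ← act_mul, ← act_mul, ← act_mul, mul_assoc, mul_assoc, hbr]
    simp only [Pi.add_apply, Pi.mul_apply] at e1 e2 e3
    have t : ∀ i j l, act σ i (P j l) = P (i j) (i l) := hP
    have t' : ∀ i j l, act σ i (M j l) = M (i j) (i l) := hM
    simp [op_add_apply, op_mul_apply, diffOp_apply, mulOp_apply, act_adj_adj, ← hi_eq_lo h, t, t',
      s1, s2, s3, s4, e4]
    linear_combination (act σ (adj r) g u) * e1 - (act σ (adj r') g u) * e2 + g u * e3
  · obtain rfl | h₀ := eq_or_ne r r'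
    · rfl
    refine op_ext fun g u => ?_
    have n3 : lo r ≠ lo r' := by simpa [lo, Fin.ext_iff] using h₀
    have n4 : lo r ≠ hi r' := by simp [lo, hi, Fin.ext_iff]; omega
    have n5 : hi r ≠ lo r' := by simp [lo, hi, Fin.ext_iff]; omega
    have n6 : hi r ≠ hi r' := by simpa [hi, Fin.ext_iff] using h₀
    have e : act σ (adj r) (act σ (adj r') g) = act σ (adj r') (act σ (adj r) g) := by
      rw [← act_mul, ← act_mul, adj, adj,
        (Equiv.Perm.disjoint_swap_swap (by simp_all [lo_ne_hi])).commute.eq]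
    have t : ∀ i j l, act σ i (P j l) = P (i j) (i l) := hP
    have t' : ∀ i j l, act σ i (M j l) = M (i j) (i l) := hM
    simp [op_mul_apply, diffOp_apply, t, t', e, adj_of_ne n3 n4, adj_of_ne n5 n6,
      adj_of_ne n3.symm n5.symm, adj_of_ne n4.symm n6.symm]
    ring

end free

end Operators

/-! ### Power series in several variables -/

section PowerSeries

variable {R : Type*} [CommRing R] {ν : Type*}

/-- The ideal of the power series without terms of total degree less than `N`. -/
def vanish (N : ℕ) : Ideal (MvPowerSeries ν R) where
  carrier := {f | (N : ℕ∞) ≤ f.order}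
  zero_mem' := by simp
  add_mem' hf hg := (le_min hf hg).trans MvPowerSeries.min_order_le_add
  smul_mem' c f hf := by
    rw [smul_eq_mul]
    exact (le_add_left hf).trans MvPowerSeries.le_order_mul

theorem mem_vanish {N : ℕ} {f : MvPowerSeries ν R} : f ∈ vanish N ↔ (N : ℕ∞) ≤ f.order := Iff.rfl

theorem mem_vanish_iff {N : ℕ} {f : MvPowerSeries ν R} :
    f ∈ vanish N ↔ ∀ d : ν →₀ ℕ, d.degree < N → MvPowerSeries.coeff d f = 0 :=
  ⟨fun h _ hd => MvPowerSeries.coeff_of_lt_order (lt_of_lt_of_le (by exact_mod_cast hd) h),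
    MvPowerSeries.nat_le_order⟩

theorem mem_vanish_one {f : MvPowerSeries ν R} :
    f ∈ vanish 1 ↔ MvPowerSeries.constantCoeff f = 0 := by
  rw [mem_vanish, Nat.cast_one, MvPowerSeries.one_le_order_iff_constCoeff_eq_zero]

theorem mul_mem_vanish {M N : ℕ} {f g : MvPowerSeries ν R} (hf : f ∈ vanish M)
    (hg : g ∈ vanish N) : f * g ∈ vanish (M + N) := by
  rw [mem_vanish] at *
  push_cast
  exact (add_le_add hf hg).trans MvPowerSeries.le_order_mul

theorem vanish_mono {M N : ℕ} (h : M ≤ N) {f : MvPowerSeries ν R} (hf : f ∈ vanish N) :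
    f ∈ vanish M := by
  rw [mem_vanish] at *
  exact le_trans (by exact_mod_cast h) hf

theorem pow_mem_vanish {f : MvPowerSeries ν R} (hf : f ∈ vanish 1) (N : ℕ) :
    f ^ N ∈ vanish N := by
  induction N with
  | zero => simp [mem_vanish]
  | succ N ih => simpa [pow_succ] using mul_mem_vanish ih hf

theorem sub_truncTotal_mem_vanish [Finite ν] (N : ℕ) (f : MvPowerSeries ν R) :
    f - (f.truncTotal N : MvPolynomial ν R) ∈ vanish N := by
  rw [mem_vanish_iff]
  intro d hd
  rw [map_sub, MvPolynomial.coeff_coe, MvPowerSeries.coeff_truncTotal _ hd, sub_self]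

theorem subst_mem_vanish [Finite ν] {a : ν → MvPowerSeries ν R}
    (ha : ∀ i, MvPowerSeries.constantCoeff (a i) = 0) {N : ℕ} {f : MvPowerSeries ν R}
    (hf : f ∈ vanish N) : f.subst a ∈ vanish N := by
  rw [mem_vanish] at *
  have h1 : (1 : ℕ∞) ≤ ⨅ i, (a i).order :=
    le_iInf fun i => MvPowerSeries.one_le_order_iff_constCoeff_eq_zero.2 (ha i)
  refine le_trans ?_ (MvPowerSeries.le_order_subst
    (MvPowerSeries.hasSubst_of_constantCoeff_zero ha) f)
  calc (N : ℕ∞) = 1 * N := (one_mul _).symm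
    _ ≤ _ := mul_le_mul' h1 hf

theorem rename_mem_vanish (w : Equiv.Perm ν) {N : ℕ} {f : MvPowerSeries ν R} (hf : f ∈ vanish N) :
    MvPowerSeries.renameEquiv R w f ∈ vanish N := by
  rw [mem_vanish_iff] at *
  intro d hd
  have := MvPowerSeries.coeff_embDomain_rename (R := R) w.toEmbedding f
    (Finsupp.embDomain w.symm.toEmbedding d)
  have e : Finsupp.embDomain w.toEmbedding (Finsupp.embDomain w.symm.toEmbedding d) = d := by
    ext i
    have h1 := Finsupp.embDomain_apply_self w.toEmbedding
      (Finsupp.embDomain w.symm.toEmbedding d) (w.symm i)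
    have h2 := Finsupp.embDomain_apply_self w.symm.toEmbedding d i
    simp only [Equiv.coe_toEmbedding, Equiv.apply_symm_apply] at h1 h2
    rw [h1, h2]
  rw [e] at this
  refine this.trans (hf _ ?_)
  rwa [Finsupp.embDomain_eq_mapDomain, Finsupp.degree_mapDomain]

variable [DecidableEq ν]

/-- The divided difference `(f - s f) / (X_i - X_j)`, where `s` exchanges `X_i` and `X_j`: the
coefficients of the quotient of a power series by `X_i - X_j`, expanded in powers of `X_j / X_i`. -/
def ddiff (i j : ν) (f : MvPowerSeries ν R) : MvPowerSeries ν R := fun d =>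
  ∑ t ∈ Finset.range (d j + 1),
    MvPowerSeries.coeff (d + Finsupp.single i (t + 1) - Finsupp.single j t)
      (f - MvPowerSeries.renameEquiv R (Equiv.swap i j) f)

theorem coeff_ddiff (i j : ν) (f : MvPowerSeries ν R) (d : ν →₀ ℕ) :
    MvPowerSeries.coeff d (ddiff i j f) = ∑ t ∈ Finset.range (d j + 1),
      MvPowerSeries.coeff (d + Finsupp.single i (t + 1) - Finsupp.single j t)
        (f - MvPowerSeries.renameEquiv R (Equiv.swap i j) f) := rfl

theorem coeff_rename_swap (i j : ν) (f : MvPowerSeries ν R) {d d' : ν →₀ ℕ}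
    (h : ∀ l, d' l = d (Equiv.swap i j l)) :
    MvPowerSeries.coeff d (MvPowerSeries.renameEquiv R (Equiv.swap i j) f) =
      MvPowerSeries.coeff d' f := by
  have := MvPowerSeries.coeff_embDomain_rename (R := R) (Equiv.swap i j).toEmbedding f d'
  have e : Finsupp.embDomain (Equiv.swap i j).toEmbedding d' = d := by
    ext l
    have h1 := Finsupp.embDomain_apply_self (Equiv.swap i j).toEmbedding d' (Equiv.swap i j l)
    simp only [Equiv.coe_toEmbedding, Equiv.swap_apply_self] at h1
    rw [h1, h, Equiv.swap_apply_self]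
  rw [e] at this
  exact this

theorem sub_mul_ddiff {i j : ν} (hij : i ≠ j) (f : MvPowerSeries ν R) :
    (MvPowerSeries.X i - MvPowerSeries.X j) * ddiff i j f =
      f - MvPowerSeries.renameEquiv R (Equiv.swap i j) f := by
  set F := f - MvPowerSeries.renameEquiv R (Equiv.swap i j) f with hF
  -- the coefficients of `F` along a line of fixed total degree in `X_i`, `X_j` cancel in pairs
  have hanti : ∀ d : ν →₀ ℕ, d i = 0 → ∑ t ∈ Finset.range (d j + 1),
      MvPowerSeries.coeff (d + Finsupp.single i t - Finsupp.single j t) F = 0 := by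
    intro d hd
    rw [hF]
    simp only [map_sub, Finset.sum_sub_distrib]
    rw [sub_eq_zero, ← Finset.sum_range_reflect]
    refine Finset.sum_congr rfl fun t ht => ?_
    have ht' : t ≤ d j := by simpa [Nat.lt_succ_iff] using ht
    refine (coeff_rename_swap i j f fun l => ?_).symm
    rcases eq_or_ne l i with rfl | hi
    · simp [hij, hd, hij.symm]
    · rcases eq_or_ne l j with rfl | hj
      · simp [hij, hd]
        omega
      · simp [Equiv.swap_apply_of_ne_of_ne hi hj, hi.symm, hj.symm]
  ext d
  have e1 : MvPowerSeries.coeff d (MvPowerSeries.X i * ddiff i j f) =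
      if 1 ≤ d i then MvPowerSeries.coeff (d - Finsupp.single i 1) (ddiff i j f) else 0 := by
    rw [MvPowerSeries.X, MvPowerSeries.coeff_monomial_mul]
    simp [Finsupp.single_le_iff]
  have e2 : MvPowerSeries.coeff d (MvPowerSeries.X j * ddiff i j f) =
      if 1 ≤ d j then MvPowerSeries.coeff (d - Finsupp.single j 1) (ddiff i j f) else 0 := by
    rw [MvPowerSeries.X, MvPowerSeries.coeff_monomial_mul]
    simp [Finsupp.single_le_iff]
  have e3 : (if 1 ≤ d j then MvPowerSeries.coeff (d - Finsupp.single j 1) (ddiff i j f) else 0) =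
      ∑ t ∈ Finset.range (d j),
        MvPowerSeries.coeff (d + Finsupp.single i (t + 1) - Finsupp.single j (t + 1)) F := by
    split_ifs with h
    · have hj : (d - Finsupp.single j 1 : ν →₀ ℕ) j + 1 = d j := by
        rw [Finsupp.tsub_apply, Finsupp.single_eq_same]
        omega
      rw [coeff_ddiff, ← hF, hj]
      refine Finset.sum_congr rfl fun t _ => ?_
      congr 2
      ext l
      simp [Finsupp.single_apply]
      split_ifs <;> first | omega | (subst_vars; omega)
    · have : d j = 0 := by omega
      simp [this]
  rw [sub_mul, map_sub, e1, e2, e3]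
  have e5 : ∑ t ∈ Finset.range (d j + 1),
      MvPowerSeries.coeff (d + Finsupp.single i t - Finsupp.single j t) F =
      ∑ t ∈ Finset.range (d j), MvPowerSeries.coeff
        (d + Finsupp.single i (t + 1) - Finsupp.single j (t + 1)) F + MvPowerSeries.coeff d F := by
    rw [Finset.sum_range_succ']
    simp
  split_ifs with h
  · have e4 : MvPowerSeries.coeff (d - Finsupp.single i 1) (ddiff i j f) =
        ∑ t ∈ Finset.range (d j + 1),
          MvPowerSeries.coeff (d + Finsupp.single i t - Finsupp.single j t) F := by
      rw [coeff_ddiff, ← hF]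
      refine Finset.sum_congr (by simp [hij]) fun t _ => ?_
      congr 2
      ext l
      simp [Finsupp.single_apply]
      split_ifs <;> first | omega | (subst_vars; omega)
    rw [e4, e5, add_sub_cancel_left]
  · have := hanti d (by omega)
    rw [e5] at this
    linear_combination -this

theorem ddiff_mem_vanish (i j : ν) {N : ℕ} {f : MvPowerSeries ν R} (hf : f ∈ vanish (N + 1)) :
    ddiff i j f ∈ vanish N := by
  have hF := Ideal.sub_mem _ hf (rename_mem_vanish (Equiv.swap i j) hf)
  rw [mem_vanish_iff] at *
  intro d hd
  rw [coeff_ddiff]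
  refine Finset.sum_eq_zero fun t ht => hF _ ?_
  have hle : Finsupp.single j t ≤ d + Finsupp.single i (t + 1) := by
    rw [Finsupp.single_le_iff]
    simp at ht
    simp
    omega
  have := congrArg Finsupp.degree (tsub_add_cancel_of_le hle)
  simp only [map_add, Finsupp.degree_single] at this
  omega

end PowerSeries

/-! ### Substitutions and the expansions at the weights -/

section Substitution

variable {k : Type*} [Field k] {n : ℕ}

open KLR

theorem hasSubst_var (i : Option (Fin n)) :
    PowerSeries.HasSubst (MvPowerSeries.X i : Ser k n) := PowerSeries.HasSubst.X i

theorem atH_eq (f : PowerSeries k) :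
    (atH f : Ser k n) = PowerSeries.substAlgHom (hasSubst_var none) f := by
  rw [PowerSeries.coe_substAlgHom, atH]

theorem atY_eq (f : PowerSeries k) (i : Fin n) :
    (atY f i : Ser k n) = PowerSeries.substAlgHom (hasSubst_var (some i)) f := by
  rw [PowerSeries.coe_substAlgHom, atY]

open Classical in
theorem coeff_atY (f : PowerSeries k) (i : Fin n) (e : Option (Fin n) →₀ ℕ) :
    MvPowerSeries.coeff e (atY f i : Ser k n) =
      if e = Finsupp.single (some i) (e (some i)) then PowerSeries.coeff (e (some i)) f else 0 :=
  PowerSeries.coeff_subst_single _ _ _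

open Classical in
theorem coeff_atH (f : PowerSeries k) (e : Option (Fin n) →₀ ℕ) :
    MvPowerSeries.coeff e (atH f : Ser k n) =
      if e = Finsupp.single none (e none) then PowerSeries.coeff (e none) f else 0 :=
  PowerSeries.coeff_subst_single _ _ _

theorem constantCoeff_atY (f : PowerSeries k) (i : Fin n) :
    MvPowerSeries.constantCoeff (atY f i : Ser k n) = PowerSeries.constantCoeff f := by
  rw [← MvPowerSeries.coeff_zero_eq_constantCoeff_apply, coeff_atY]
  simp

theorem constantCoeff_atH (f : PowerSeries k) :
    MvPowerSeries.constantCoeff (atH f : Ser k n) = PowerSeries.constantCoeff f := by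
  rw [← MvPowerSeries.coeff_zero_eq_constantCoeff_apply, coeff_atH]
  simp

/-- The action of permutations of the strands on power series. -/
def sig : Equiv.Perm (Fin n) →* RingAut (Ser k n) where
  toFun w := (MvPowerSeries.renameEquiv k (Equiv.optionCongr w)).toRingEquiv
  map_one' := by
    refine RingEquiv.ext fun f => ?_
    have : Equiv.optionCongr (1 : Equiv.Perm (Fin n)) = Equiv.refl _ := Equiv.optionCongr_refl
    rw [this, MvPowerSeries.renameEquiv_refl]
    rfl
  map_mul' w w' := by
    refine RingEquiv.ext fun f => ?_
    have : Equiv.optionCongr (w * w') = (Equiv.optionCongr w').trans (Equiv.optionCongr w) := by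
      ext1 x
      cases x <;> rfl
    rw [this, ← MvPowerSeries.renameEquiv_trans]
    rfl

theorem sig_apply (w : Equiv.Perm (Fin n)) (f : Ser k n) :
    sig w f = MvPowerSeries.renameEquiv k (Equiv.optionCongr w) f := rfl

theorem sig_adj (r : Fin (n - 1)) (f : Ser k n) :
    sig (adj r) f = MvPowerSeries.renameEquiv k (Equiv.swap (some (lo r)) (some (hi r))) f := by
  rw [sig_apply, adj, Equiv.optionCongr_swap]

@[simp] theorem sig_X_some (w : Equiv.Perm (Fin n)) (i : Fin n) :
    sig w (MvPowerSeries.X (some i) : Ser k n) = MvPowerSeries.X (some (w i)) :=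
  MvPowerSeries.rename_X _ _

@[simp] theorem sig_C (w : Equiv.Perm (Fin n)) (t : k) :
    sig w (MvPowerSeries.C t : Ser k n) = MvPowerSeries.C t :=
  MvPowerSeries.rename_C _ _

theorem sig_subst (w : Equiv.Perm (Fin n)) (i : Option (Fin n)) (f : PowerSeries k) :
    sig w (PowerSeries.subst (MvPowerSeries.X i : Ser k n) f) =
      PowerSeries.subst (MvPowerSeries.X (Equiv.optionCongr w i) : Ser k n) f := by
  have h1 : MvPowerSeries.HasSubst fun _ : Unit => (MvPowerSeries.X i : Ser k n) :=
    (hasSubst_var i).const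
  rw [sig_apply]
  change MvPowerSeries.rename (Equiv.optionCongr w) _ = _
  rw [MvPowerSeries.rename_eq_subst, PowerSeries.subst, PowerSeries.subst,
    MvPowerSeries.subst_comp_subst_apply h1 (MvPowerSeries.HasSubst.X_comp _)]
  congr 1
  ext1 _
  exact MvPowerSeries.subst_X (MvPowerSeries.HasSubst.X_comp _) _

@[simp] theorem sig_atY (w : Equiv.Perm (Fin n)) (f : PowerSeries k) (i : Fin n) :
    sig w (atY f i : Ser k n) = atY f (w i) := sig_subst w (some i) f

@[simp] theorem sig_atH (w : Equiv.Perm (Fin n)) (f : PowerSeries k) :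
    sig w (atH f : Ser k n) = atH f := sig_subst w none f

theorem sig_mem_vanish (w : Equiv.Perm (Fin n)) {N : ℕ} {f : Ser k n} (hf : f ∈ vanish N) :
    sig w f ∈ vanish N := rename_mem_vanish _ hf

theorem mul_ddiff {r : Fin (n - 1)} (f : Ser k n) :
    (MvPowerSeries.X (some (hi r)) - MvPowerSeries.X (some (lo r))) *
      ddiff (some (lo r)) (some (hi r)) f = sig (adj r) f - f := by
  have h : (some (lo r) : Option (Fin n)) ≠ some (hi r) := by simpa using lo_ne_hi r
  have := sub_mul_ddiff h f
  rw [← sig_adj] at this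
  linear_combination -this

/-- Substitution of `p(y_i)` for `y_i`. -/
def subsY (p : PowerSeries k) : Option (Fin n) → Ser k n
  | none => MvPowerSeries.X none
  | some i => atY p i

section subsY

variable {p p' : PowerSeries k}

theorem constantCoeff_subsY (hp : PowerSeries.constantCoeff p = 0) (i : Option (Fin n)) :
    MvPowerSeries.constantCoeff (subsY p i) = 0 := by
  cases i with
  | none => simp [subsY]
  | some i => simp [subsY, constantCoeff_atY, hp]

theorem hasSubst_subsY (hp : PowerSeries.constantCoeff p = 0) :
    MvPowerSeries.HasSubst (subsY p : Option (Fin n) → Ser k n) :=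
  MvPowerSeries.hasSubst_of_constantCoeff_zero (constantCoeff_subsY hp)

theorem subst_subsY_atY (hp : PowerSeries.constantCoeff p = 0) (f : PowerSeries k) (i : Fin n) :
    (atY f i : Ser k n).subst (subsY p) = atY (f.subst p) i := by
  have h1 : MvPowerSeries.HasSubst fun _ : Unit => (MvPowerSeries.X (some i) : Ser k n) :=
    (hasSubst_var _).const
  have hp' : PowerSeries.HasSubst p := PowerSeries.HasSubst.of_constantCoeff_zero' hp
  rw [atY, atY, PowerSeries.subst_comp_subst_apply hp' (hasSubst_var _), PowerSeries.subst,
    PowerSeries.subst, MvPowerSeries.subst_comp_subst_apply h1 (hasSubst_subsY hp)]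
  congr 1
  ext1 _
  exact MvPowerSeries.subst_X (hasSubst_subsY hp) _

theorem subst_subsY_subst_subsY (hp : PowerSeries.constantCoeff p = 0)
    (hp' : PowerSeries.constantCoeff p' = 0) (h : p.subst p' = PowerSeries.X) (f : Ser k n) :
    (f.subst (subsY p)).subst (subsY p') = f := by
  rw [MvPowerSeries.subst_comp_subst_apply (hasSubst_subsY hp) (hasSubst_subsY hp')]
  have : (fun i => (subsY p i : Ser k n).subst (subsY p')) = MvPowerSeries.X := by
    ext1 i
    cases i with
    | none => exact MvPowerSeries.subst_X (hasSubst_subsY hp') none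
    | some i =>
      rw [subsY, subst_subsY_atY hp', h, atY, PowerSeries.subst_X (hasSubst_var _)]
  rw [this, MvPowerSeries.subst_self, id]

end subsY

/-- The hypotheses on the power series `b`, `c`, `d` that the comparison uses. The last one is the
factorization which makes the fraction `A_r` regular along an edge. -/
structure IsAdmissible (n : ℕ) (b c d : PowerSeries k) : Prop where
  b0 : PowerSeries.coeff 0 b = 1
  b1 : PowerSeries.coeff 1 b = 1
  d0 : PowerSeries.constantCoeff d = 1
  factor : ∀ i j : Fin n, i ≠ j → ∃ β : Ser k n, MvPowerSeries.constantCoeff β ≠ 0 ∧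
    atY b i - atH d * atY b j =
      (MvPowerSeries.X (some j) - MvPowerSeries.X (some i) + atH c) * β

theorem exists_factor_atY {b : PowerSeries k} (hb1 : PowerSeries.coeff 1 b = 1) {i j : Fin n}
    (hij : i ≠ j) : ∃ β : Ser k n, MvPowerSeries.constantCoeff β = 1 ∧
      atY b j - atY b i = (MvPowerSeries.X (some j) - MvPowerSeries.X (some i)) * β := by
  have h : (some i : Option (Fin n)) ≠ some j := by simpa using hij
  have e := sub_mul_ddiff h (atY b i : Ser k n)
  have e' : MvPowerSeries.renameEquiv k (Equiv.swap (some i) (some j)) (atY b i : Ser k n) =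
      atY b j := by
    rw [← Equiv.optionCongr_swap, ← sig_apply, sig_atY, Equiv.swap_apply_left]
  rw [e'] at e
  refine ⟨ddiff (some i) (some j) (atY b i), ?_, by linear_combination e⟩
  -- compare the coefficients of `y_i`
  have := congrArg (MvPowerSeries.coeff (Finsupp.single (some i) 1)) e
  classical
  rw [sub_mul, map_sub, map_sub, coeff_atY, coeff_atY, MvPowerSeries.X, MvPowerSeries.X,
    MvPowerSeries.coeff_monomial_mul, MvPowerSeries.coeff_monomial_mul] at this
  simpa [Finsupp.single_le_iff, hij, hij.symm, hb1] using this

theorem exp_subst_add [CharZero k] {x y : Ser k n} (hx : MvPowerSeries.constantCoeff x = 0)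
    (hy : MvPowerSeries.constantCoeff y = 0) :
    (PowerSeries.exp k).subst (x + y) =
      (PowerSeries.exp k).subst x * (PowerSeries.exp k).subst y := by
  have h2 : (PowerSeries.exp k).subst
      (MvPowerSeries.X 0 + MvPowerSeries.X 1 : MvPowerSeries (Fin 2) k) =
      (PowerSeries.exp k).subst (MvPowerSeries.X 0 : MvPowerSeries (Fin 2) k) *
        (PowerSeries.exp k).subst (MvPowerSeries.X 1 : MvPowerSeries (Fin 2) k) := by
    ext e
    rw [PowerSeries.coeff_subst_X_zero_add_X_one, PowerSeries.coeff_subst_X_zero_subst_mul_X_one]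
    have := Nat.add_choose_mul_factorial_mul_factorial (e 0) (e 1)
    rw [← Nat.choose_symm_add] at this
    have h' : ((e 0 + e 1).choose (e 0) : k) * (e 0).factorial * (e 1).factorial =
        (e 0 + e 1).factorial := by exact_mod_cast this
    have f0 : ((e 0).factorial : k) ≠ 0 := by exact_mod_cast Nat.factorial_ne_zero _
    have f1 : ((e 1).factorial : k) ≠ 0 := by exact_mod_cast Nat.factorial_ne_zero _
    have f2 : ((e 0 + e 1).factorial : k) ≠ 0 := by exact_mod_cast Nat.factorial_ne_zero _
    simp only [PowerSeries.coeff_exp, map_div₀, map_one, map_natCast]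
    field_simp
    linear_combination h'
  have ha : MvPowerSeries.HasSubst (![x, y] : Fin 2 → Ser k n) :=
    MvPowerSeries.hasSubst_of_constantCoeff_zero (by intro i; fin_cases i <;> simp [hx, hy])
  have key : ∀ z : MvPowerSeries (Fin 2) k, MvPowerSeries.constantCoeff z = 0 →
      ((PowerSeries.exp k).subst z).subst ![x, y] =
        (PowerSeries.exp k).subst (z.subst ![x, y]) := by
    intro z hz
    have hz' : MvPowerSeries.HasSubst fun _ : Unit => z :=
      (PowerSeries.HasSubst.of_constantCoeff_zero hz).const
    rw [PowerSeries.subst, PowerSeries.subst, MvPowerSeries.subst_comp_subst_apply hz' ha]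
  have := congrArg (MvPowerSeries.subst ![x, y]) h2
  rw [MvPowerSeries.subst_mul ha, key _ (by simp), key _ (by simp), key _ (by simp),
    MvPowerSeries.subst_add ha, MvPowerSeries.subst_X ha, MvPowerSeries.subst_X ha] at this
  simpa using this

theorem isAdmissible_exp [CharZero k] :
    IsAdmissible n (PowerSeries.exp k) PowerSeries.X (PowerSeries.exp k) where
  b0 := by simp
  b1 := by simp [PowerSeries.coeff_exp]
  d0 := by simp
  factor i j hij := by
    set E := PowerSeries.mk fun p => PowerSeries.coeff (p + 1) (PowerSeries.exp k) with hE
    set z : Ser k n := MvPowerSeries.X (some j) - MvPowerSeries.X (some i) + MvPowerSeries.X none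
      with hz
    have hz0 : MvPowerSeries.constantCoeff z = 0 := by simp [hz]
    have hzs : PowerSeries.HasSubst z := PowerSeries.HasSubst.of_constantCoeff_zero hz0
    have e1 : (PowerSeries.exp k).subst z = z * E.subst z + 1 := by
      conv_lhs => rw [PowerSeries.eq_X_mul_shift_add_const (PowerSeries.exp k)]
      rw [PowerSeries.subst_add hzs, PowerSeries.subst_mul hzs, PowerSeries.subst_X hzs,
        PowerSeries.subst_C]
      simp [hE]
    have e2 : (atH (PowerSeries.exp k) * atY (PowerSeries.exp k) j : Ser k n) =
        (PowerSeries.exp k).subst z * atY (PowerSeries.exp k) i := by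
      rw [atH, atY, atY, ← exp_subst_add (by simp) (by simp), ← exp_subst_add hz0 (by simp)]
      congr 1
      rw [hz]
      ring
    have hX : (atH PowerSeries.X : Ser k n) = MvPowerSeries.X none :=
      PowerSeries.subst_X (hasSubst_var none)
    refine ⟨-(E.subst z * atY (PowerSeries.exp k) i), ?_, ?_⟩
    · have : MvPowerSeries.constantCoeff (E.subst z) = 1 := by
        have h3 : E = PowerSeries.X * PowerSeries.mk (fun p => PowerSeries.coeff (p + 1) E) +
            PowerSeries.C 1 := by
          conv_lhs => rw [PowerSeries.eq_X_mul_shift_add_const E]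
          congr 2
          simp [hE, PowerSeries.coeff_exp]
        rw [h3, PowerSeries.subst_add hzs, PowerSeries.subst_mul hzs, PowerSeries.subst_X hzs,
          PowerSeries.subst_C]
        simp [hz0]
      simp [this, constantCoeff_atY]
    · rw [e2, e1, hX, ← hz]
      ring

theorem isAdmissible_one {b : PowerSeries k} (hb0 : PowerSeries.coeff 0 b = 1)
    (hb1 : PowerSeries.coeff 1 b = 1) : IsAdmissible n b 0 1 where
  b0 := hb0
  b1 := hb1
  d0 := by simp
  factor i j hij := by
    obtain ⟨β, hβ, e⟩ := exists_factor_atY (n := n) hb1 hij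
    refine ⟨-β, by simp [hβ], ?_⟩
    rw [atH_eq, atH_eq, map_one, map_zero]
    linear_combination -e

end Substitution

/-! ### The operators of the two polynomial representations -/

section Pullback

variable {S S' E : Type*} [CommRing S] [CommRing S'] [Ring E] {N : ℕ}

theorem IsTwisted.pullback {s' : Fin N → S' →+* S'} {D' : Fin N → S' → S'} {a' b' : Fin N → S'}
    {c' : Fin N → Fin N → S'} {ι : S' →+* E} {τ : Fin N → E}
    (h : IsTwisted s' D' a' b' c' ι τ) (j : S →+* S') {s : Fin N → S →+* S} {D : Fin N → S → S}
    {a b : Fin N → S} {c : Fin N → Fin N → S} (hs : ∀ r f, j (s r f) = s' r (j f))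
    (hD : ∀ r f, j (D r f) = D' r (j f)) (ha : ∀ r, j (a r) = a' r) (hb : ∀ r, j (b r) = b' r)
    (hc : ∀ r r' : Fin N, (r : ℕ) + 1 = r' → j (c r r') = c' r r') :
    IsTwisted s D a b c (ι.comp j) τ where
  comm r f := by simp only [RingHom.comp_apply, hs, hD, h.comm]
  sq r := by simp only [RingHom.comp_apply, ha, hb, h.sq]
  braid r r' hr := by simp only [RingHom.comp_apply, hc r r' hr, h.braid r r' hr]
  far := h.far

theorem IsLocallyFree.pullback {ι : S' →+* E} {τ : Fin N → E} (h : IsLocallyFree ι τ) (j : S →+* S')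
    (hj : Function.Injective j) : IsLocallyFree (ι.comp j) τ where
  one r c₀ c₁ e := by
    simpa only [map_eq_zero_iff j hj] using h.one r (j c₀) (j c₁) e
  far r r' h₀ h₁ h₂ c₀ c₁ c₂ c₃ e := by
    simpa only [map_eq_zero_iff j hj] using h.far r r' h₀ h₁ h₂ (j c₀) (j c₁) (j c₂) (j c₃) e
  braid r r' hr c₀ c₁ c₂ c₃ c₄ c₅ e := by
    simpa only [map_eq_zero_iff j hj] using
      h.braid r r' hr (j c₀) (j c₁) (j c₂) (j c₃) (j c₄) (j c₅) e

end Pullback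

section Relations

variable {k : Type*} [Field k] {n : ℕ} {U : Finset k}

open KLR

/-- Coloured power series: one power series in `h, y_1, …, y_n` for every weight. -/
abbrev Col (n : ℕ) (U : Finset k) : Type _ := (Fin n → U) → Ser k n

/-- The fraction field of `k[[h, y_1, …, y_n]]`. -/
abbrev Frac (k : Type*) [Field k] (n : ℕ) : Type _ := FractionRing (Ser k n)

/-- Coloured power series as coloured fractions. -/
def toFrac : Col n U →+* ((Fin n → U) → Frac k n) :=
  (algebraMap (Ser k n) (Frac k n)).compLeft _

theorem toFrac_apply (f : Col n U) (u : Fin n → U) :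
    toFrac f u = algebraMap (Ser k n) (Frac k n) (f u) := rfl

theorem toFrac_injective :
    Function.Injective (toFrac : Col n U →+* ((Fin n → U) → Frac k n)) := by
  intro f g h
  ext1 u
  exact IsFractionRing.injective (Ser k n) (Frac k n) (congrFun h u)

/-- The action of permutations of the strands on fractions. -/
def sigFrac : Equiv.Perm (Fin n) →* RingAut (Frac k n) where
  toFun w := IsFractionRing.ringEquivOfRingEquiv (K := Frac k n) (L := Frac k n)
    (sig w : Ser k n ≃+* Ser k n)
  map_one' := by
    refine RingEquiv.ext fun z => ?_
    obtain ⟨x, y, -, rfl⟩ := IsFractionRing.div_surjective (A := Ser k n) z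
    simp only [map_div₀, IsFractionRing.ringEquivOfRingEquiv_algebraMap, map_one,
      RingAut.one_apply]
  map_mul' w w' := by
    refine RingEquiv.ext fun z => ?_
    obtain ⟨x, y, -, rfl⟩ := IsFractionRing.div_surjective (A := Ser k n) z
    simp only [map_div₀, IsFractionRing.ringEquivOfRingEquiv_algebraMap, map_mul,
      RingAut.mul_apply]

theorem sigFrac_algebraMap (w : Equiv.Perm (Fin n)) (f : Ser k n) :
    sigFrac w (algebraMap (Ser k n) (Frac k n) f) = algebraMap _ _ (sig w f) :=
  IsFractionRing.ringEquivOfRingEquiv_algebraMap (K := Frac k n) (L := Frac k n)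
    (sig w : Ser k n ≃+* Ser k n) f

theorem algebraMap_frac_injective :
    Function.Injective (algebraMap (Ser k n) (Frac k n)) :=
  IsFractionRing.injective (Ser k n) (Frac k n)

theorem X_injective :
    Function.Injective fun i : Fin n => (MvPowerSeries.X (some i) : Ser k n) := by
  intro i j h
  exact Option.some_injective _ (MvPowerSeries.X_inj.1 h)

theorem sigFrac_injective : Function.Injective (sigFrac (k := k) (n := n)) := by
  intro w w' h
  ext1 i
  have := DFunLike.congr_fun h (algebraMap (Ser k n) (Frac k n) (MvPowerSeries.X (some i)))
  rw [sigFrac_algebraMap, sigFrac_algebraMap, sig_X_some, sig_X_some] at this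
  exact X_injective (k := k) (algebraMap_frac_injective this)

theorem toFrac_act (w : Equiv.Perm (Fin n)) (f : Col n U) :
    toFrac (act sig w f) = act sigFrac w (toFrac f) := by
  ext1 u
  rw [toFrac_apply, act_apply, act_apply, toFrac_apply, sigFrac_algebraMap]

/-- The `i`-th generator `X_i`, expanded at every weight. -/
def colX (b : PowerSeries k) (i : Fin n) : Col n U := fun u => eigen b u i

/-- The variable `y_i`. -/
def colY (i : Fin n) : Col n U := fun _ => MvPowerSeries.X (some i)

/-- The scalars `k[[h]]`. -/
def scal : PowerSeries k →+* Col n U :=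
  RingHom.pi fun _ => (PowerSeries.substAlgHom (hasSubst_var (k := k) none)).toRingHom

theorem scal_apply (Q : PowerSeries k) (u : Fin n → U) : scal Q u = atH Q := (atH_eq Q).symm

theorem act_colX (b : PowerSeries k) (w : Equiv.Perm (Fin n)) (i : Fin n) :
    act sig w (colX b i : Col n U) = colX b (w i) := by
  ext1 u
  simp [act_apply, colX, eigen]

theorem act_colY (w : Equiv.Perm (Fin n)) (i : Fin n) :
    act sig w (colY i : Col n U) = colY (w i) := by
  ext1 u
  simp [act_apply, colY]

theorem act_scal (w : Equiv.Perm (Fin n)) (Q : PowerSeries k) :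
    act sig w (scal Q : Col n U) = scal Q := by
  ext1 u
  simp [act_apply, scal_apply]

theorem colX_ne {b : PowerSeries k} (hb1 : PowerSeries.coeff 1 b = 1) (hU : (0 : k) ∉ U)
    {i j : Fin n} (hij : i ≠ j) (u : Fin n → U) :
    (colX b i : Col n U) u ≠ colX b j u := by
  intro h
  have := congrArg (MvPowerSeries.coeff (Finsupp.single (some i) 1)) h
  simp only [colX, eigen, MvPowerSeries.coeff_C_mul, coeff_atY] at this
  have hi : (u i : k) ≠ 0 := fun h0 => hU (h0 ▸ (u i).2)
  simp [hij, hb1, hi] at this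

open Classical in
/-- The coefficient of the transposition in the operator by which `ψ_r` acts on coloured fractions,
for the strands `i = r`, `j = r + 1`. -/
def klrP (q : k) (c : PowerSeries k) (i j : Fin n) : (Fin n → U) → Frac k n := fun u =>
  if u i = u j then (toFrac (U := U) (colY j) u - toFrac (U := U) (colY i) u)⁻¹
  else if (u i : k) = q * u j then
    toFrac (U := U) (colY j) u - toFrac (U := U) (colY i) u + toFrac (U := U) (scal c) u
  else 1

open Classical in
/-- The coefficient of the identity in the operator by which `ψ_r` acts, for the strands `i = r`,
`j = r + 1`: the operator is the divided difference if the colours of the strands agree. -/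
def klrM (i j : Fin n) : (Fin n → U) → Frac k n := fun u =>
  if u i = u j then -(toFrac (U := U) (colY j) u - toFrac (U := U) (colY i) u)⁻¹ else 0

/-- The coefficient of the transposition in the Demazure–Lusztig operator by which `T_r` acts on
coloured fractions, for the strands `i = r`, `j = r + 1`. -/
def heckeP (Q b : PowerSeries k) (i j : Fin n) : (Fin n → U) → Frac k n :=
  (toFrac (colX b i) - toFrac (scal Q) * toFrac (colX b j)) *
    (toFrac (colX b j) - toFrac (colX b i))⁻¹

/-- The coefficient of the identity in the Demazure–Lusztig operator by which `T_r` acts, for the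
strands `i = r`, `j = r + 1`. -/
def heckeM (Q b : PowerSeries k) (i j : Fin n) : (Fin n → U) → Frac k n :=
  (toFrac (scal Q) - 1) * toFrac (colX b j) * (toFrac (colX b j) - toFrac (colX b i))⁻¹

theorem act_inv (w : Equiv.Perm (Fin n)) (f : (Fin n → U) → Frac k n) :
    act sigFrac w f⁻¹ = (act sigFrac w f)⁻¹ := by
  ext1 u
  simp [act_apply]

theorem isEquivariant_heckeP (Q b : PowerSeries k) :
    IsEquivariant sigFrac (heckeP (n := n) (U := U) Q b) := by
  intro w i j
  simp only [heckeP, map_mul, map_sub, act_inv, ← toFrac_act, act_colX, act_scal]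

theorem isEquivariant_heckeM (Q b : PowerSeries k) :
    IsEquivariant sigFrac (heckeM (n := n) (U := U) Q b) := by
  intro w i j
  simp only [heckeM, map_mul, map_sub, map_one, act_inv, ← toFrac_act, act_colX, act_scal]

theorem sigFrac_colY (w : Equiv.Perm (Fin n)) (i : Fin n) (u u' : Fin n → U) :
    sigFrac w (toFrac (U := U) (colY i) u) = toFrac (U := U) (colY (w i)) u' := by
  simp [toFrac_apply, colY, sigFrac_algebraMap]

theorem sigFrac_scal (w : Equiv.Perm (Fin n)) (Q : PowerSeries k) (u u' : Fin n → U) :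
    sigFrac w (toFrac (U := U) (scal Q) u) = toFrac (U := U) (scal Q) u' := by
  simp [toFrac_apply, scal_apply, sigFrac_algebraMap]

theorem isEquivariant_klrP (q : k) (c : PowerSeries k) :
    IsEquivariant sigFrac (klrP (n := n) (U := U) q c) := by
  intro w i j
  ext1 u
  simp only [klrP, act_apply, Function.comp_apply]
  split_ifs <;> simp [sigFrac_colY w _ _ u, sigFrac_scal w _ _ u]

theorem isEquivariant_klrM : IsEquivariant sigFrac (klrM (k := k) (n := n) (U := U)) := by
  intro w i j
  ext1 u
  simp only [klrM, act_apply, Function.comp_apply]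
  split_ifs <;> simp [sigFrac_colY w _ _ u]

theorem colY_sub_ne {i j : Fin n} (hij : i ≠ j) (u : Fin n → U) :
    toFrac (U := U) (colY i) u - toFrac (U := U) (colY j) u ≠ 0 := by
  intro h
  exact hij (X_injective (k := k) (algebraMap_frac_injective (sub_eq_zero.1 h)))

theorem colX_sub_ne {b : PowerSeries k} (hb1 : PowerSeries.coeff 1 b = 1) (hU : (0 : k) ∉ U)
    {i j : Fin n} (hij : i ≠ j) (u : Fin n → U) :
    toFrac (U := U) (colX b i) u - toFrac (U := U) (colX b j) u ≠ 0 := by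
  intro h
  exact colX_ne hb1 hU hij u (algebraMap_frac_injective (sub_eq_zero.1 h))

/-- The Demazure–Lusztig operators satisfy the relations of the affine Hecke algebra. -/
theorem isTwisted_heckeOp (Q : PowerSeries k) {b : PowerSeries k}
    (hb1 : PowerSeries.coeff 1 b = 1) (hU : (0 : k) ∉ U) :
    IsTwisted (fun r => act sigFrac (adj r))
      (fun r f => heckeM (n := n) (U := U) Q b (lo r) (hi r) * (f - act sigFrac (adj r) f))
      (fun _ => toFrac (scal (Q - 1))) (fun _ => toFrac (scal Q)) (fun _ _ => 0)
      mulOp (diffOp sigFrac (heckeP Q b) (heckeM Q b)) := by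
  have hx := fun i j hij => colX_sub_ne (n := n) hb1 hU (i := i) (j := j) hij
  refine isTwisted_diffOp (a := fun _ _ => toFrac (scal (Q - 1))) (b := fun _ _ => toFrac (scal Q))
    (c := fun _ _ _ => 0) (isEquivariant_heckeP Q b) (isEquivariant_heckeM Q b)
    (fun i j hij => ?_) (fun i j hij => ?_) (fun i j l hij hil hjl => ?_)
    (fun i j l hij hil hjl => ?_) (fun i j l hij hil hjl => ?_)
  -- all identities are identities of rational functions in the `X_i` and `Q`
  all_goals
    ext1 u
    simp only [heckeP, heckeM, Pi.add_apply, Pi.mul_apply, Pi.sub_apply, Pi.inv_apply, map_sub,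
      map_one, Pi.one_apply, Pi.zero_apply]
    have h1 := hx _ _ hij u
    have h2 := hx _ _ hij.symm u
    try have h3 := hx _ _ hil u
    try have h4 := hx _ _ hil.symm u
    try have h5 := hx _ _ hjl u
    try have h6 := hx _ _ hjl.symm u
    generalize toFrac (scal Q) u = Q' at *
    generalize toFrac (colX b i) u = x at *
    generalize toFrac (colX b j) u = y at *
    try generalize toFrac (colX b l) u = z at *
  · rw [← neg_sub y x, inv_neg]
    field_simp
    ring
  · rw [← neg_sub y x, inv_neg]
    field_simp
    ring
  · rw [← neg_sub y x, inv_neg]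
    field_simp
    ring
  · rw [← neg_sub z y, inv_neg]
    field_simp
    ring
  · rw [← neg_sub y x, ← neg_sub z y, inv_neg, inv_neg]
    field_simp
    ring

open Classical in
/-- The lower order term `Q_{u_r, u_{r+1}}(y_r, y_{r+1})` in the quadratic relation of the KLR
algebra. -/
def klrQ (q : k) (c : PowerSeries k) (i j : Fin n) : Col n U := fun u =>
  if u i = u j then 0 else
    (if (u j : k) = q * u i then colY (U := U) i u - colY (U := U) j u + scal c u else 1) *
      (if (u i : k) = q * u j then colY (U := U) j u - colY (U := U) i u + scal c u else 1)

/-- The lower order term in the braid relation of the KLR algebra. -/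
def klrB (q : k) (i j l : Fin n) : Col n U := fun u =>
  Bpol q (u i : k) (u j) (u l) (colY (U := U) i u) (colY (U := U) j u) (colY (U := U) l u)

theorem klrB_eq_zero {q : k} {i j l : Fin n} {u : Fin n → U} (h : u i ≠ u l ∨ u i = u j) :
    klrB q i j l u = 0 := by
  rw [klrB, Bpol, if_pos]
  exact h.imp (fun h h' => h (Subtype.coe_injective h')) (congrArg _)

open Classical in
theorem klrB_eq {q : k} {i j l : Fin n} {u : Fin n → U} (h : u i = u l) (h' : u i ≠ u j) :
    klrB q i j l u = if (u j : k) = q * u i ∧ (u i : k) = q * u j then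
      2 * colY (U := U) j u - colY (U := U) i u - colY (U := U) l u
      else if (u j : k) = q * u i then 1 else if (u i : k) = q * u j then -1 else 0 := by
  rw [klrB, Bpol, if_neg]
  rintro (h₁ | h₁)
  · exact h₁ (congrArg _ h)
  · exact h' (Subtype.coe_injective h₁)

/-- The operators of the polynomial representation satisfy the relations of the KLR algebra. -/
theorem isTwisted_klrOp (q : k) (c : PowerSeries k) :
    IsTwisted (fun r => act sigFrac (adj r))
      (fun r f => klrM (k := k) (n := n) (U := U) (lo r) (hi r) * (f - act sigFrac (adj r) f))
      (fun _ => 0) (fun r => toFrac (klrQ q c (lo r) (hi r)))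
      (fun r r' => toFrac (klrB q (lo r) (hi r) (hi r')))
      mulOp (diffOp sigFrac (klrP q c) klrM) := by
  have hy := fun i j hij => colY_sub_ne (n := n) (U := U) (i := i) (j := j) hij
  refine isTwisted_diffOp (a := fun _ _ => 0) (b := fun i j => toFrac (klrQ q c i j))
    (c := fun i j l => toFrac (klrB q i j l)) (isEquivariant_klrP q c) isEquivariant_klrM
    (fun i j hij => ?_) (fun i j hij => ?_) (fun i j l hij hil hjl => ?_)
    (fun i j l hij hil hjl => ?_) (fun i j l hij hil hjl => ?_)
  -- distinguish which of the three colours coincide; the braid relation with outer colours equal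
  -- moreover depends on the edges between the two colours
  all_goals
    ext1 u
    simp only [klrP, klrM, toFrac_apply, klrQ, Pi.add_apply, Pi.mul_apply,
      Pi.zero_apply]
    have h1 := hy _ _ hij u
    have h2 := hy _ _ hij.symm u
    try have h3 := hy _ _ hil u
    try have h4 := hy _ _ hil.symm u
    try have h5 := hy _ _ hjl u
    try have h6 := hy _ _ hjl.symm u
    simp only [toFrac_apply] at h1 h2
    try simp only [toFrac_apply] at h3 h4 h5 h6
    by_cases e1 : u i = u j
  · simp only [e1, if_true]
    rw [← neg_sub (algebraMap (Ser k n) (Frac k n) (colY j u)), inv_neg]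
    ring
  · simp only [e1, Ne.symm e1, if_false]
    simp
  · simp only [e1, if_true]
    rw [← neg_sub (algebraMap (Ser k n) (Frac k n) (colY j u)), inv_neg, map_zero]
    ring
  · simp only [e1, Ne.symm e1, if_false, map_mul, apply_ite (algebraMap (Ser k n) (Frac k n)),
      map_add, map_sub, map_one]
    ring
  · by_cases e2 : u j = u l
    · simp only [e1, e2, if_true]
      field_simp
      ring
    · simp only [e1, e2, if_false, if_true]
      ring
  · by_cases e2 : u j = u l
    · have e3 : ¬ u i = u l := e2 ▸ e1
      simp only [e2, e3, Ne.symm e3, if_false, if_true]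
      ring
    · simp only [e1, Ne.symm e1, e2, if_false]
      ring
  · by_cases e2 : u j = u l
    · simp only [e1, e2, if_true]
      field_simp
      ring
    · simp only [e1, e2, Ne.symm e2, if_false, if_true]
      ring
  · by_cases e2 : u j = u l
    · have e3 : ¬ u i = u l := e2 ▸ e1
      simp only [e2, e3, if_false, if_true]
      ring
    · simp only [e1, e2, Ne.symm e2, if_false]
      ring
  · by_cases e2 : u j = u l
    · rw [klrB_eq_zero (Or.inr e1), map_zero]
      simp only [e1, e2, if_true]
      field_simp
      ring
    · rw [klrB_eq_zero (Or.inr e1), map_zero]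
      simp only [e1, e2, Ne.symm e2, if_false, if_true]
      ring
  · by_cases e2 : u i = u l
    · rw [klrB_eq e2 e1]
      simp only [← e2, e1, Ne.symm e1, if_false, if_true]
      have e2' : (u i : k) = u l := congrArg _ e2
      generalize scal c u = c'
      by_cases c1 : (u j : k) = q * u i
      · have c1' : (u j : k) = q * u l := by rwa [← e2']
        by_cases c2 : (u i : k) = q * u j
        · have c2' : (u l : k) = q * u j := by rwa [← e2']
          simp only [if_pos c1, if_pos c1', if_pos c2, if_pos c2', if_pos (And.intro c1 c2),
            map_sub, map_mul, map_ofNat]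
          field_simp
          ring
        · have c2' : ¬ (u l : k) = q * u j := by rwa [← e2']
          simp only [if_pos c1, if_pos c1', if_neg c2, if_neg c2', if_neg fun h : _ ∧ _ => c2 h.2,
            map_one]
          field_simp
          ring
      · have c1' : ¬ (u j : k) = q * u l := by rwa [← e2']
        by_cases c2 : (u i : k) = q * u j
        · have c2' : (u l : k) = q * u j := by rwa [← e2']
          simp only [if_neg c1, if_neg c1', if_pos c2, if_pos c2', if_neg fun h : _ ∧ _ => c1 h.1,
            map_neg, map_one]
          field_simp
          ring
        · have c2' : ¬ (u l : k) = q * u j := by rwa [← e2']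
          simp only [if_neg c1, if_neg c1', if_neg c2, if_neg c2', if_neg fun h : _ ∧ _ => c1 h.1,
            map_zero]
          ring
    · rw [klrB_eq_zero (Or.inl e2), map_zero]
      simp only [e1, Ne.symm e1, e2, if_false]
      ring

end Relations

/-! ### Comparison of the two sets of relations over coloured power series -/

section Comparison

variable {k : Type*} [Field k] {n : ℕ} {U : Finset k}

open KLR

open Classical in
/-- The twisted derivation of the KLR algebra: a divided difference on the weights with equal
neighbouring colours. -/
def klrD (r : Fin (n - 1)) (f : Col n U) : Col n U := fun u =>
  if u (lo r) = u (hi r) then ddiff (some (lo r)) (some (hi r)) (f u) else 0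

open Classical in
/-- The difference `B_r = T_r - Φ_r`. -/
def colB (Q b : PowerSeries k) (r : Fin (n - 1)) : Col n U := fun u =>
  if u (lo r) = u (hi r) then -1 else
    (scal (Q - 1) u) * colX b (hi r) u * (colX b (hi r) u - colX b (lo r) u)⁻¹

open Classical in
theorem colB_apply (Q b : PowerSeries k) (r : Fin (n - 1)) (u : Fin n → U) : colB Q b r u =
    if u (lo r) = u (hi r) then -1 else
      (scal (Q - 1) u) * colX b (hi r) u * (colX b (hi r) u - colX b (lo r) u)⁻¹ := rfl

open Classical in
/-- The image of `ψ_r` in the polynomial representation: `ψ_r 𝟙 = κ_r 𝟙`. -/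
def colKappa (q : k) (c : PowerSeries k) (r : Fin (n - 1)) : Col n U := fun u =>
  if u (lo r) = u (hi r) then 0
  else if (u (lo r) : k) = q * u (hi r) then
    colY (U := U) (hi r) u - colY (U := U) (lo r) u + scal c u
  else 1

/-- The twisted derivation of the affine Hecke algebra, for `T_r = A_r ψ_r + B_r`. -/
def heckeD (A B : Fin (n - 1) → Col n U) (r : Fin (n - 1)) (f : Col n U) : Col n U :=
  A r * klrD r f + B r * (f - act sig (adj r) f)

/-- The relations of the KLR algebra with scalars extended to coloured power series. -/
def IsKLR {B : Type*} [Ring B] (q : k) (c : PowerSeries k) (ι : Col n U →+* B)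
    (ψ : Fin (n - 1) → B) : Prop :=
  IsTwisted (fun r => act sig (adj r)) klrD (fun _ => 0) (fun r => klrQ q c (lo r) (hi r))
    (fun r r' => klrB q (lo r) (hi r) (hi r')) ι ψ

/-- The relations of the affine Hecke algebra with scalars extended to coloured power series. -/
def IsHecke {B : Type*} [Ring B] (Q : PowerSeries k) (A C : Fin (n - 1) → Col n U)
    (ι : Col n U →+* B) (T : Fin (n - 1) → B) : Prop :=
  IsTwisted (fun r => act sig (adj r)) (heckeD A C) (fun _ => scal (Q - 1)) (fun _ => scal Q)
    (fun _ _ => 0) ι T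

theorem toFrac_klrD (r : Fin (n - 1)) (f : Col n U) :
    toFrac (klrD r f) = klrM (lo r) (hi r) * (toFrac f - act sigFrac (adj r) (toFrac f)) := by
  ext1 u
  rw [← toFrac_act]
  simp only [toFrac_apply, Pi.mul_apply, Pi.sub_apply, klrM, klrD]
  split_ifs with h
  · have hu : u ∘ adj r = u := by
      ext1 i
      rcases eq_or_ne i (lo r) with rfl | h1
      · simp [h]
      · rcases eq_or_ne i (hi r) with rfl | h2
        · simp [h]
        · simp [adj_of_ne h1 h2]
    have hne := colY_sub_ne (U := U) (lo_ne_hi r).symm u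
    have := congrArg (algebraMap (Ser k n) (Frac k n)) (mul_ddiff (r := r) (f u))
    rw [act_apply, hu]
    simp only [map_mul, map_sub, toFrac_apply, colY] at this hne ⊢
    field_simp
    linear_combination this
  · simp

/-- Multiplication operators with coloured power series, on coloured fractions. -/
abbrev colOp : Col n U →+* AddMonoid.End ((Fin n → U) → Frac k n) :=
  (mulOp (α := U) (L := Frac k n)).comp toFrac

theorem isKLR_klrOp (q : k) (c : PowerSeries k) :
    IsKLR q c (colOp (n := n) (U := U)) (diffOp sigFrac (klrP q c) klrM) := by
  unfold IsKLR
  exact IsTwisted.pullback (isTwisted_klrOp (n := n) (U := U) q c) toFrac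
    (s := fun r => act sig (adj r)) (D := klrD) (a := fun _ => 0)
    (b := fun r => klrQ q c (lo r) (hi r)) (c := fun r r' => klrB q (lo r) (hi r) (hi r'))
    (fun r f => toFrac_act (adj r) f) toFrac_klrD (fun _ => map_zero toFrac) (fun _ => rfl)
    fun _ _ _ => rfl

theorem sub_add_atH_ne (c : PowerSeries k) {i j : Fin n} (hij : i ≠ j) :
    (MvPowerSeries.X (some j) - MvPowerSeries.X (some i) + atH c : Ser k n) ≠ 0 := by
  intro h0
  -- the coefficient of `y_j` is `1`
  have := congrArg (MvPowerSeries.coeff (Finsupp.single (some j) 1)) h0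
  classical
  have e : (Finsupp.single (some j) 1 : Option (Fin n) →₀ ℕ) ≠ 0 := by simp
  simp [coeff_atH, MvPowerSeries.coeff_X, hij.symm, Finsupp.single_left_inj] at this

theorem isLocallyFree_klrOp (q : k) (c : PowerSeries k) :
    IsLocallyFree (colOp (n := n) (U := U))
      (diffOp sigFrac (klrP q c) klrM) := by
  have key : ∀ i j, i ≠ j → ∀ u : Fin n → U, klrP q c i j u ≠ 0 := ?_
  · exact (isLocallyFree_diffOp (L := Frac k n) (α := U) (σ := sigFrac) (P := klrP q c) (M := klrM)
      sigFrac_injective key).pullback toFrac toFrac_injective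
  intro i j hij u
  have hne := colY_sub_ne (U := U) hij.symm u
  rw [klrP]
  split_ifs with h1 h2
  · exact inv_ne_zero hne
  · rw [← Pi.sub_apply, ← Pi.add_apply, ← map_sub, ← map_add, toFrac_apply, ne_eq,
      map_eq_zero_iff _ algebraMap_frac_injective, Pi.add_apply, scal_apply]
    exact sub_add_atH_ne c hij
  · exact one_ne_zero

open Classical in
theorem AFrac_eq (q : k) (c Q b : PowerSeries k) (r : Fin (n - 1)) (u : Fin n → U) :
    AFrac q c Q b r u =
      if u (lo r) = u (hi r) then heckeP Q b (lo r) (hi r) u *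
        algebraMap _ _ (MvPowerSeries.X (some (hi r)) - MvPowerSeries.X (some (lo r)) : Ser k n)
      else if (u (lo r) : k) = q * u (hi r) then heckeP Q b (lo r) (hi r) u / algebraMap _ _
        (MvPowerSeries.X (some (hi r)) - MvPowerSeries.X (some (lo r)) + atH c : Ser k n)
      else heckeP Q b (lo r) (hi r) u := by
  have : phiFrac Q b r u = heckeP Q b (lo r) (hi r) u := by
    rw [phiFrac, heckeP, map_sub, map_sub, map_mul, ← scal_apply Q u, div_eq_mul_inv]
    rfl
  rw [AFrac, this]

/-- The power series `A_r`, together with the properties through which they enter. -/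
structure IsTransition (q : k) (c Q b : PowerSeries k) (A : Fin (n - 1) → Col n U) : Prop where
  isUnit : ∀ r, IsUnit (A r)
  frac : ∀ r u, algebraMap _ (FractionRing (Ser k n)) (A r u) = AFrac q c Q b r u

theorem isUnit_of_constantCoeff {f : Ser k n} (h : MvPowerSeries.constantCoeff f ≠ 0) :
    IsUnit f := MvPowerSeries.isUnit_iff_constantCoeff.2 (isUnit_iff_ne_zero.2 h)

theorem constantCoeff_colX {b c d : PowerSeries k} (h : IsAdmissible n b c d) (i : Fin n)
    (u : Fin n → U) : MvPowerSeries.constantCoeff (colX b i u) = (u i : k) := by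
  have hb := h.b0
  rw [PowerSeries.coeff_zero_eq_constantCoeff_apply] at hb
  simp [colX, eigen, constantCoeff_atY, hb]

theorem constantCoeff_colX_sub {b c d : PowerSeries k} (h : IsAdmissible n b c d) {i j : Fin n}
    {u : Fin n → U} (hu : u i ≠ u j) :
    MvPowerSeries.constantCoeff (colX b i u - colX b j u) ≠ 0 := by
  rw [map_sub, constantCoeff_colX h, constantCoeff_colX h, sub_ne_zero]
  exact fun h => hu (Subtype.coe_injective h)

theorem constantCoeff_colX_sub_mul {b c d : PowerSeries k} (h : IsAdmissible n b c d) (q : k)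
    (i j : Fin n) (u : Fin n → U) : MvPowerSeries.constantCoeff (colX b i u -
      (atH (PowerSeries.C q * d) : Ser k n) * colX b j u) = u i - q * u j := by
  rw [map_sub, map_mul, constantCoeff_colX h, constantCoeff_colX h, constantCoeff_atH]
  simp [h.d0]

theorem colX_sub_mul_eq {q : k} {b c d : PowerSeries k} {i j : Fin n} {u : Fin n → U}
    (hu : (u i : k) = q * u j) {β : Ser k n} (e : atY b i - atH d * atY b j =
      (MvPowerSeries.X (some j) - MvPowerSeries.X (some i) + atH c) * β) :
    colX b i u - atH (PowerSeries.C q * d) * colX b j u = MvPowerSeries.C (u i : k) * β *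
      (MvPowerSeries.X (some j) - MvPowerSeries.X (some i) + atH c) := by
  have hQ' : (atH (PowerSeries.C q * d) : Ser k n) = MvPowerSeries.C q * atH d := by
    rw [atH_eq, atH_eq, map_mul]
    congr 1
    rw [← atH_eq, atH, PowerSeries.subst_C]
  have hC : (MvPowerSeries.C (u i : k) : Ser k n) =
      MvPowerSeries.C q * MvPowerSeries.C (u j : k) := by rw [← map_mul, hu]
  simp only [colX, eigen, hQ']
  linear_combination MvPowerSeries.C (u i : k) * e + atH d * atY b j * hC

theorem heckeP_eq_div (Q b : PowerSeries k) (i j : Fin n) (u : Fin n → U) :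
    heckeP Q b i j u = algebraMap (Ser k n) _ (colX b i u - atH Q * colX b j u) /
      algebraMap (Ser k n) _ (colX b j u - colX b i u) := by
  rw [heckeP, map_sub (algebraMap (Ser k n) (Frac k n)), map_sub (algebraMap (Ser k n) (Frac k n)),
    map_mul (algebraMap (Ser k n) (Frac k n)), ← scal_apply _ u, div_eq_mul_inv]
  rfl

theorem heckeP_ne {q : k} {b c d : PowerSeries k} (h : IsAdmissible n b c d)
    (hU : (0 : k) ∉ U) {i j : Fin n} (hij : i ≠ j) (u : Fin n → U) :
    heckeP (PowerSeries.C q * d) b i j u ≠ 0 := by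
  have hx := colX_sub_ne (U := U) h.b1 hU hij.symm u
  rw [toFrac_apply, toFrac_apply, ← map_sub] at hx
  rw [heckeP_eq_div]
  refine div_ne_zero ((map_ne_zero_iff _ algebraMap_frac_injective).2 ?_) hx
  by_cases hu : (u i : k) = q * u j
  · obtain ⟨β, hβ, e⟩ := h.factor i j hij
    rw [colX_sub_mul_eq hu e]
    refine mul_ne_zero (mul_ne_zero ?_ ?_) (sub_add_atH_ne c hij)
    · rw [ne_eq, ← map_zero (MvPowerSeries.C (σ := Option (Fin n))), MvPowerSeries.C_inj]
      exact fun h0 => hU (h0 ▸ (u i).2)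
    · rintro rfl
      exact hβ (map_zero _)
  · intro h0
    have := constantCoeff_colX_sub_mul h q i j u
    rw [h0, map_zero, eq_comm, sub_eq_zero] at this
    exact hu this

theorem exists_isTransition {q : k} {b c d : PowerSeries k} (h : IsAdmissible n b c d)
    (hq1 : q ≠ 1) (hU : (0 : k) ∉ U) :
    ∃ A : Fin (n - 1) → Col n U, IsTransition q c (PowerSeries.C q * d) b A := by
  have key : ∀ (r : Fin (n - 1)) (u : Fin n → U), ∃ a : Ser k n, IsUnit a ∧
      algebraMap _ (FractionRing (Ser k n)) a = AFrac q c (PowerSeries.C q * d) b r u := by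
    intro r u
    have hu0 : (u (lo r) : k) ≠ 0 := fun h0 => hU (h0 ▸ (u (lo r)).2)
    have hx := colX_sub_ne (U := U) h.b1 hU (lo_ne_hi r).symm u
    have hy := colY_sub_ne (U := U) (lo_ne_hi r).symm u
    rw [toFrac_apply, toFrac_apply] at hx hy
    rw [AFrac_eq]
    have hnum := constantCoeff_colX_sub_mul h q (lo r) (hi r) u
    rw [heckeP_eq_div]
    split_ifs with h1 h2
    · obtain ⟨β, hβ, e⟩ := exists_factor_atY (n := n) h.b1 (lo_ne_hi r)
      obtain ⟨β', hβ'⟩ := (isUnit_of_constantCoeff (f := β) (by simp [hβ])).exists_right_inv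
      have hC : (MvPowerSeries.C (u (lo r) : k)⁻¹ * MvPowerSeries.C (u (lo r) : k) : Ser k n) =
          1 := by
        rw [← map_mul, inv_mul_cancel₀ hu0, map_one]
      have e' : colX b (hi r) u - colX b (lo r) u = MvPowerSeries.C (u (lo r) : k) * β *
          (MvPowerSeries.X (some (hi r)) - MvPowerSeries.X (some (lo r))) := by
        simp only [colX, eigen, ← h1]
        linear_combination MvPowerSeries.C (u (lo r) : k) * e
      refine ⟨(colX b (lo r) u - atH (PowerSeries.C q * d) * colX b (hi r) u) *
        (MvPowerSeries.C (u (lo r) : k)⁻¹ * β'), ?_, ?_⟩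
      · refine (isUnit_of_constantCoeff ?_).mul (IsUnit.of_mul_eq_one
          (MvPowerSeries.C (u (lo r) : k) * β) (by linear_combination β' * β * hC + hβ'))
        rw [hnum, ← h1, ← one_sub_mul]
        exact mul_ne_zero (sub_ne_zero.2 hq1.symm) hu0
      · have := congrArg (algebraMap (Ser k n) (FractionRing (Ser k n))) (show
          (MvPowerSeries.C (u (lo r) : k)⁻¹ * β') * (colX b (hi r) u - colX b (lo r) u) =
            MvPowerSeries.X (some (hi r)) - MvPowerSeries.X (some (lo r)) by
          rw [e']
          linear_combination (MvPowerSeries.X (some (hi r)) - MvPowerSeries.X (some (lo r))) *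
            (β' * β * hC + hβ'))
        rw [map_mul, div_mul_eq_mul_div, eq_div_iff (by rwa [map_sub]), ← this]
        simp only [map_mul]
        ring
    · have hne : u (hi r) ≠ u (lo r) := Ne.symm h1
      obtain ⟨β, hβ, e⟩ := h.factor _ _ (lo_ne_hi r)
      obtain ⟨v, hv⟩ := (isUnit_of_constantCoeff (constantCoeff_colX_sub h hne)).exists_right_inv
      have e' := colX_sub_mul_eq h2 e
      refine ⟨MvPowerSeries.C (u (lo r) : k) * β * v, ?_, ?_⟩
      · refine (isUnit_of_constantCoeff ?_).mul (IsUnit.of_mul_eq_one _ (mul_comm v _ ▸ hv))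
        rw [map_mul, MvPowerSeries.constantCoeff_C]
        exact mul_ne_zero hu0 hβ
      · have hc : algebraMap (Ser k n) (FractionRing (Ser k n))
            (MvPowerSeries.X (some (hi r)) - MvPowerSeries.X (some (lo r)) + atH c) ≠ 0 :=
          (map_ne_zero_iff _ algebraMap_frac_injective).2 (sub_add_atH_ne c (lo_ne_hi r))
        have := congrArg (algebraMap (Ser k n) (FractionRing (Ser k n))) hv
        rw [e', map_mul _ (_ * _), eq_div_iff hc, eq_div_iff (by rwa [map_sub])]
        rw [map_mul, map_one] at this
        rw [map_mul (algebraMap (Ser k n) (Frac k n)) (_ * β)]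
        linear_combination algebraMap (Ser k n) (FractionRing (Ser k n))
          (MvPowerSeries.C (u (lo r) : k) * β) * algebraMap (Ser k n) (FractionRing (Ser k n))
          (MvPowerSeries.X (some (hi r)) - MvPowerSeries.X (some (lo r)) + atH c) * this
    · have hne : u (hi r) ≠ u (lo r) := Ne.symm h1
      obtain ⟨v, hv⟩ := (isUnit_of_constantCoeff (constantCoeff_colX_sub h hne)).exists_right_inv
      refine ⟨(colX b (lo r) u - atH (PowerSeries.C q * d) * colX b (hi r) u) * v, ?_, ?_⟩
      · refine (isUnit_of_constantCoeff ?_).mul (IsUnit.of_mul_eq_one _ (mul_comm v _ ▸ hv))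
        rw [hnum]
        exact sub_ne_zero.2 h2
      · rw [eq_div_iff (by rwa [map_sub]), ← map_mul, mul_assoc, mul_comm v, hv, mul_one]
  choose A hA hA' using key
  refine ⟨A, fun r => ?_, hA'⟩
  exact Pi.isUnit_iff.2 (hA r)

section Transition

variable {q : k} {b c d : PowerSeries k} {A : Fin (n - 1) → Col n U}

theorem IsTransition.mul_klrP {Q : PowerSeries k} (hA : IsTransition q c Q b A)
    (r : Fin (n - 1)) : toFrac (A r) * klrP q c (lo r) (hi r) = heckeP Q b (lo r) (hi r) := by
  ext1 u
  have hy := colY_sub_ne (U := U) (lo_ne_hi r).symm u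
  have hc := (map_ne_zero_iff _ (algebraMap_frac_injective (k := k))).2
    (sub_add_atH_ne c (lo_ne_hi r))
  rw [Pi.mul_apply, toFrac_apply, hA.frac, AFrac_eq, klrP]
  simp only [toFrac_apply, colY, scal_apply, map_add, map_sub] at hy hc ⊢
  split_ifs <;> field_simp

theorem IsTransition.mul_klrM {Q : PowerSeries k} (hA : IsTransition q c Q b A)
    (h : IsAdmissible n b c d) (hU : (0 : k) ∉ U) (r : Fin (n - 1)) :
    toFrac (A r) * klrM (lo r) (hi r) + toFrac (colB Q b r) = heckeM Q b (lo r) (hi r) := by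
  ext1 u
  have hy := colY_sub_ne (U := U) (lo_ne_hi r).symm u
  have hx := colX_sub_ne (U := U) h.b1 hU (lo_ne_hi r).symm u
  rw [Pi.add_apply, Pi.mul_apply, toFrac_apply, hA.frac, AFrac_eq, klrM, toFrac_apply (colB Q b r),
    colB_apply]
  simp only [heckeP, heckeM, Pi.mul_apply, Pi.sub_apply, Pi.inv_apply, Pi.one_apply]
  simp only [toFrac_apply] at hx hy ⊢
  split_ifs with h1 h2
  · simp only [colY, map_sub, map_neg, map_one] at hy ⊢
    field_simp
    ring
  all_goals
    have hv := MvPowerSeries.mul_inv_cancel _ (constantCoeff_colX_sub h (Ne.symm h1))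
    have := congrArg (algebraMap (Ser k n) (Frac k n)) hv
    rw [map_mul, map_sub, map_one] at this
    rw [mul_zero, zero_add, map_mul, map_mul, eq_inv_of_mul_eq_one_right this, map_sub, map_one,
      Pi.sub_apply, Pi.one_apply, map_sub, map_one]

/-- Demazure–Lusztig operators in terms of KLR operators. -/
theorem IsTransition.heckeOp_eq {Q : PowerSeries k} (hA : IsTransition q c Q b A)
    (h : IsAdmissible n b c d) (hU : (0 : k) ∉ U) (r : Fin (n - 1)) :
    colOp (A r) * diffOp sigFrac (klrP q c) klrM r +
      colOp (colB Q b r) = diffOp sigFrac (heckeP Q b) (heckeM Q b) r := by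
  refine DFunLike.ext _ _ fun g => ?_
  change toFrac (A r) * (klrP q c (lo r) (hi r) * act sigFrac (adj r) g +
    klrM (lo r) (hi r) * g) + toFrac (colB Q b r) * g = heckeP Q b (lo r) (hi r) *
    act sigFrac (adj r) g + heckeM Q b (lo r) (hi r) * g
  rw [← hA.mul_klrP, ← hA.mul_klrM h hU]
  ring

theorem isHecke_heckeOp {Q : PowerSeries k} (hA : IsTransition q c Q b A)
    (h : IsAdmissible n b c d) (hU : (0 : k) ∉ U) :
    IsHecke Q A (colB Q b) (colOp (n := n) (U := U))
      (diffOp sigFrac (heckeP Q b) (heckeM Q b)) := by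
  unfold IsHecke
  refine IsTwisted.pullback (isTwisted_heckeOp (n := n) (U := U) Q h.b1 hU) toFrac
    (s := fun r => act sig (adj r)) (D := heckeD A (colB Q b)) (a := fun _ => scal (Q - 1))
    (b := fun _ => scal Q) (c := fun _ _ => 0)
    (fun r f => toFrac_act (adj r) f) (fun r f => ?_) (fun _ => rfl) (fun _ => rfl)
    fun _ _ _ => map_zero toFrac
  rw [← hA.mul_klrM h hU, heckeD, map_add, map_mul, map_mul, toFrac_klrD, map_sub, toFrac_act]
  ring

theorem isLocallyFree_heckeOp {Q : PowerSeries k} (hQ : ∀ i j, i ≠ j → ∀ u : Fin n → U,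
      heckeP Q b i j u ≠ 0) :
    IsLocallyFree (colOp (n := n) (U := U))
      (diffOp sigFrac (heckeP Q b) (heckeM Q b)) :=
  (isLocallyFree_diffOp (L := Frac k n) (α := U) (σ := sigFrac) (P := heckeP Q b)
    (M := heckeM Q b) sigFrac_injective hQ).pullback toFrac toFrac_injective

/-- In any ring, elements with the relations of the KLR algebra yield elements with the relations of
the affine Hecke algebra. -/
theorem IsKLR.isHecke {R : Type*} [Ring R] {Q : PowerSeries k} {ι : Col n U →+* R}
    {ψ : Fin (n - 1) → R} (hψ : IsKLR q c ι ψ) (hA : IsTransition q c Q b A)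
    (h : IsAdmissible n b c d) (hU : (0 : k) ∉ U) :
    IsHecke Q A (colB Q b) ι fun r => ι (A r) * ψ r + ι (colB Q b r) := by
  refine IsTwisted.transfer hψ (isKLR_klrOp q c) (isLocallyFree_klrOp q c) ?_
  rw [funext fun r => hA.heckeOp_eq h hU r]
  exact isHecke_heckeOp hA h hU

theorem IsTransition.inverse_mul {Q : PowerSeries k} (hA : IsTransition q c Q b A)
    (r : Fin (n - 1)) : Ring.inverse (A r) * A r = 1 := Ring.inverse_mul_cancel _ (hA.isUnit r)

/-- In any ring, elements with the relations of the affine Hecke algebra yield elements with the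
relations of the KLR algebra. -/
theorem IsHecke.isKLR {R : Type*} [Ring R] {Q : PowerSeries k} {ι : Col n U →+* R}
    {T : Fin (n - 1) → R} (hT : IsHecke Q A (colB Q b) ι T) (hA : IsTransition q c Q b A)
    (h : IsAdmissible n b c d) (hU : (0 : k) ∉ U) (hQ : ∀ i j, i ≠ j → ∀ u : Fin n → U,
      heckeP Q b i j u ≠ 0) :
    IsKLR q c ι fun r => ι (Ring.inverse (A r)) * T r + ι (-(Ring.inverse (A r) * colB Q b r)) := by
  refine IsTwisted.transfer hT (isHecke_heckeOp hA h hU) (isLocallyFree_heckeOp hQ) ?_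
  rw [show (fun r => _) = diffOp sigFrac (klrP (U := U) q c) klrM from funext fun r => ?_]
  · exact isKLR_klrOp q c
  rw [← hA.heckeOp_eq h hU, mul_add, ← mul_assoc, ← map_mul, ← map_mul, hA.inverse_mul, map_one,
    one_mul, map_neg, add_neg_cancel_right]

/-- On the generator of the polynomial representations, `T_r = A_r ψ_r + B_r` acts by `-1`. -/
theorem IsTransition.mul_colKappa {Q : PowerSeries k} (hA : IsTransition q c Q b A)
    (h : IsAdmissible n b c d) (hU : (0 : k) ∉ U) (r : Fin (n - 1)) :
    A r * colKappa q c r + colB Q b r + 1 = 0 := by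
  apply toFrac_injective
  have hκ : toFrac (colKappa (U := U) q c r) = klrP q c (lo r) (hi r) + klrM (lo r) (hi r) := by
    ext1 u
    rw [Pi.add_apply, klrP, klrM, toFrac_apply, colKappa]
    split_ifs
    · simp
    · simp [toFrac_apply]
    · simp
  have e : toFrac (A r * colKappa q c r + colB Q b r + 1) = heckeP Q b (lo r) (hi r) +
      heckeM Q b (lo r) (hi r) + 1 := by
    rw [← hA.mul_klrP, ← hA.mul_klrM h hU, map_add, map_add, map_mul, hκ, map_one]
    ring
  rw [e, map_zero]
  ext1 u
  have hx := colX_sub_ne (U := U) h.b1 hU (lo_ne_hi r).symm u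
  simp only [heckeP, heckeM, Pi.mul_apply, Pi.add_apply, Pi.sub_apply, Pi.inv_apply, Pi.one_apply,
    Pi.zero_apply]
  field_simp
  ring

end Transition

section Continuity

/-- Coloured power series without terms of total degree less than `N`. -/
def colVanish (N : ℕ) : Ideal (Col n U) := Ideal.pi fun _ => vanish N

theorem act_mem_colVanish (w : Equiv.Perm (Fin n)) {N : ℕ} {f : Col n U} (hf : f ∈ colVanish N) :
    act sig w f ∈ colVanish N := fun _ => sig_mem_vanish _ (hf _)

theorem colVanish_mono {M N : ℕ} (h : M ≤ N) {f : Col n U} (hf : f ∈ colVanish N) :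
    f ∈ colVanish M := fun u => vanish_mono h (hf u)

theorem klrD_mem_colVanish (r : Fin (n - 1)) {N : ℕ} {f : Col n U} (hf : f ∈ colVanish (N + 1)) :
    klrD r f ∈ colVanish N := by
  intro u
  rw [klrD]
  split_ifs
  · exact ddiff_mem_vanish _ _ (hf u)
  · exact zero_mem _

theorem heckeD_mem_colVanish (A B : Fin (n - 1) → Col n U) (r : Fin (n - 1)) {N : ℕ} {f : Col n U}
    (hf : f ∈ colVanish (N + 1)) : heckeD A B r f ∈ colVanish N :=
  add_mem (Ideal.mul_mem_left _ _ (klrD_mem_colVanish r hf)) (Ideal.mul_mem_left _ _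
    (colVanish_mono N.le_succ (sub_mem hf (act_mem_colVanish _ hf))))

end Continuity

end Comparison

/-! ### Homomorphisms between completions -/

section CompletionMaps

variable {K : Type*} [CommRing K] {A A' : Type*} [Ring A] [Algebra K A] [Ring A'] [Algebra K A']
  {G : Set A} {G' : Set A'}

namespace Compl

/-- The component modulo `A · I ^ m · A`, as a homomorphism. -/
def projHom (G : Set A) (m : ℕ) : Compl K G →ₐ[K] A ⧸ powIdeal G m :=
  (Pi.evalAlgHom K (fun m : ℕ => A ⧸ powIdeal G m) m).comp (complSubalgebra K G).val

theorem projHom_apply (m : ℕ) (x : Compl K G) : projHom G m x = Compl.proj K m x := rfl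

theorem projHom_toCompl (m : ℕ) (a : A) :
    projHom G m (toCompl K G a) = Ideal.Quotient.mk (powIdeal G m) a := rfl

theorem ext_proj {x y : Compl K G} (h : ∀ m, projHom G m x = projHom G m y) : x = y :=
  Subtype.ext (funext h)

/-- The elements of the completion that vanish modulo `A · I ^ m · A`. -/
def lev (K : Type*) [CommRing K] {A : Type*} [Ring A] [Algebra K A] (G : Set A) (m : ℕ) :
    Ideal (Compl K G) := RingHom.ker (projHom (K := K) G m)

theorem mem_lev {m : ℕ} {x : Compl K G} : x ∈ lev K G m ↔ projHom G m x = 0 := Iff.rfl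

theorem mul_mem_lev {m : ℕ} {x : Compl K G} (hx : x ∈ lev K G m) (y : Compl K G) :
    x * y ∈ lev K G m := by
  rw [mem_lev, map_mul, mem_lev.1 hx, zero_mul]

theorem eq_zero_of_mem_lev {x : Compl K G} (h : ∀ m, x ∈ lev K G m) : x = 0 :=
  ext_proj fun m => by rw [h m, map_zero]

theorem eq_of_sub_mem_lev {x y : Compl K G} (h : ∀ m, x - y ∈ lev K G m) : x = y :=
  sub_eq_zero.1 (eq_zero_of_mem_lev h)

theorem exists_sub_mem_lev (x : Compl K G) (m : ℕ) : ∃ a : A, x - toCompl K G a ∈ lev K G m := by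
  obtain ⟨a, ha⟩ := x.2 m
  refine ⟨a, ?_⟩
  rw [mem_lev, map_sub, projHom_toCompl, ha m le_rfl]
  exact sub_self _

section lift

variable (f : A →ₐ[K] Compl K G') (hf : ∀ m, ∀ x ∈ G ^ m, f x ∈ lev K G' m)

include hf in
theorem map_mem_lev {m : ℕ} {x : A} (hx : x ∈ powIdeal G m) : f x ∈ lev K G' m := by
  have : TwoSidedIdeal.span (G ^ m) ≤ TwoSidedIdeal.ker ((projHom G' m).comp f) :=
    TwoSidedIdeal.span_le.2 fun y hy => (TwoSidedIdeal.mem_ker _).2 (hf m y hy)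
  exact (TwoSidedIdeal.mem_ker ((projHom G' m).comp f)).1 (this hx)

/-- The map of quotients that is induced by a homomorphism compatible with the filtrations. -/
def quotMap (m : ℕ) : A ⧸ powIdeal G m →ₐ[K] A' ⧸ powIdeal G' m :=
  Ideal.Quotient.liftₐ (powIdeal G m) ((projHom G' m).comp f) fun _ hx => map_mem_lev f hf hx

/-- A homomorphism which is compatible with the filtrations extends to the completion. -/
def lift : Compl K G →ₐ[K] Compl K G' :=
  AlgHom.codRestrict (AlgHom.pi fun m => (quotMap f hf m).comp (projHom G m))
    (complSubalgebra K G') fun x m => by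
      obtain ⟨a, ha⟩ := x.2 m
      obtain ⟨a', ha'⟩ := (f a).2 m
      refine ⟨a', fun l hl => ?_⟩
      rw [ha' l hl]
      change _ = quotMap f hf l (x.1 l)
      rw [← ha l hl]
      rfl

theorem projHom_lift (m : ℕ) (x : Compl K G) :
    projHom G' m (lift f hf x) = quotMap f hf m (projHom G m x) := rfl

theorem lift_mem_lev {m : ℕ} {x : Compl K G} (hx : x ∈ lev K G m) : lift f hf x ∈ lev K G' m := by
  rw [mem_lev, projHom_lift, mem_lev.1 hx, map_zero]

theorem continuous_lift : Continuous (lift f hf) := by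
  refine continuous_iInf_rng.2 fun m => continuous_induced_rng.2 ?_
  refine continuous_iInf_dom (i := m) ?_
  let _ : TopologicalSpace (A ⧸ powIdeal G m) := ⊥
  exact continuous_def.2 fun s _ => isOpen_induced_iff.2 ⟨quotMap f hf m ⁻¹' s, trivial, rfl⟩

end lift

/-- A homomorphism to a completion which respects the filtrations is determined by its restriction
to the dense subalgebra. -/
theorem eq_of_toCompl {f g : Compl K G →ₐ[K] Compl K G'}
    (hf : ∀ m, ∀ x ∈ lev K G m, f x ∈ lev K G' m) (hg : ∀ m, ∀ x ∈ lev K G m, g x ∈ lev K G' m)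
    (h : ∀ a, f (toCompl K G a) = g (toCompl K G a)) (x : Compl K G) : f x = g x := by
  refine eq_of_sub_mem_lev fun m => ?_
  obtain ⟨a, ha⟩ := exists_sub_mem_lev x m
  have := sub_mem (hf m _ ha) (hg m _ ha)
  rwa [map_sub, map_sub, h, sub_sub_sub_cancel_right] at this

end Compl

/-- The left ideal of the completion is generated by generators of the left ideal. -/
theorem complIdeal_span (s : Set A) : complIdeal K G (Submodule.span A s) =
    Submodule.span (Compl K G) (toCompl K G '' s) := by
  refine le_antisymm (Submodule.span_le.2 ?_)
    (Submodule.span_mono (Set.image_mono Submodule.subset_span))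
  rintro _ ⟨x, hx, rfl⟩
  refine Submodule.span_induction (p := fun x _ => toCompl K G x ∈
    Submodule.span (Compl K G) (toCompl K G '' s)) (fun x hx => ?_) ?_ (fun x y _ _ hx hy => ?_)
    (fun a x _ hx => ?_) hx
  · exact Submodule.subset_span ⟨x, hx, rfl⟩
  · rw [map_zero]
    exact zero_mem _
  · rw [map_add]
    exact add_mem hx hy
  · rw [smul_eq_mul, map_mul]
    exact Submodule.smul_mem _ _ hx

end CompletionMaps

/-! ### Polynomials and power series in commuting elements -/

section PolyHom

variable {k : Type*} [Field k] {n : ℕ} {A : Type*} [Ring A] [Algebra (PowerSeries k) A]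

open KLR

open scoped IsMulCommutative in
/-- The value of a polynomial in `h, y_1, …, y_n` at pairwise commuting elements `x_1, …, x_n` of a
`k[[h]]`-algebra. -/
def polyHom (x : Fin n → A) (hx : ∀ i j, x i * x j = x j * x i) :
    MvPolynomial (Option (Fin n)) k →+* A :=
  have comm : ∀ a ∈ Set.range x, ∀ b ∈ Set.range x, a * b = b * a := by
    rintro _ ⟨i, rfl⟩ _ ⟨j, rfl⟩
    exact hx i j
  have := Algebra.isMulCommutative_adjoin (PowerSeries k) comm
  (Algebra.adjoin (PowerSeries k) (Set.range x)).val.toRingHom.comp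
    (MvPolynomial.eval₂Hom (S₁ := Algebra.adjoin (PowerSeries k) (Set.range x))
      ((algebraMap (PowerSeries k) (Algebra.adjoin (PowerSeries k) (Set.range x))).comp
        PowerSeries.C) fun i : Option (Fin n) =>
      i.elim (algebraMap (PowerSeries k) _ PowerSeries.X) fun i =>
        ⟨x i, Algebra.subset_adjoin ⟨i, rfl⟩⟩)

variable {x : Fin n → A} (hx : ∀ i j, x i * x j = x j * x i)

open scoped IsMulCommutative in
theorem polyHom_C (t : k) : polyHom x hx (MvPolynomial.C t) =
    algebraMap (PowerSeries k) A (PowerSeries.C t) := by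
  simp [polyHom]

open scoped IsMulCommutative in
theorem polyHom_X_none : polyHom x hx (MvPolynomial.X none : MvPolynomial (Option (Fin n)) k) =
    algebraMap (PowerSeries k) A PowerSeries.X := by
  simp [polyHom]

open scoped IsMulCommutative in
theorem polyHom_X_some (i : Fin n) :
    polyHom x hx (MvPolynomial.X (some i) : MvPolynomial (Option (Fin n)) k) = x i := by
  simp [polyHom]

theorem polyHom_monomial (d : Option (Fin n) →₀ ℕ) (t : k) :
    polyHom x hx (MvPolynomial.monomial d t) =
      PowerSeries.monomial (d none) t • (List.ofFn fun i => x i ^ d (some i)).prod := by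
  have e : (MvPolynomial.monomial d t : MvPolynomial (Option (Fin n)) k) =
      MvPolynomial.C t * (MvPolynomial.X none ^ d none *
        (List.ofFn fun i : Fin n => MvPolynomial.X (some i) ^ d (some i)).prod) := by
    rw [MvPolynomial.monomial_eq, Finsupp.prod_fintype _ _ (by simp), Fintype.prod_option,
      List.prod_ofFn]
  rw [e, map_mul, map_mul, map_pow, map_list_prod, List.map_ofFn, polyHom_C, polyHom_X_none,
    ← mul_assoc, ← map_pow, ← map_mul, Algebra.smul_def]
  congr 2
  · rw [PowerSeries.monomial_eq_mk]
    ext j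
    simp [PowerSeries.coeff_X_pow]
  · congr 2
    ext1 i
    simp [polyHom_X_some]

theorem commute_polyHom {z : A} (hz : ∀ i, Commute z (x i)) (p : MvPolynomial (Option (Fin n)) k) :
    Commute z (polyHom x hx p) := by
  induction p using MvPolynomial.induction_on with
  | C t =>
    rw [polyHom_C]
    exact (Algebra.commutes _ _).symm
  | add p q hp hq =>
    rw [map_add]
    exact hp.add_right hq
  | mul_X p i hp =>
    rw [map_mul]
    refine hp.mul_right ?_
    cases i with
    | none =>
      rw [polyHom_X_none]
      exact (Algebra.commutes _ _).symm
    | some i =>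
      rw [polyHom_X_some]
      exact hz i

end PolyHom

/-! ### Coloured power series in the completed KLR algebra -/

section KSide

variable {k : Type*} [Field k] (q : k) (c : PowerSeries k) (U : Finset k) {n : ℕ}

namespace KLR

/-- The projection from the free algebra. -/
def quot (n : ℕ) : FreeAlgebra (PowerSeries k) (KGen U n) →ₐ[PowerSeries k] KLR q c U n :=
  RingQuot.mkAlgHom (PowerSeries k) (KRel q c U n)

theorem rel {x y : FreeAlgebra (PowerSeries k) (KGen U n)} (h : KRel q c U n x y) :
    quot q c U n x = quot q c U n y := RingQuot.mkAlgHom_rel _ h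

theorem gen_y_comm (i j : Fin n) :
    gen q c U n (.y i) * gen q c U n (.y j) = gen q c U n (.y j) * gen q c U n (.y i) := by
  have := rel q c U (.y_comm i j)
  rwa [map_mul, map_mul] at this

theorem term_eq (d : Option (Fin n) →₀ ℕ) (t : k) : term q c U d t =
    polyHom (fun i => gen q c U n (.y i)) (gen_y_comm q c U) (MvPolynomial.monomial d t) :=
  (polyHom_monomial _ _ _).symm

theorem partialSum_eq (f : Ser k n) (m : ℕ) : partialSum q c U f m =
    polyHom (fun i => gen q c U n (.y i)) (gen_y_comm q c U) (f.truncTotal m) := by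
  have : f.truncTotal m = ∑ d ∈ (Finsupp.finite_of_degree_lt m).toFinset,
      MvPolynomial.monomial d (MvPowerSeries.coeff d f) := rfl
  rw [partialSum, this, map_sum]
  simp only [term_eq]

theorem polyHom_mem_powIdeal {p : MvPolynomial (Option (Fin n)) k} {m : ℕ}
    (hp : (p : Ser k n) ∈ vanish m) :
    polyHom (fun i => gen q c U n (.y i)) (gen_y_comm q c U) p ∈
      powIdeal (idealGens q c U n) m := by
  rw [p.as_sum, map_sum]
  refine sum_mem fun d hd => ?_
  rw [← term_eq]
  refine term_mem q c U d ?_ _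
  by_contra hlt
  rw [MvPolynomial.mem_support_iff, ← MvPolynomial.coeff_coe] at hd
  exact hd (mem_vanish_iff.1 hp d (not_le.1 hlt))

theorem projHom_ev (f : Ser k n) (m : ℕ) : Compl.projHom (idealGens q c U n) m (ev q c U f) =
    Ideal.Quotient.mk _ (polyHom (fun i => gen q c U n (.y i)) (gen_y_comm q c U)
      (f.truncTotal m)) := by
  rw [← partialSum_eq]
  rfl

theorem projHom_ev_of_sub_mem {f : Ser k n} {p : MvPolynomial (Option (Fin n)) k} {m : ℕ}
    (h : f - p ∈ vanish m) : Compl.projHom (idealGens q c U n) m (ev q c U f) =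
    Ideal.Quotient.mk _ (polyHom (fun i => gen q c U n (.y i)) (gen_y_comm q c U) p) := by
  rw [projHom_ev, Ideal.Quotient.eq, ← map_sub]
  apply polyHom_mem_powIdeal
  have := sub_mem h (sub_truncTotal_mem_vanish m f)
  rw [sub_sub_sub_cancel_left] at this
  rwa [← MvPolynomial.coeToMvPowerSeries.ringHom_apply, map_sub]

/-- Evaluation of power series in `h, y_1, …, y_n`, as a homomorphism. -/
def evHom : Ser k n →+* Hat q c U n where
  toFun := ev q c U
  map_one' := Compl.ext_proj fun m => by
    rw [projHom_ev_of_sub_mem q c U (p := 1) (by simp), map_one, map_one, map_one]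
  map_zero' := Compl.ext_proj fun m => by
    rw [projHom_ev_of_sub_mem q c U (p := 0) (by simp), map_zero, map_zero, map_zero]
  map_add' f g := Compl.ext_proj fun m => by
    rw [projHom_ev_of_sub_mem q c U (p := f.truncTotal m + g.truncTotal m), map_add, map_add,
      map_add, projHom_ev, projHom_ev]
    rw [MvPolynomial.coe_add, add_sub_add_comm]
    exact add_mem (sub_truncTotal_mem_vanish m f) (sub_truncTotal_mem_vanish m g)
  map_mul' f g := Compl.ext_proj fun m => by
    rw [projHom_ev_of_sub_mem q c U (p := f.truncTotal m * g.truncTotal m), map_mul, map_mul,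
      map_mul, projHom_ev, projHom_ev]
    have : f * g - ((f.truncTotal m * g.truncTotal m : MvPolynomial (Option (Fin n)) k) :
        Ser k n) = g * (f - f.truncTotal m) + f.truncTotal m * (g - g.truncTotal m) := by
      rw [MvPolynomial.coe_mul]
      ring
    rw [this]
    exact add_mem (Ideal.mul_mem_left _ _ (sub_truncTotal_mem_vanish m f))
      (Ideal.mul_mem_left _ _ (sub_truncTotal_mem_vanish m g))

theorem evHom_apply (f : Ser k n) : evHom q c U f = ev q c U f := rfl

theorem evHom_mem_lev {f : Ser k n} {m : ℕ} (hf : f ∈ vanish m) :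
    evHom q c U f ∈ Compl.lev (PowerSeries k) (idealGens q c U n) m := by
  rw [Compl.mem_lev, evHom_apply, projHom_ev_of_sub_mem q c U (p := 0) (by simpa), map_zero,
    map_zero]

theorem evHom_coe (p : MvPolynomial (Option (Fin n)) k) : evHom q c U (p : Ser k n) =
    toCompl _ _ (polyHom (fun i => gen q c U n (.y i)) (gen_y_comm q c U) p) :=
  Compl.ext_proj fun m => by
    rw [evHom_apply, projHom_ev_of_sub_mem q c U (p := p) (by simp), Compl.projHom_toCompl]

theorem evHom_X_some (i : Fin n) :
    evHom q c U (MvPowerSeries.X (some i)) = kgen q c U n (.y i) := by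
  rw [← MvPolynomial.coe_X, evHom_coe, polyHom_X_some]

theorem evHom_X_none : evHom (n := n) q c U (MvPowerSeries.X none) =
    algebraMap (PowerSeries k) _ PowerSeries.X := by
  rw [← MvPolynomial.coe_X, evHom_coe, polyHom_X_none, AlgHom.commutes]

theorem evHom_C (t : k) : evHom (n := n) q c U (MvPowerSeries.C t) =
    algebraMap (PowerSeries k) _ (PowerSeries.C t) := by
  rw [← MvPolynomial.coe_C, evHom_coe, polyHom_C, AlgHom.commutes]

section generators

variable (n)

theorem kgen_complete_orthogonal :
    CompleteOrthogonalIdempotents fun u : Fin n → U => kgen q c U n (.e u) := by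
  classical
  have key : ∀ u v : Fin n → U, gen q c U n (.e u) * gen q c U n (.e v) =
      if u = v then gen q c U n (.e u) else 0 := by
    intro u v
    have := rel q c U (.e_mul_e u v)
    rw [map_mul] at this
    refine this.trans ?_
    split_ifs
    · rfl
    · exact map_zero (quot q c U n)
  have hsum := rel q c U (n := n) .sum_e
  rw [map_sum, map_one] at hsum
  refine ⟨⟨fun u => ?_, fun u v huv => ?_⟩, ?_⟩
  · rw [IsIdempotentElem, ← map_mul, key, if_pos rfl]
  · change _ * _ = 0
    rw [← map_mul, key, if_neg huv, map_zero]
  · rw [← map_sum]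
    exact (congrArg _ hsum).trans (map_one (toCompl _ _))

variable {n}

theorem kgen_e_commute (u : Fin n → U) (f : Ser k n) :
    Commute (kgen q c U n (.e u)) (evHom q c U f) := by
  refine Compl.eq_of_sub_mem_lev fun m => ?_
  rw [Compl.mem_lev, map_sub, sub_eq_zero, map_mul, map_mul, evHom_apply, projHom_ev,
    Compl.projHom_toCompl, ← map_mul, ← map_mul]
  refine congrArg _ (commute_polyHom _ (fun i => ?_) _)
  have := rel q c U (.y_e i u)
  rw [map_mul, map_mul] at this
  exact this.symm

/-- Coloured power series as elements of the completed KLR algebra. -/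
def colEv : Col n U →+* Hat q c U n where
  toFun f := ∑ u, evHom q c U (f u) * kgen q c U n (.e u)
  map_one' := by
    simp only [Pi.one_apply, map_one, one_mul]
    exact (kgen_complete_orthogonal q c U n).complete
  map_zero' := by simp
  map_add' f g := by simp [add_mul, Finset.sum_add_distrib]
  map_mul' f g := by
    rw [Finset.sum_mul_sum]
    refine Finset.sum_congr rfl fun u _ => ?_
    rw [Finset.sum_eq_single u (fun v _ hv => ?_) (by simp)]
    · rw [mul_assoc, ← mul_assoc (kgen q c U n (.e u)), (kgen_e_commute q c U u _).eq, mul_assoc,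
        (kgen_complete_orthogonal q c U n).idem u, Pi.mul_apply, map_mul, mul_assoc]
    · rw [mul_assoc, ← mul_assoc (kgen q c U n (.e u)), (kgen_e_commute q c U u _).eq, mul_assoc,
        (kgen_complete_orthogonal q c U n).ortho hv.symm, mul_zero, mul_zero]

theorem colEv_apply (f : Col n U) :
    colEv q c U f = ∑ u, ev q c U (f u) * kgen q c U n (.e u) := rfl

theorem colEv_mul_e (f : Col n U) (u : Fin n → U) :
    colEv q c U f * kgen q c U n (.e u) = ev q c U (f u) * kgen q c U n (.e u) := by
  rw [colEv_apply, Finset.sum_mul, Finset.sum_eq_single u (fun v _ hv => ?_) (by simp), mul_assoc,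
    (kgen_complete_orthogonal q c U n).idem u]
  rw [mul_assoc, (kgen_complete_orthogonal q c U n).ortho hv, mul_zero]

/-- Elements are determined by their products with the idempotents. -/
theorem eq_of_mul_e {x y : Hat q c U n}
    (h : ∀ u, x * kgen q c U n (.e u) = y * kgen q c U n (.e u)) : x = y := by
  have e := (kgen_complete_orthogonal q c U n).complete
  rw [← mul_one x, ← mul_one y, ← e, Finset.mul_sum, Finset.mul_sum]
  exact Finset.sum_congr rfl fun u _ => h u

theorem colEv_mem_lev {f : Col n U} {m : ℕ} (hf : f ∈ colVanish m) :
    colEv q c U f ∈ Compl.lev (PowerSeries k) (idealGens q c U n) m :=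
  sum_mem fun u _ => Compl.mul_mem_lev (evHom_mem_lev q c U (hf u)) _

theorem colEv_colY (i : Fin n) : colEv q c U (colY i) = kgen q c U n (.y i) := by
  refine eq_of_mul_e q c U fun u => ?_
  rw [colEv_mul_e, ← evHom_apply, colY, evHom_X_some]

open Classical in
theorem colEv_single (u : Fin n → U) : colEv q c U (Pi.single u 1) = kgen q c U n (.e u) := by
  rw [colEv_apply, Finset.sum_eq_single u (fun v _ hv => ?_) (by simp), Pi.single_eq_same,
    ← evHom_apply, map_one, one_mul]
  rw [Pi.single_eq_of_ne hv, ← evHom_apply, map_zero, zero_mul]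

end generators

end KLR

end KSide

/-! ### Approximation of coloured power series by polynomials -/

section Approximation

variable {k : Type*} [Field k] {n : ℕ} {U : Finset k}

open KLR

theorem scal_C (t : k) : (scal (PowerSeries.C t) : Col n U) = fun _ => MvPowerSeries.C t := by
  ext1 u
  rw [scal_apply, atH, PowerSeries.subst_C]

theorem scal_X : (scal PowerSeries.X : Col n U) = fun _ => MvPowerSeries.X none := by
  ext1 u
  rw [scal_apply, atH, PowerSeries.subst_X (hasSubst_var _)]

/-- A constant family of power series. -/
def colConst : Ser k n →+* Col n U := Pi.constRingHom _ _

/-- The subring generated by the `scal`, the variables and the idempotents is dense. -/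
theorem exists_sub_mem_of_colY (S : Subring (Col n U)) (hS : ∀ Q, scal Q ∈ S)
    (hy : ∀ i, colY i ∈ S) (he : ∀ u, ∃ g ∈ S, ∀ v, g v = open Classical in if v = u then 1 else 0)
    (f : Col n U) (m : ℕ) : ∃ g ∈ S, f - g ∈ colVanish m := by
  classical
  choose ε hε hε' using he
  have hpoly : ∀ p : MvPolynomial (Option (Fin n)) k, colConst (U := U) (p : Ser k n) ∈ S := by
    intro p
    induction p using MvPolynomial.induction_on with
    | C t =>
      have := hS (PowerSeries.C t)
      rw [scal_C] at this
      rwa [MvPolynomial.coe_C]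
    | add p q hp hq =>
      rw [MvPolynomial.coe_add, map_add]
      exact add_mem hp hq
    | mul_X p i hp =>
      rw [MvPolynomial.coe_mul, map_mul, MvPolynomial.coe_X]
      refine mul_mem hp ?_
      cases i with
      | none =>
        have := hS PowerSeries.X
        rwa [scal_X] at this
      | some i => exact hy i
  refine ⟨∑ u, colConst ((f u).truncTotal m : Ser k n) * ε u,
    sum_mem fun u _ => mul_mem (hpoly _) (hε u), fun v => ?_⟩
  rw [Pi.sub_apply, Finset.sum_apply, Finset.sum_eq_single v (fun u _ hu => ?_) (by simp)]
  · rw [Pi.mul_apply, hε', if_pos rfl, mul_one]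
    exact sub_truncTotal_mem_vanish m _
  · rw [Pi.mul_apply, hε', if_neg hu.symm, mul_zero]

section Chinese

variable (n U)

/-- The maximal ideal of the point `(0, u_1, …, u_n)` in `k[h, X_1, …, X_n]`. -/
def pointIdeal (u : Fin n → U) : Ideal (MvPolynomial (Option (Fin n)) k) :=
  Ideal.span (Set.range fun i : Option (Fin n) =>
    MvPolynomial.X i - MvPolynomial.C (i.elim 0 fun i => (u i : k)))

/-- The generators of the ideal `𝓘`, as polynomials in `h, X_1, …, X_n`. -/
def fibreGens : Set (MvPolynomial (Option (Fin n)) k) :=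
  {MvPolynomial.X none} ∪
    Set.range fun i : Fin n => ∏ v ∈ U, (MvPolynomial.X (some i) - MvPolynomial.C v)

variable {n U}

theorem isCoprime_pointIdeal {u v : Fin n → U} (h : u ≠ v) :
    IsCoprime (pointIdeal n U u) (pointIdeal n U v) := by
  obtain ⟨i, hi⟩ := Function.ne_iff.1 h
  have hne : (v i : k) - u i ≠ 0 := sub_ne_zero.2 fun e => hi (Subtype.coe_injective e.symm)
  have hu : MvPolynomial.X (some i) - MvPolynomial.C (u i : k) ∈ pointIdeal n U u :=
    Ideal.subset_span ⟨some i, rfl⟩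
  have hv : MvPolynomial.X (some i) - MvPolynomial.C (v i : k) ∈ pointIdeal n U v :=
    Ideal.subset_span ⟨some i, rfl⟩
  refine Ideal.isCoprime_iff_exists.2 ⟨_, Ideal.mul_mem_left _
    (MvPolynomial.C ((v i : k) - u i)⁻¹) hu, _, Ideal.mul_mem_left _
    (-MvPolynomial.C ((v i : k) - u i)⁻¹) hv, ?_⟩
  have : (MvPolynomial.C ((v i : k) - u i)⁻¹ * MvPolynomial.C ((v i : k) - u i) :
      MvPolynomial (Option (Fin n)) k) = 1 := by
    rw [← map_mul, inv_mul_cancel₀ hne, map_one]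
  rw [map_sub] at this
  linear_combination this

/-- The product of the ideals of all points is contained in the ideal `𝓘`. -/
theorem prod_pointIdeal_le : ∏ u : Fin n → U, pointIdeal n U u ≤ Ideal.span (fibreGens n U) := by
  classical
  rw [show (∏ u : Fin n → U, pointIdeal n U u) = _ from Ideal.prod_span _ _, Ideal.span_le]
  intro x hx
  rw [Set.mem_finsetProd] at hx
  obtain ⟨g, hg, rfl⟩ := hx
  choose i hi using fun u => hg (Finset.mem_univ u)
  have hdvd : ∀ p ∈ fibreGens n U, p ∣ ∏ u, g u → ∏ u, g u ∈ Ideal.span (fibreGens n U) :=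
    fun p hp hd => Ideal.mem_of_dvd _ hd (Ideal.subset_span hp)
  by_cases hnone : ∃ u, i u = none
  · obtain ⟨u, hu⟩ := hnone
    refine hdvd _ (Or.inl rfl) (Dvd.dvd.trans ?_ (Finset.dvd_prod_of_mem g (Finset.mem_univ u)))
    rw [← hi, hu]
    simp
  · push Not at hnone
    choose j hj using fun u => Option.ne_none_iff_exists'.1 (hnone u)
    -- otherwise a point would avoid the coordinate that is selected at it
    have key : ∃ l : Fin n, ∀ v : U, ∃ u, j u = l ∧ u l = v := by
      by_contra! h
      choose w hw using h
      exact hw _ w rfl rfl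
    obtain ⟨l, hl⟩ := key
    choose t ht ht' using hl
    have hinj : Function.Injective t := fun v v' e => by rw [← ht' v, e, ht']
    refine hdvd _ (Or.inr ⟨l, rfl⟩) ?_
    have e : ∏ v ∈ U, (MvPolynomial.X (some l) - MvPolynomial.C v) = ∏ v : U, g (t v) := by
      rw [← Finset.prod_coe_sort]
      refine Finset.prod_congr rfl fun v _ => ?_
      rw [← hi, hj, ht]
      simp [ht']
    change (∏ v ∈ U, (MvPolynomial.X (some l) - MvPolynomial.C v)) ∣ _
    rw [e, ← Finset.prod_image (s := Finset.univ) (g := t) (f := g) hinj.injOn]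
    exact Finset.prod_dvd_prod_of_subset _ _ _ (Finset.subset_univ _)

theorem mem_span_pow_of_forall {p : MvPolynomial (Option (Fin n)) k} {m : ℕ}
    (hp : ∀ u : Fin n → U, p ∈ pointIdeal n U u ^ m) : p ∈ Ideal.span (fibreGens n U ^ m) := by
  rw [Ideal.span, ← Submodule.span_pow]
  refine Ideal.pow_right_mono (prod_pointIdeal_le (n := n) (U := U)) m ?_
  rw [← Finset.prod_pow, Ideal.prod_eq_iInf_of_pairwise_isCoprime]
  · simpa using hp
  · intro u _ v _ h
    exact (isCoprime_pointIdeal h).pow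

end Chinese

section expansion

theorem vanish_one_pow_le {ν R : Type*} [CommRing R] (m : ℕ) :
    (vanish 1 : Ideal (MvPowerSeries ν R)) ^ m ≤ vanish m := by
  induction m with
  | zero => intro f _; simp [mem_vanish]
  | succ m ih =>
    rw [pow_succ]
    exact Ideal.mul_le.2 fun f hf g hg => mul_mem_vanish (ih hf) hg

variable (n U)

/-- The expansions of a polynomial in `h, X_1, …, X_n` at the weights. -/
def colPoly (b : PowerSeries k) : MvPolynomial (Option (Fin n)) k →+* Col n U :=
  MvPolynomial.eval₂Hom (scal.comp PowerSeries.C) fun i => i.elim (scal PowerSeries.X) (colX b)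

variable {n U}

theorem colPoly_mem_colVanish {b c d : PowerSeries k} (h : IsAdmissible n b c d) {m : ℕ}
    {p : MvPolynomial (Option (Fin n)) k} {u : Fin n → U} (hp : p ∈ pointIdeal n U u ^ m) :
    colPoly n U b p u ∈ vanish m := by
  set φ := (Pi.evalRingHom (fun _ : Fin n → U => Ser k n) u).comp (colPoly n U b)
  have h1 : pointIdeal n U u ≤ (vanish 1).comap φ := by
    refine Ideal.span_le.2 ?_
    rintro _ ⟨i, rfl⟩
    refine mem_vanish_one.2 ?_
    cases i with
    | none => simp [φ, colPoly, scal_X]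
    | some i => simp [φ, colPoly, constantCoeff_colX h, scal_C]
  exact vanish_one_pow_le m (Ideal.le_comap_pow _ _ (Ideal.pow_right_mono h1 m hp))

variable (u : Fin n → U)

/-- The change of variables `X_i = u_i (1 + z_i)`, which expresses polynomials in the `z_i` by the
`X_i`. -/
def shiftPoly : MvPolynomial (Option (Fin n)) k →ₐ[k] MvPolynomial (Option (Fin n)) k :=
  MvPolynomial.aeval fun i => i.elim (MvPolynomial.X none) fun i =>
    MvPolynomial.C (u i : k)⁻¹ * MvPolynomial.X (some i) - 1

variable {u}

theorem coe_ne_zero (hU : (0 : k) ∉ U) (x : U) : (x : k) ≠ 0 := fun h0 => hU (h0 ▸ x.2)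

theorem shiftPoly_surjective (hU : (0 : k) ∉ U) : Function.Surjective (shiftPoly u) := by
  set ψ : MvPolynomial (Option (Fin n)) k →ₐ[k] MvPolynomial (Option (Fin n)) k :=
    MvPolynomial.aeval fun i => i.elim (MvPolynomial.X none) fun i =>
      MvPolynomial.C (u i : k) * (MvPolynomial.X (some i) + 1)
  have : (shiftPoly u).comp ψ = AlgHom.id k _ := by
    refine MvPolynomial.algHom_ext fun i => ?_
    cases i with
    | none => simp [shiftPoly, ψ]
    | some i =>
      have : (MvPolynomial.C (u i : k) * MvPolynomial.C (u i : k)⁻¹ :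
          MvPolynomial (Option (Fin n)) k) = 1 := by
        rw [← map_mul, mul_inv_cancel₀ (coe_ne_zero hU _), map_one]
      simp only [shiftPoly, ψ, AlgHom.comp_apply, MvPolynomial.aeval_X, Option.elim_some, map_mul,
        map_add, map_one, MvPolynomial.algHom_C, MvPolynomial.algebraMap_eq, AlgHom.id_apply]
      linear_combination MvPolynomial.X (some i) * this
  exact fun p => ⟨ψ p, DFunLike.congr_fun this p⟩

theorem shiftPoly_mem_pointIdeal (hU : (0 : k) ∉ U) {p : MvPolynomial (Option (Fin n)) k} {m : ℕ}
    (hp : (p : Ser k n) ∈ vanish m) : shiftPoly u p ∈ pointIdeal n U u ^ m := by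
  have h0 : p ∈ MvPolynomial.idealOfVars (Option (Fin n)) k ^ m := by
    rw [MvPolynomial.mem_pow_idealOfVars_iff']
    intro x hx
    rw [← MvPolynomial.coeff_coe]
    exact mem_vanish_iff.1 hp x hx
  have h1 : MvPolynomial.idealOfVars (Option (Fin n)) k ≤ (pointIdeal n U u).comap
      (shiftPoly u) := by
    refine Ideal.span_le.2 ?_
    rintro _ ⟨i, rfl⟩
    have hi : MvPolynomial.X i - MvPolynomial.C (i.elim 0 fun i => (u i : k)) ∈
      pointIdeal n U u := Ideal.subset_span ⟨i, rfl⟩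
    cases i with
    | none => simpa [shiftPoly] using hi
    | some i =>
      have := Ideal.mul_mem_left _ (MvPolynomial.C (u i : k)⁻¹) hi
      rw [Option.elim_some, mul_sub, ← map_mul, inv_mul_cancel₀ (coe_ne_zero hU _), map_one] at this
      simpa [shiftPoly] using this
  exact Ideal.le_comap_pow _ _ (Ideal.pow_right_mono h1 m h0)

theorem colPoly_shiftPoly (b : PowerSeries k) (hU : (0 : k) ∉ U)
    (p : MvPolynomial (Option (Fin n)) k) :
    colPoly n U b (shiftPoly u p) u = (p : Ser k n).subst (subsY (b - 1)) := by
  rw [MvPowerSeries.subst_coe]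
  have : ((Pi.evalRingHom (fun _ : Fin n → U => Ser k n) u).comp (colPoly n U b)).comp
      (shiftPoly u : MvPolynomial (Option (Fin n)) k →+* _) =
      (MvPolynomial.aeval (subsY (b - 1)) : _ →ₐ[k] Ser k n) := by
    refine MvPolynomial.ringHom_ext (fun t => ?_) fun i => ?_
    · simp [colPoly, scal_C, MvPowerSeries.algebraMap_apply]
    · cases i with
      | none => simp [shiftPoly, colPoly, scal_X, subsY]
      | some i =>
        have e : (MvPowerSeries.C (u i : k)⁻¹ * MvPowerSeries.C (u i : k) : Ser k n) = 1 := by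
          rw [← map_mul, inv_mul_cancel₀ (coe_ne_zero hU _), map_one]
        simp [shiftPoly, colPoly, scal_C, subsY, colX, eigen, ← mul_assoc, e, atY_eq]
  exact RingHom.congr_fun this p

variable {b c d : PowerSeries k}

theorem IsAdmissible.constantCoeff_sub (h : IsAdmissible n b c d) :
    PowerSeries.constantCoeff (b - 1) = 0 := by
  have := h.b0
  rw [PowerSeries.coeff_zero_eq_constantCoeff_apply] at this
  rw [map_sub, this, map_one, sub_self]

theorem IsAdmissible.exists_inverse (h : IsAdmissible n b c d) :
    ∃ g : PowerSeries k, PowerSeries.constantCoeff g = 0 ∧ g.subst (b - 1) = PowerSeries.X ∧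
      (b - 1).subst g = PowerSeries.X := by
  have h0 := h.constantCoeff_sub
  have h1 : IsUnit (PowerSeries.coeff 1 (b - 1)) := by
    rw [map_sub, h.b1, PowerSeries.coeff_one, if_neg one_ne_zero, sub_zero]
    exact isUnit_one
  exact ⟨(b - 1).substInvOfIsUnit h1, PowerSeries.constantCoeff_substInvOfIsUnit _ _,
    PowerSeries.subst_substInvOfIsUnit_left _ h0 h1,
    PowerSeries.subst_substInvOfIsUnit_right _ h0 h1⟩

/-- Polynomials in `h` and the `X_i` are dense in the coloured power series. -/
theorem exists_sub_colPoly_mem (h : IsAdmissible n b c d) (hU : (0 : k) ∉ U) (f : Col n U) (m : ℕ) :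
    ∃ p, f - colPoly n U b p ∈ colVanish m := by
  obtain ⟨g, hg0, hg, hg'⟩ := h.exists_inverse
  have hb := h.constantCoeff_sub
  set F : (Fin n → U) → MvPolynomial (Option (Fin n)) k := fun u =>
    ((f u).subst (subsY g) : Ser k n).truncTotal m
  have hco : Pairwise (Function.onFun IsCoprime fun u : Fin n → U => pointIdeal n U u ^ m) :=
    fun u v huv => (isCoprime_pointIdeal huv).pow
  obtain ⟨p, hp⟩ := Ideal.exists_forall_sub_mem_ideal hco fun u => shiftPoly u (F u)
  refine ⟨p, fun u => ?_⟩
  have h1 := colPoly_mem_colVanish h (hp u)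
  have h2 := subst_mem_vanish (constantCoeff_subsY (n := n) hb)
    (sub_truncTotal_mem_vanish m ((f u).subst (subsY g) : Ser k n))
  rw [MvPowerSeries.subst_sub (hasSubst_subsY hb), subst_subsY_subst_subsY hg0 hb hg,
    ← colPoly_shiftPoly b hU] at h2
  have := sub_mem h2 h1
  rw [map_sub, Pi.sub_apply] at this
  rw [Pi.sub_apply]
  convert this using 1
  ring

/-- Polynomials in `h` and the `X_i` whose expansions at all weights vanish to order `m` lie in the
`m`-th power of the ideal `𝓘`. -/
theorem mem_span_pow_of_colPoly (h : IsAdmissible n b c d) (hU : (0 : k) ∉ U)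
    {p : MvPolynomial (Option (Fin n)) k} {m : ℕ} (hp : colPoly n U b p ∈ colVanish m) :
    p ∈ Ideal.span (fibreGens n U ^ m) := by
  obtain ⟨g, hg0, hg, hg'⟩ := h.exists_inverse
  have hb := h.constantCoeff_sub
  refine mem_span_pow_of_forall fun u => ?_
  obtain ⟨p, rfl⟩ := shiftPoly_surjective (u := u) hU p
  refine shiftPoly_mem_pointIdeal hU ?_
  have h1 := hp u
  rw [colPoly_shiftPoly b hU] at h1
  have h2 := subst_mem_vanish (constantCoeff_subsY (n := n) hg0) h1
  rwa [subst_subsY_subst_subsY hb hg0 hg'] at h2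

end expansion

end Approximation

/-! ### Filtered homomorphisms from coloured power series to completions -/

section Filtered

variable {k : Type*} [Field k] {n : ℕ} {U : Finset k}

open KLR

/-- Additive maps `D` with `D (f g) = s f * D g + D f * g`. -/
structure IsTwistedDerivation {S : Type*} [CommRing S] (s : S →+* S) (D : S → S) : Prop where
  add : ∀ f g, D (f + g) = D f + D g
  mul : ∀ f g, D (f * g) = s f * D g + D f * g

namespace IsTwistedDerivation

variable {S : Type*} [CommRing S] {s : S →+* S} {D : S → S}

theorem one (h : IsTwistedDerivation s D) : D 1 = 0 := by
  simpa using h.mul 1 1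

theorem zero (h : IsTwistedDerivation s D) : D 0 = 0 := by
  simpa using h.add 0 0

theorem neg (h : IsTwistedDerivation s D) (f : S) : D (-f) = -D f := by
  have := h.add f (-f)
  rw [add_neg_cancel, h.zero] at this
  linear_combination -this

theorem sub (h : IsTwistedDerivation s D) (f g : S) : D (f - g) = D f - D g := by
  rw [sub_eq_add_neg, h.add, h.neg, sub_eq_add_neg]

/-- The subring of the elements for which the twisted commutation relation with `t` holds. -/
def commSubring {B : Type*} [Ring B] (h : IsTwistedDerivation s D) (ι : S →+* B) (t : B) :
    Subring S where
  carrier := {f | t * ι f = ι (s f) * t + ι (D f)}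
  mul_mem' {f g} hf hg := by
    rw [Set.mem_ofPred_eq] at hf hg ⊢
    rw [map_mul, ← mul_assoc, hf, add_mul, mul_assoc, hg, h.mul]
    simp only [map_mul, map_add, mul_add, mul_assoc, add_assoc]
  one_mem' := by simp [h.one]
  add_mem' {f g} hf hg := by
    rw [Set.mem_ofPred_eq] at hf hg ⊢
    rw [map_add, mul_add, hf, hg, h.add, map_add, map_add, map_add]
    noncomm_ring
  zero_mem' := by simp [h.zero]
  neg_mem' {f} hf := by
    rw [Set.mem_ofPred_eq] at hf ⊢
    rw [map_neg, mul_neg, hf, h.neg, map_neg, map_neg, map_neg]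
    noncomm_ring

theorem mem_commSubring {B : Type*} [Ring B] (h : IsTwistedDerivation s D) {ι : S →+* B} {t : B}
    {f : S} : f ∈ h.commSubring ι t ↔ t * ι f = ι (s f) * t + ι (D f) := Iff.rfl

end IsTwistedDerivation

theorem isTwistedDerivation_klrD (r : Fin (n - 1)) :
    IsTwistedDerivation (act sig (adj r)) (klrD (U := U) r) where
  add f g := by
    apply toFrac_injective
    simp only [toFrac_klrD, map_add]
    ring
  mul f g := by
    apply toFrac_injective
    simp only [toFrac_klrD, map_add, map_mul, toFrac_act]
    ring

theorem isTwistedDerivation_heckeD (A B : Fin (n - 1) → Col n U) (r : Fin (n - 1)) :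
    IsTwistedDerivation (act sig (adj r)) (heckeD A B r) where
  add f g := by
    rw [heckeD, heckeD, heckeD, (isTwistedDerivation_klrD r).add, map_add]
    ring
  mul f g := by
    rw [heckeD, heckeD, heckeD, (isTwistedDerivation_klrD r).mul, map_mul]
    ring

variable {A : Type*} [Ring A] [Algebra (PowerSeries k) A] {G : Set A}

/-- Homomorphisms to a completion which are compatible with the filtrations. -/
def IsFiltered (ι : Col n U →+* Compl (PowerSeries k) G) : Prop :=
  ∀ m, ∀ f ∈ colVanish m, ι f ∈ Compl.lev (PowerSeries k) G m

theorem scal_X_mem : (scal PowerSeries.X : Col n U) ∈ colVanish 1 := fun u => by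
  rw [scal_X, mem_vanish_one, MvPowerSeries.constantCoeff_X]

namespace IsFiltered

variable {ι ι' : Col n U →+* Compl (PowerSeries k) G}

theorem ext (h : IsFiltered ι) (h' : IsFiltered ι')
    (hd : ∀ f m, ∃ g ∈ RingHom.eqLocus ι ι', f - g ∈ colVanish m) : ι = ι' := by
  refine RingHom.ext fun f => Compl.eq_of_sub_mem_lev fun m => ?_
  obtain ⟨g, hg, hfg⟩ := hd f m
  have := sub_mem (h m _ hfg) (h' m _ hfg)
  rwa [map_sub, map_sub, show ι g = ι' g from hg, sub_sub_sub_cancel_right] at this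

theorem map_scal (h : IsFiltered ι)
    (hC : ∀ t, ι (scal (PowerSeries.C t)) = algebraMap (PowerSeries k) _ (PowerSeries.C t))
    (hX : ι (scal PowerSeries.X) = algebraMap (PowerSeries k) _ PowerSeries.X) (Q : PowerSeries k) :
    ι (scal Q) = algebraMap (PowerSeries k) _ Q := by
  refine Compl.eq_of_sub_mem_lev fun m => ?_
  have hpow : algebraMap (PowerSeries k) (Compl (PowerSeries k) G) PowerSeries.X ^ m ∈
      Compl.lev (PowerSeries k) G m := by
    rw [← hX, ← map_pow]
    exact h m _ fun u => vanish_one_pow_le m (Ideal.pow_mem_pow (scal_X_mem u) m)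
  have hpoly : ((ι.comp scal).comp (Polynomial.coeToPowerSeries.ringHom (R := k))) =
      (algebraMap (PowerSeries k) (Compl (PowerSeries k) G)).comp
        (Polynomial.coeToPowerSeries.ringHom (R := k)) := by
    refine Polynomial.ringHom_ext (fun t => ?_) ?_
    · simpa using hC t
    · simpa using hX
  have htr := RingHom.congr_fun hpoly (PowerSeries.trunc m Q)
  simp only [RingHom.comp_apply, Polynomial.coeToPowerSeries.ringHom_apply] at htr
  obtain ⟨R, hR⟩ : PowerSeries.X ^ m ∣ Q - (PowerSeries.trunc m Q : PowerSeries k) := by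
    rw [PowerSeries.X_pow_dvd_iff]
    intro j hj
    rw [map_sub, Polynomial.coeff_coe, PowerSeries.coeff_trunc, if_pos hj, sub_self]
  have e : ι (scal Q) - algebraMap (PowerSeries k) _ Q =
      ι (scal (PowerSeries.X ^ m * R)) - algebraMap (PowerSeries k) _ (PowerSeries.X ^ m * R) := by
    rw [← hR]
    simp only [map_sub]
    rw [htr, sub_sub_sub_cancel_right]
  rw [e]
  simp only [map_mul, map_pow, hX]
  exact sub_mem (Compl.mul_mem_lev hpow _) (Compl.mul_mem_lev hpow _)

/-- A twisted commutation relation holds as soon as it does so on a dense subring. -/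
theorem comm (h : IsFiltered ι) {r : Fin (n - 1)} {D : Col n U → Col n U}
    (hD : IsTwistedDerivation (act sig (adj r)) D)
    (hDm : ∀ m, ∀ f ∈ colVanish (m + 1), D f ∈ colVanish m) (t : Compl (PowerSeries k) G)
    (hd : ∀ f m, ∃ g ∈ hD.commSubring ι t, f - g ∈ colVanish m) (f : Col n U) :
    t * ι f = ι (act sig (adj r) f) * t + ι (D f) := by
  refine Compl.eq_of_sub_mem_lev fun m => ?_
  obtain ⟨g, hg, hfg⟩ := hd f (m + 1)
  have h1 := Ideal.mul_mem_left _ t (h m _ (colVanish_mono m.le_succ hfg))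
  have h2 := Compl.mul_mem_lev
    (h m _ (act_mem_colVanish (adj r) (colVanish_mono m.le_succ hfg))) t
  have h3 := h m _ (hDm m _ hfg)
  have := sub_mem h1 (add_mem h2 h3)
  rw [hD.mem_commSubring] at hg
  rw [map_sub, mul_sub, map_sub, map_sub, sub_mul, hD.sub, map_sub] at this
  convert this using 1
  rw [hg]
  abel

end IsFiltered

end Filtered

/-! ### The relations of the completed KLR algebra -/

section KRelations

variable {k : Type*} [Field k] (q : k) (c : PowerSeries k) (U : Finset k) {n : ℕ}

namespace KLR

theorem isFiltered_colEv : IsFiltered (colEv (n := n) q c U) :=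
  fun _ _ hf => colEv_mem_lev q c U hf

theorem colEv_scal (Q : PowerSeries k) :
    colEv (n := n) q c U (scal Q) = algebraMap (PowerSeries k) _ Q := by
  refine (isFiltered_colEv q c U).map_scal (fun t => eq_of_mul_e q c U fun u => ?_)
    (eq_of_mul_e q c U fun u => ?_) Q
  · rw [colEv_mul_e, scal_C, ← evHom_apply, evHom_C]
  · rw [colEv_mul_e, scal_X, ← evHom_apply, evHom_X_none]

theorem evHom_scal (Q : PowerSeries k) (u : Fin n → U) :
    evHom q c U (scal Q u) = algebraMap (PowerSeries k) _ Q := by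
  have := colEv_scal (n := n) q c U Q
  simp only [colEv_apply, scal_apply, ← Finset.mul_sum] at this
  rwa [(kgen_complete_orthogonal q c U n).complete, mul_one, ← scal_apply Q u] at this

theorem evHom_colY (i : Fin n) (u : Fin n → U) :
    evHom q c U (colY (U := U) i u) = kgen q c U n (.y i) := evHom_X_some q c U i

section Maps

variable {A B : Type*} [Ring A] [Algebra (PowerSeries k) A] [Ring B] [Algebra (PowerSeries k) B]

theorem map_Qpol (f : A →ₐ[PowerSeries k] B) (u v : k) (a b : A) :
    f (Qpol q c u v a b) = Qpol q c u v (f a) (f b) := by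
  rw [Qpol, Qpol]
  split_ifs <;> simp

theorem map_Bpol {A B : Type*} [Ring A] [Ring B] (f : A →+* B) (u v w : k) (x y z : A) :
    f (Bpol q u v w x y z) = Bpol q u v w (f x) (f y) (f z) := by
  rw [Bpol, Bpol]
  split_ifs <;> simp [map_ofNat f 2]

end Maps

variable {U}

theorem toCompl_quot_kg (g : KGen U n) :
    toCompl (PowerSeries k) (idealGens q c U n) (quot q c U n (kg U n g)) = kgen q c U n g := rfl

theorem kgen_psi_e (r : Fin (n - 1)) (u : Fin n → U) :
    kgen q c U n (.psi r) * kgen q c U n (.e u) =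
      kgen q c U n (.e (swp r u)) * kgen q c U n (.psi r) := by
  have := rel q c U (.psi_e r u)
  rw [map_mul, map_mul] at this
  rw [← map_mul, ← map_mul]
  exact congrArg _ this

theorem kgen_psi_y_of_ne (r : Fin (n - 1)) (i : Fin n) (h₁ : i ≠ lo r) (h₂ : i ≠ hi r) :
    kgen q c U n (.psi r) * kgen q c U n (.y i) =
      kgen q c U n (.y i) * kgen q c U n (.psi r) := by
  have := rel q c U (.psi_y_comm r i h₁ h₂)
  rw [map_mul, map_mul] at this
  rw [← map_mul, ← map_mul]
  exact congrArg _ this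

theorem kgen_psi_far (r s : Fin (n - 1)) (h₁ : (r : ℕ) + 1 ≠ s) (h₂ : (s : ℕ) + 1 ≠ r) :
    kgen q c U n (.psi r) * kgen q c U n (.psi s) =
      kgen q c U n (.psi s) * kgen q c U n (.psi r) := by
  have := rel q c U (.psi_comm r s h₁ h₂)
  rw [map_mul, map_mul] at this
  rw [← map_mul, ← map_mul]
  exact congrArg _ this

open Classical in
theorem kgen_psi_y_hi (r : Fin (n - 1)) (u : Fin n → U) :
    kgen q c U n (.psi r) * kgen q c U n (.y (hi r)) * kgen q c U n (.e u) =
      (kgen q c U n (.y (lo r)) * kgen q c U n (.psi r) - if u (lo r) = u (hi r) then 1 else 0) *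
        kgen q c U n (.e u) := by
  have := congrArg (toCompl (PowerSeries k) (idealGens q c U n)) (rel q c U (.psi_y_hi r u))
  simp only [map_mul, map_sub, apply_ite (quot q c U n),
    apply_ite (toCompl (PowerSeries k) (idealGens q c U n)), map_one, map_zero,
    toCompl_quot_kg] at this
  exact this

open Classical in
theorem kgen_y_hi_psi (r : Fin (n - 1)) (u : Fin n → U) :
    kgen q c U n (.y (hi r)) * kgen q c U n (.psi r) * kgen q c U n (.e u) =
      (kgen q c U n (.psi r) * kgen q c U n (.y (lo r)) - if u (lo r) = u (hi r) then 1 else 0) *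
        kgen q c U n (.e u) := by
  have := congrArg (toCompl (PowerSeries k) (idealGens q c U n)) (rel q c U (.y_hi_psi r u))
  simp only [map_mul, map_sub, apply_ite (quot q c U n),
    apply_ite (toCompl (PowerSeries k) (idealGens q c U n)), map_one, map_zero,
    toCompl_quot_kg] at this
  exact this

theorem kgen_psi_sq (r : Fin (n - 1)) (u : Fin n → U) :
    kgen q c U n (.psi r) * kgen q c U n (.psi r) * kgen q c U n (.e u) =
      Qpol q c (u (lo r) : k) (u (hi r)) (kgen q c U n (.y (lo r))) (kgen q c U n (.y (hi r))) *
        kgen q c U n (.e u) := by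
  have := congrArg (toCompl (PowerSeries k) (idealGens q c U n)) (rel q c U (.psi_sq r u))
  simp only [map_mul, map_Qpol, toCompl_quot_kg] at this
  exact this

theorem kgen_braid (r s : Fin (n - 1)) (h : (r : ℕ) + 1 = s) (u : Fin n → U) :
    kgen q c U n (.psi r) * kgen q c U n (.psi s) * kgen q c U n (.psi r) * kgen q c U n (.e u) =
      (kgen q c U n (.psi s) * kgen q c U n (.psi r) * kgen q c U n (.psi s) +
        Bpol q (u (lo r) : k) (u (hi r)) (u (hi s)) (kgen q c U n (.y (lo r)))
          (kgen q c U n (.y (hi r))) (kgen q c U n (.y (hi s)))) * kgen q c U n (.e u) := by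
  have := congrArg (toCompl (PowerSeries k) (idealGens q c U n)) (rel q c U (.braid r s h u))
  have e := fun (v w z : k) (a b d : FreeAlgebra (PowerSeries k) (KGen U n)) => map_Bpol q
    (((toCompl (PowerSeries k) (idealGens q c U n)).comp (quot q c U n)).toRingHom) v w z a b d
  simp only [AlgHom.toRingHom_eq_coe, RingHom.coe_coe, AlgHom.comp_apply] at e
  simp only [map_mul, map_add, e, toCompl_quot_kg] at this
  exact this

/-- The divided difference of a symmetric power series vanishes. -/
theorem klrD_eq_zero {r : Fin (n - 1)} {f : Col n U} (h : act sig (adj r) f = f) :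
    klrD r f = 0 := by
  apply toFrac_injective
  rw [toFrac_klrD, ← toFrac_act, h, sub_self, mul_zero, map_zero]

open Classical in
theorem klrD_colY_hi (r : Fin (n - 1)) :
    klrD r (colY (U := U) (hi r)) = fun u => if u (lo r) = u (hi r) then -1 else 0 := by
  ext1 u
  rw [klrD]
  split_ifs with h
  · have e := mul_ddiff (r := r) (colY (U := U) (hi r) u)
    have hne : (MvPowerSeries.X (some (hi r)) - MvPowerSeries.X (some (lo r)) : Ser k n) ≠ 0 :=
      sub_ne_zero.2 fun h => lo_ne_hi r (X_injective (k := k) h.symm)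
    refine mul_left_cancel₀ hne (e.trans ?_)
    simp [colY]
  · rfl

open Classical in
theorem klrD_colY_lo (r : Fin (n - 1)) :
    klrD r (colY (U := U) (lo r)) = fun u => if u (lo r) = u (hi r) then 1 else 0 := by
  have h : act sig (adj r) (colY (U := U) (lo r) + colY (hi r)) = colY (lo r) + colY (hi r) := by
    rw [map_add, act_colY, act_colY, adj_lo, adj_hi, add_comm]
  have := klrD_eq_zero h
  rw [(isTwistedDerivation_klrD r).add, klrD_colY_hi] at this
  ext1 u
  have := congrFun this u
  rw [Pi.add_apply, Pi.zero_apply] at this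
  split_ifs at this ⊢ with hu
  · linear_combination this
  · linear_combination this

theorem klrD_single (r : Fin (n - 1)) {f : Col n U} (hf : ∀ u, f u = 0 ∨ f u = 1) :
    klrD r f = 0 := by
  ext1 u
  rw [klrD, Pi.zero_apply]
  split_ifs
  · have e := mul_ddiff (r := r) (f u)
    have hne : (MvPowerSeries.X (some (hi r)) - MvPowerSeries.X (some (lo r)) : Ser k n) ≠ 0 :=
      sub_ne_zero.2 fun h => lo_ne_hi r (X_injective (k := k) h.symm)
    refine mul_left_cancel₀ hne (e.trans ?_)
    rcases hf u with h | h <;> simp [h]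
  · rfl

open Classical in
theorem act_single (w : Equiv.Perm (Fin n)) (u : Fin n → U) :
    act sig w (Pi.single u 1 : Col n U) = Pi.single (u ∘ w.symm) 1 := by
  ext1 v
  rw [act_apply, Pi.single_apply, Pi.single_apply]
  simp only [Equiv.eq_comp_symm]
  split_ifs <;> simp

variable (U)

theorem psi_mul_colEv (r : Fin (n - 1)) (f : Col n U) :
    kgen q c U n (.psi r) * colEv q c U f =
      colEv q c U (act sig (adj r) f) * kgen q c U n (.psi r) + colEv q c U (klrD r f) := by
  classical
  refine (isFiltered_colEv q c U).comm (isTwistedDerivation_klrD r)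
    (fun m f hf => klrD_mem_colVanish r hf) _ (exists_sub_mem_of_colY _ (fun Q => ?_)
      (fun i => ?_) fun u => ⟨Pi.single u 1, ?_, fun v => ?_⟩) f
  · rw [IsTwistedDerivation.mem_commSubring, act_scal, klrD_eq_zero (act_scal _ _), colEv_scal,
      map_zero, add_zero]
    exact (Algebra.commutes _ _).symm
  · rw [IsTwistedDerivation.mem_commSubring, act_colY]
    by_cases h₁ : i = lo r
    · subst h₁
      rw [adj_lo, klrD_colY_lo, colEv_colY, colEv_colY]
      refine eq_of_mul_e q c U fun u => ?_
      rw [add_mul, kgen_y_hi_psi, sub_mul, colEv_mul_e, ← evHom_apply,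
        apply_ite (evHom (n := n) q c U), map_one, map_zero, sub_add_cancel]
    by_cases h₂ : i = hi r
    · subst h₂
      rw [adj_hi, klrD_colY_hi, colEv_colY, colEv_colY]
      refine eq_of_mul_e q c U fun u => ?_
      rw [add_mul, kgen_psi_y_hi, sub_mul, colEv_mul_e, ← evHom_apply,
        apply_ite (evHom (n := n) q c U), map_neg, map_one, map_zero, sub_eq_add_neg]
      split_ifs <;> simp
    · rw [adj_of_ne h₁ h₂, klrD_eq_zero (by rw [act_colY, adj_of_ne h₁ h₂]), map_zero, add_zero,
        colEv_colY, kgen_psi_y_of_ne q c r i h₁ h₂]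
  · rw [IsTwistedDerivation.mem_commSubring, act_single, colEv_single, colEv_single, klrD_single,
      map_zero, add_zero, kgen_psi_e]
    · rfl
    · intro v
      rw [Pi.single_apply]
      split_ifs <;> simp
  · rw [Pi.single_apply]

/-- The completed KLR algebra satisfies the relations of the KLR algebra over coloured power
series. -/
theorem isKLR_colEv :
    IsKLR q c (colEv (n := n) q c U) fun r => kgen q c U n (.psi r) where
  comm := psi_mul_colEv q c U
  sq r := by
    rw [map_zero, zero_mul, zero_add]
    refine eq_of_mul_e q c U fun u => ?_
    rw [kgen_psi_sq, colEv_mul_e, klrQ, Qpol, ← evHom_apply]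
    by_cases h : u (lo r) = u (hi r)
    · rw [if_pos h, if_pos (congrArg _ h), map_zero]
    · rw [if_neg h, if_neg fun h' => h (Subtype.coe_injective h')]
      split_ifs <;>
        simp only [map_mul, map_add, map_sub, map_one, evHom_scal, evHom_colY]
  braid r s h := by
    refine eq_of_mul_e q c U fun u => ?_
    rw [kgen_braid q c r s h, add_mul, add_mul, colEv_mul_e, klrB, ← evHom_apply, map_Bpol]
    simp only [evHom_colY]
  far r s h₁ h₂ := kgen_psi_far q c r s h₁ h₂

end KLR

end KRelations

/-! ### Coloured power series in the completed affine Hecke algebra -/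

section HSide

variable {k : Type*} [Field k] (Q : PowerSeries k) {U : Finset k} {n : ℕ}

open KLR

namespace Hecke

/-- The projection from the free algebra. -/
def quot (n : ℕ) : FreeAlgebra (PowerSeries k) (HGen n) →ₐ[PowerSeries k] Hecke Q n :=
  RingQuot.mkAlgHom (PowerSeries k) (HRel Q n)

theorem rel {x y : FreeAlgebra (PowerSeries k) (HGen n)} (h : HRel Q n x y) :
    quot Q n x = quot Q n y := RingQuot.mkAlgHom_rel _ h

theorem gen_X_comm (i j : Fin n) : gen Q n (.X i) * gen Q n (.X j) =
    gen Q n (.X j) * gen Q n (.X i) := by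
  have := rel Q (.X_comm i j)
  rwa [map_mul, map_mul] at this

/-- The value of a polynomial in `h, X_1, …, X_n`. -/
abbrev polyX : MvPolynomial (Option (Fin n)) k →+* Hecke Q n :=
  polyHom (fun i => gen Q n (.X i)) (gen_X_comm Q)

theorem polyX_mem_idealGens {p : MvPolynomial (Option (Fin n)) k} (hp : p ∈ fibreGens n U) :
    polyX Q p ∈ idealGens Q n U := by
  rcases hp with rfl | ⟨i, rfl⟩
  · left
    rw [polyX, polyHom_X_none]
    rfl
  · right
    refine ⟨i, ?_⟩
    have : ((Polynomial.aeval (R := PowerSeries k) (gen Q n (.X i)) : _ →+* Hecke Q n).comp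
        (Polynomial.mapRingHom (PowerSeries.C (R := k)))) =
        (polyX Q).comp (Polynomial.eval₂RingHom MvPolynomial.C (MvPolynomial.X (some i))) := by
      refine Polynomial.ringHom_ext (fun t => ?_) ?_
      · simp [polyX, polyHom_C]
      · simp [polyX, polyHom_X_some]
    have := RingHom.congr_fun this (∏ u ∈ U, (Polynomial.X - Polynomial.C u))
    simp only [RingHom.comp_apply, map_prod, map_sub, Polynomial.coe_eval₂RingHom,
      Polynomial.eval₂_X, Polynomial.eval₂_C] at this
    simpa [Polynomial.map_prod] using this

theorem polyX_mem_powIdeal {p : MvPolynomial (Option (Fin n)) k} {m : ℕ}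
    (hp : p ∈ Ideal.span (fibreGens n U ^ m)) : polyX Q p ∈ powIdeal (idealGens Q n U) m := by
  have : Ideal.span (fibreGens n U ^ m) ≤ (powIdeal (idealGens Q n U) m).comap (polyX Q) := by
    refine Ideal.span_le.2 fun x hx => mem_powIdeal_of_mem_pow le_rfl ?_
    have h1 := Set.mem_image_of_mem (polyX Q) hx
    rw [Set.image_pow] at h1
    refine Set.pow_subset_pow_left ?_ h1
    rintro _ ⟨y, hy, rfl⟩
    exact polyX_mem_idealGens Q hy
  exact this hp

variable {b c d : PowerSeries k} (h : IsAdmissible n b c d) (hU : (0 : k) ∉ U)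

include h hU in
theorem mk_polyX_eq {f : Col n U} {m : ℕ} {p p' : MvPolynomial (Option (Fin n)) k}
    (hp : f - colPoly n U b p ∈ colVanish m) (hp' : f - colPoly n U b p' ∈ colVanish m) :
    Ideal.Quotient.mk (powIdeal (idealGens Q n U) m) (polyX Q p) =
      Ideal.Quotient.mk (powIdeal (idealGens Q n U) m) (polyX Q p') := by
  rw [Ideal.Quotient.eq, ← map_sub]
  refine polyX_mem_powIdeal Q (mem_span_pow_of_colPoly h hU ?_)
  have := sub_mem hp' hp
  rwa [sub_sub_sub_cancel_left, ← map_sub] at this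

/-- A polynomial in `h` and the `X_i` which approximates a coloured power series to order `m`. -/
def approx (f : Col n U) (m : ℕ) : MvPolynomial (Option (Fin n)) k :=
  (exists_sub_colPoly_mem h hU f m).choose

theorem sub_approx_mem (f : Col n U) (m : ℕ) : f - colPoly n U b (approx h hU f m) ∈ colVanish m :=
  (exists_sub_colPoly_mem h hU f m).choose_spec

/-- The value of a coloured power series: modulo the `m`-th power of the ideal, it is the value of a
polynomial in `h` and the `X_i` with the same expansions to order `m`. -/
def colVal₀ (f : Col n U) : Hat Q n U :=
  ⟨fun m => Ideal.Quotient.mk _ (polyX Q (approx h hU f m)), fun m =>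
    ⟨polyX Q (approx h hU f m), fun _ hl => mk_polyX_eq Q h hU
      (colVanish_mono hl (sub_approx_mem h hU f m)) (sub_approx_mem h hU f _)⟩⟩

theorem projHom_colVal₀ {f : Col n U} {m : ℕ} {p : MvPolynomial (Option (Fin n)) k}
    (hp : f - colPoly n U b p ∈ colVanish m) :
    Compl.projHom (idealGens Q n U) m (colVal₀ Q h hU f) =
      Ideal.Quotient.mk (powIdeal (idealGens Q n U) m) (polyX Q p) :=
  mk_polyX_eq Q h hU (sub_approx_mem h hU f m) hp

/-- Coloured power series as elements of the completed affine Hecke algebra. -/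
def colVal : Col n U →+* Hat Q n U where
  toFun := colVal₀ Q h hU
  map_one' := Compl.ext_proj fun m => by
    rw [projHom_colVal₀ Q h hU (p := 1) (by simp), map_one, map_one, map_one]
  map_zero' := Compl.ext_proj fun m => by
    rw [projHom_colVal₀ Q h hU (p := 0) (by simp), map_zero, map_zero, map_zero]
  map_add' f g := Compl.ext_proj fun m => by
    have hf := sub_approx_mem h hU f m
    have hg := sub_approx_mem h hU g m
    rw [projHom_colVal₀ Q h hU (p := approx h hU f m + approx h hU g m), map_add, map_add,
      map_add, projHom_colVal₀ Q h hU hf, projHom_colVal₀ Q h hU hg]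
    rw [map_add, add_sub_add_comm]
    exact add_mem hf hg
  map_mul' f g := Compl.ext_proj fun m => by
    have hf := sub_approx_mem h hU f m
    have hg := sub_approx_mem h hU g m
    rw [projHom_colVal₀ Q h hU (p := approx h hU f m * approx h hU g m), map_mul, map_mul,
      map_mul, projHom_colVal₀ Q h hU hf, projHom_colVal₀ Q h hU hg]
    have : f * g - colPoly n U b (approx h hU f m * approx h hU g m) =
        g * (f - colPoly n U b (approx h hU f m)) +
          colPoly n U b (approx h hU f m) * (g - colPoly n U b (approx h hU g m)) := by
      rw [map_mul]
      ring
    rw [this]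
    exact add_mem (Ideal.mul_mem_left _ _ hf) (Ideal.mul_mem_left _ _ hg)

theorem isFiltered_colVal : IsFiltered (colVal Q h hU) := fun m f hf => by
  rw [Compl.mem_lev]
  exact (projHom_colVal₀ Q h hU (p := 0) (by simpa)).trans (by rw [map_zero, map_zero])

theorem colVal_colPoly (p : MvPolynomial (Option (Fin n)) k) :
    colVal Q h hU (colPoly n U b p) = toCompl _ _ (polyX Q p) :=
  Compl.ext_proj fun m => projHom_colVal₀ Q h hU (p := p) (by simp)

theorem colVal_colX (i : Fin n) : colVal Q h hU (colX b i) = hgen Q n U (.X i) := by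
  have := colVal_colPoly Q h hU (MvPolynomial.X (some i))
  rw [polyX, polyHom_X_some] at this
  simpa [colPoly] using this

theorem colVal_scal (R : PowerSeries k) :
    colVal Q h hU (scal R) = algebraMap (PowerSeries k) _ R := by
  refine (isFiltered_colVal Q h hU).map_scal (fun t => ?_) ?_ R
  · have := colVal_colPoly Q h hU (MvPolynomial.C t)
    rw [polyX, polyHom_C, AlgHom.commutes] at this
    simpa [colPoly] using this
  · have := colVal_colPoly Q h hU (MvPolynomial.X none)
    rw [polyX, polyHom_X_none, AlgHom.commutes] at this
    simpa [colPoly] using this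

include h hU in
/-- The subring generated by the `scal` and the `X_i` is dense. -/
theorem exists_sub_mem_of_colX (S : Subring (Col n U)) (hS : ∀ R, scal R ∈ S)
    (hX : ∀ i, colX b i ∈ S) (f : Col n U) (m : ℕ) : ∃ g ∈ S, f - g ∈ colVanish m := by
  obtain ⟨p, hp⟩ := exists_sub_colPoly_mem h hU f m
  refine ⟨_, ?_, hp⟩
  clear hp
  induction p using MvPolynomial.induction_on with
  | C t => simpa [colPoly] using hS (PowerSeries.C t)
  | add p q hp hq =>
    rw [map_add]
    exact add_mem hp hq
  | mul_X p i hp =>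
    rw [map_mul]
    refine mul_mem hp ?_
    cases i with
    | none => simpa [colPoly] using hS PowerSeries.X
    | some i => simpa [colPoly] using hX i

end Hecke

end HSide

/-! ### The relations of the completed affine Hecke algebra -/

section HRelations

variable {k : Type*} [Field k] {Q : PowerSeries k} {U : Finset k} {n : ℕ}

open KLR

namespace Hecke

variable (Q U) in
theorem toCompl_quot_hg (g : HGen n) :
    toCompl (PowerSeries k) (idealGens Q n U) (quot Q n (hg n g)) = hgen Q n U g := rfl

section relations

variable (Q U)

theorem hgen_X_Xinv (i : Fin n) : hgen Q n U (.X i) * hgen Q n U (.Xinv i) = 1 := by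
  have := congrArg (toCompl (PowerSeries k) (idealGens Q n U)) (rel Q (.X_Xinv i))
  simpa only [map_mul, map_one, toCompl_quot_hg] using this

theorem hgen_T_sq (r : Fin (n - 1)) : hgen Q n U (.T r) * hgen Q n U (.T r) =
    algebraMap _ _ (Q - 1) * hgen Q n U (.T r) + algebraMap _ _ Q := by
  have := congrArg (toCompl (PowerSeries k) (idealGens Q n U)) (rel Q (.T_sq r))
  simpa only [map_mul, map_add, AlgHom.commutes, toCompl_quot_hg] using this

theorem hgen_T_X_T (r : Fin (n - 1)) :
    hgen Q n U (.T r) * hgen Q n U (.X (lo r)) * hgen Q n U (.T r) =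
      algebraMap _ _ Q * hgen Q n U (.X (hi r)) := by
  have := congrArg (toCompl (PowerSeries k) (idealGens Q n U)) (rel Q (.T_X_T r))
  simpa only [map_mul, AlgHom.commutes, toCompl_quot_hg] using this

theorem hgen_braid (r s : Fin (n - 1)) (h : (r : ℕ) + 1 = s) :
    hgen Q n U (.T r) * hgen Q n U (.T s) * hgen Q n U (.T r) =
      hgen Q n U (.T s) * hgen Q n U (.T r) * hgen Q n U (.T s) := by
  have := congrArg (toCompl (PowerSeries k) (idealGens Q n U)) (rel Q (.braid r s h))
  simpa only [map_mul, toCompl_quot_hg] using this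

theorem hgen_T_X_of_ne (r : Fin (n - 1)) (i : Fin n) (h₁ : i ≠ lo r) (h₂ : i ≠ hi r) :
    hgen Q n U (.T r) * hgen Q n U (.X i) = hgen Q n U (.X i) * hgen Q n U (.T r) := by
  have := congrArg (toCompl (PowerSeries k) (idealGens Q n U)) (rel Q (.T_X_comm r i h₁ h₂))
  simpa only [map_mul, toCompl_quot_hg] using this

theorem hgen_T_far (r s : Fin (n - 1)) (h₁ : (r : ℕ) + 1 ≠ s) (h₂ : (s : ℕ) + 1 ≠ r) :
    hgen Q n U (.T r) * hgen Q n U (.T s) = hgen Q n U (.T s) * hgen Q n U (.T r) := by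
  have := congrArg (toCompl (PowerSeries k) (idealGens Q n U)) (rel Q (.T_comm r s h₁ h₂))
  simpa only [map_mul, toCompl_quot_hg] using this

end relations

theorem mul_left_cancel_of_isUnit (hQ : IsUnit Q) {x y : Hat Q n U}
    (h : algebraMap (PowerSeries k) _ Q * x = algebraMap (PowerSeries k) _ Q * y) : x = y :=
  (hQ.map (algebraMap (PowerSeries k) (Hat Q n U))).mul_left_cancel h

theorem hgen_T_X_lo (hQ : IsUnit Q) (r : Fin (n - 1)) :
    hgen Q n U (.T r) * hgen Q n U (.X (lo r)) = hgen Q n U (.X (hi r)) * hgen Q n U (.T r) -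
      algebraMap _ _ (Q - 1) * hgen Q n U (.X (hi r)) := by
  apply mul_left_cancel_of_isUnit hQ
  have h1 := hgen_T_sq Q U r
  have h2 := hgen_T_X_T Q U r
  have c1 : ∀ x : Hat Q n U, x * algebraMap (PowerSeries k) _ (Q - 1) =
    algebraMap (PowerSeries k) _ (Q - 1) * x := fun x => (Algebra.commutes _ _).symm
  have c2 : ∀ x : Hat Q n U, x * algebraMap (PowerSeries k) _ Q =
    algebraMap (PowerSeries k) _ Q * x := fun x => (Algebra.commutes _ _).symm
  generalize hgen Q n U (.T r) = T at *
  generalize hgen Q n U (.X (lo r)) = x at *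
  generalize hgen Q n U (.X (hi r)) = y at *
  generalize algebraMap (PowerSeries k) (Hat Q n U) (Q - 1) = p at *
  generalize algebraMap (PowerSeries k) (Hat Q n U) Q = p' at *
  -- multiply `T x T = Q y` on the right by `T - (Q - 1)`
  have e : T * x * (T * T) = p' * y * T := by rw [← h2, mul_assoc (T * x)]
  rw [h1, mul_add, ← mul_assoc, c1, mul_assoc, h2, c2] at e
  have e' : p' * (T * x) = p' * y * T - p * (p' * y) := by rw [← e]; abel
  rw [e', mul_sub, mul_assoc, ← mul_assoc p, c2, mul_assoc]

theorem hgen_T_X_hi (hQ : IsUnit Q) (r : Fin (n - 1)) :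
    hgen Q n U (.T r) * hgen Q n U (.X (hi r)) = hgen Q n U (.X (lo r)) * hgen Q n U (.T r) +
      algebraMap _ _ (Q - 1) * hgen Q n U (.X (hi r)) := by
  apply mul_left_cancel_of_isUnit hQ
  have h1 := hgen_T_sq Q U r
  have h2 := hgen_T_X_T Q U r
  have c1 : ∀ x : Hat Q n U, x * algebraMap (PowerSeries k) _ (Q - 1) =
    algebraMap (PowerSeries k) _ (Q - 1) * x := fun x => (Algebra.commutes _ _).symm
  have c2 : ∀ x : Hat Q n U, x * algebraMap (PowerSeries k) _ Q =
    algebraMap (PowerSeries k) _ Q * x := fun x => (Algebra.commutes _ _).symm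
  generalize hgen Q n U (.T r) = T at *
  generalize hgen Q n U (.X (lo r)) = x at *
  generalize hgen Q n U (.X (hi r)) = y at *
  generalize algebraMap (PowerSeries k) (Hat Q n U) (Q - 1) = p at *
  generalize algebraMap (PowerSeries k) (Hat Q n U) Q = p' at *
  -- multiply `T x T = Q y` on the left by `T - (Q - 1)`
  have e : T * (T * x * T) = (T * T) * (x * T) := by simp only [mul_assoc]
  rw [h2, h1, add_mul, mul_assoc, ← mul_assoc T x, h2, ← mul_assoc, c2, mul_assoc] at e
  rw [e, mul_add, ← mul_assoc p, c2, mul_assoc, add_comm]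

variable {b c d : PowerSeries k} (h : IsAdmissible n b c d) (hU : (0 : k) ∉ U)
  {q : k} {A : Fin (n - 1) → Col n U}

include h hU in
theorem toFrac_heckeD (hA : IsTransition q c Q b A) (r : Fin (n - 1)) (f : Col n U) :
    toFrac (heckeD A (colB Q b) r f) =
      heckeM Q b (lo r) (hi r) * (toFrac f - act sigFrac (adj r) (toFrac f)) := by
  rw [← hA.mul_klrM h hU, heckeD, map_add, map_mul, map_mul, toFrac_klrD, map_sub, toFrac_act]
  ring

include h hU in
theorem heckeD_colX_hi (hA : IsTransition q c Q b A) (r : Fin (n - 1)) :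
    heckeD A (colB Q b) r (colX b (hi r)) = scal (Q - 1) * colX b (hi r) := by
  apply toFrac_injective
  rw [toFrac_heckeD h hU hA, ← toFrac_act, act_colX, adj_hi]
  ext1 u
  have hx := colX_sub_ne (U := U) h.b1 hU (lo_ne_hi r).symm u
  simp only [heckeM, map_mul, map_sub, map_one, Pi.mul_apply, Pi.sub_apply, Pi.inv_apply,
    Pi.one_apply]
  field_simp

include h hU in
theorem heckeD_colX_lo (hA : IsTransition q c Q b A) (r : Fin (n - 1)) :
    heckeD A (colB Q b) r (colX b (lo r)) = -(scal (Q - 1) * colX b (hi r)) := by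
  apply toFrac_injective
  rw [toFrac_heckeD h hU hA, ← toFrac_act, act_colX, adj_lo]
  ext1 u
  have hx := colX_sub_ne (U := U) h.b1 hU (lo_ne_hi r).symm u
  simp only [heckeM, map_mul, map_sub, map_one, map_neg, Pi.mul_apply, Pi.sub_apply, Pi.inv_apply,
    Pi.one_apply, Pi.neg_apply]
  field_simp
  ring

include h hU in
theorem heckeD_eq_zero (hA : IsTransition q c Q b A) {r : Fin (n - 1)} {f : Col n U}
    (hf : act sig (adj r) f = f) : heckeD A (colB Q b) r f = 0 := by
  apply toFrac_injective
  rw [toFrac_heckeD h hU hA, ← toFrac_act, hf, sub_self, mul_zero, map_zero]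

theorem T_mul_colVal (hQ : IsUnit Q) (hA : IsTransition q c Q b A) (r : Fin (n - 1))
    (f : Col n U) : hgen Q n U (.T r) * colVal Q h hU f =
      colVal Q h hU (act sig (adj r) f) * hgen Q n U (.T r) +
        colVal Q h hU (heckeD A (colB Q b) r f) := by
  refine (isFiltered_colVal Q h hU).comm (isTwistedDerivation_heckeD A (colB Q b) r)
    (fun m f hf => heckeD_mem_colVanish A (colB Q b) r hf) _
    (exists_sub_mem_of_colX h hU _ (fun R => ?_) (fun i => ?_)) f
  · rw [IsTwistedDerivation.mem_commSubring, act_scal, heckeD_eq_zero h hU hA (act_scal _ _),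
      colVal_scal, map_zero, add_zero]
    exact (Algebra.commutes _ _).symm
  · rw [IsTwistedDerivation.mem_commSubring, act_colX]
    by_cases h₁ : i = lo r
    · subst h₁
      rw [adj_lo, heckeD_colX_lo h hU hA, map_neg, map_mul, colVal_scal, colVal_colX, colVal_colX,
        hgen_T_X_lo hQ, sub_eq_add_neg]
    by_cases h₂ : i = hi r
    · subst h₂
      rw [adj_hi, heckeD_colX_hi h hU hA, map_mul, colVal_scal, colVal_colX, colVal_colX,
        hgen_T_X_hi hQ]
    · rw [adj_of_ne h₁ h₂, heckeD_eq_zero h hU hA (by rw [act_colX, adj_of_ne h₁ h₂]), map_zero,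
        add_zero, colVal_colX, hgen_T_X_of_ne Q U r i h₁ h₂]

/-- The completed affine Hecke algebra satisfies the relations of the affine Hecke algebra over
coloured power series. -/
theorem isHecke_colVal (hQ : IsUnit Q) (hA : IsTransition q c Q b A) :
    IsHecke Q A (colB Q b) (colVal Q h hU) fun r => hgen Q n U (.T r) where
  comm := T_mul_colVal h hU hQ hA
  sq r := by rw [colVal_scal, colVal_scal, hgen_T_sq]
  braid r s hrs := by rw [map_zero, add_zero, hgen_braid Q U r s hrs]
  far r s h₁ h₂ := hgen_T_far Q U r s h₁ h₂

end Hecke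

end HRelations

/-! ### Weight spaces and intertwiners -/

section Weights

variable {k : Type*} [Field k] {Q : PowerSeries k} {U : Finset k} {n : ℕ}
  {b c d : PowerSeries k} (h : IsAdmissible n b c d) (hU : (0 : k) ∉ U)

open KLR

open Classical in
/-- The coloured power series which is `1` at the weight `u` and `0` elsewhere. -/
def colE (u : Fin n → U) : Col n U := Pi.single u 1

theorem colE_self (u : Fin n → U) : (colE u : Col n U) u = 1 := by
  classical
  rw [colE]
  exact Pi.single_eq_same _ _

theorem colE_of_ne {u v : Fin n → U} (hv : v ≠ u) : (colE u : Col n U) v = 0 := by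
  classical
  rw [colE]
  exact Pi.single_eq_of_ne hv _

theorem complete_orthogonal_colE :
    CompleteOrthogonalIdempotents fun u : Fin n → U => (colE u : Col n U) := by
  refine ⟨⟨fun u => ?_, fun u v huv => ?_⟩, ?_⟩
  · ext1 w
    by_cases hw : w = u
    · rw [hw, Pi.mul_apply, colE_self, one_mul]
    · rw [Pi.mul_apply, colE_of_ne hw, zero_mul]
  · ext1 w
    by_cases hw : w = u
    · rw [Pi.mul_apply, colE_of_ne (hw.trans_ne huv), mul_zero, Pi.zero_apply]
    · rw [Pi.mul_apply, colE_of_ne hw, zero_mul, Pi.zero_apply]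
  · ext1 w
    rw [Finset.sum_apply, Finset.sum_eq_single w (fun v _ hv => colE_of_ne hv.symm) (by simp),
      colE_self, Pi.one_apply]

theorem mul_colE_congr {f g : Col n U} {u : Fin n → U} (hfg : f u = g u) :
    f * colE u = g * colE u := by
  ext1 w
  by_cases hw : w = u
  · rw [hw, Pi.mul_apply, Pi.mul_apply, hfg]
  · rw [Pi.mul_apply, Pi.mul_apply, colE_of_ne hw, mul_zero, mul_zero]

open Classical in
theorem colE_mul_colE (u v : Fin n → U) :
    (colE u * colE v : Col n U) = if u = v then colE u else 0 := by
  split_ifs with huv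
  · subst huv
    exact complete_orthogonal_colE.idem u
  · exact complete_orthogonal_colE.ortho huv

theorem act_colE (r : Fin (n - 1)) (u : Fin n → U) :
    act sig (adj r) (colE u : Col n U) = colE (swp r u) := by
  classical
  rw [colE, act_single]
  rfl

theorem klrD_colE (r : Fin (n - 1)) (u : Fin n → U) : klrD r (colE u : Col n U) = 0 :=
  klrD_single r fun v => by
    by_cases hv : v = u
    · exact Or.inr (hv ▸ colE_self v)
    · exact Or.inl (colE_of_ne hv)

namespace Hecke

/-- At a weight `v ≠ u`, one of the `X_j - u_j` is invertible, so that an element of the weight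
space of `u` has no component at `v`; at the weight `u` all `X_j - u_j` are
topologically nilpotent. -/
theorem isWeightIdempotents_colVal :
    IsWeightIdempotents Q n U fun u => colVal Q h hU (colE u) := by
  have hc : CompleteOrthogonalIdempotents fun u => colVal Q h hU (colE u) :=
    complete_orthogonal_colE.map (colVal Q h hU)
  have hx : ∀ (u : Fin n → U) j, hgen Q n U (.X j) - algebraMap (PowerSeries k) _
      (PowerSeries.C (u j : k)) = colVal Q h hU (colX b j - scal (PowerSeries.C (u j : k))) := by
    intro u j
    rw [map_sub, colVal_colX, colVal_scal]
  have hcoeff : ∀ (u v : Fin n → U) j, MvPowerSeries.constantCoeff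
      ((colX b j - scal (PowerSeries.C (u j : k)) : Col n U) v) = v j - u j := by
    intro u v j
    rw [Pi.sub_apply, map_sub, constantCoeff_colX h, scal_C, MvPowerSeries.constantCoeff_C]
  refine ⟨hc, fun u g => ⟨fun hg => ?_, fun hg j m => ⟨m, fun N hN => ?_⟩⟩⟩
  · have key : ∀ v, v ≠ u → colVal Q h hU (colE v) * g = 0 := by
      intro v hv
      obtain ⟨j, hj⟩ := Function.ne_iff.1 hv
      refine Compl.eq_zero_of_mem_lev fun m => ?_
      obtain ⟨N, hN⟩ := hg j m
      have hN := hN N le_rfl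
      rw [hx, ← Compl.projHom_apply, ← Compl.mem_lev] at hN
      have hunit : MvPowerSeries.constantCoeff
          ((colX b j - scal (PowerSeries.C (u j : k)) : Col n U) v) ≠ 0 := by
        rw [hcoeff, sub_ne_zero]
        exact fun e => hj (Subtype.coe_injective e)
      obtain ⟨z, hz⟩ := (isUnit_of_constantCoeff hunit).exists_left_inv
      -- `e_v` is divisible by `(X_j - u_j) ^ N`
      have e : (colE v : Col n U) = (colE v * fun _ => z ^ N) *
          (colX b j - scal (PowerSeries.C (u j : k))) ^ N := by
        ext1 w
        by_cases hw : w = v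
        · subst hw
          rw [Pi.mul_apply, Pi.mul_apply, Pi.pow_apply, mul_assoc, ← mul_pow, hz, one_pow, mul_one]
        · rw [Pi.mul_apply, Pi.mul_apply, colE_of_ne hw, zero_mul, zero_mul]
      rw [e, map_mul, map_pow, mul_assoc]
      exact Ideal.mul_mem_left _ _ hN
    calc colVal Q h hU (colE u) * g = ∑ v, colVal Q h hU (colE v) * g :=
          (Finset.sum_eq_single u (fun v _ hv => key v hv) (by simp)).symm
      _ = g := by rw [← Finset.sum_mul, hc.complete, one_mul]
  · rw [← Compl.projHom_apply, ← Compl.mem_lev, ← hg, ← mul_assoc, hx, ← map_pow, ← map_mul]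
    refine Compl.mul_mem_lev (isFiltered_colVal Q h hU m _ (fun v => ?_)) _
    by_cases hv : v = u
    · subst hv
      rw [Pi.mul_apply, colE_self, mul_one, Pi.pow_apply]
      refine vanish_mono hN (pow_mem_vanish (mem_vanish_one.2 ?_) N)
      rw [hcoeff, sub_self]
    · rw [Pi.mul_apply, colE_of_ne hv, mul_zero]
      exact zero_mem _

include h hU in
theorem isUnit_colX (i : Fin n) : IsUnit (colX b i : Col n U) :=
  Pi.isUnit_iff.2 fun u => isUnit_of_constantCoeff (by
    rw [constantCoeff_colX h]
    exact coe_ne_zero hU _)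

theorem colVal_inverse_colX (i : Fin n) :
    colVal Q h hU (Ring.inverse (colX b i)) = hgen Q n U (.Xinv i) := by
  rw [← mul_one (colVal Q h hU _), ← hgen_X_Xinv Q U i, ← mul_assoc, ← colVal_colX Q h hU,
    ← map_mul, Ring.inverse_mul_cancel _ (isUnit_colX h hU i), map_one, one_mul]

variable (b) in
/-- The element `denom` as a coloured power series. -/
def colDenom (r : Fin (n - 1)) (u : Fin n → U) : Col n U :=
  (1 - colX b (lo r) * Ring.inverse (colX b (hi r))) * colE u + (1 - colE u)

theorem colVal_colDenom (r : Fin (n - 1)) (u : Fin n → U) :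
    colVal Q h hU (colDenom b r u) = denom Q n U (fun u => colVal Q h hU (colE u)) r u := by
  rw [colDenom, denom, map_add, map_mul, map_sub, map_sub, map_mul, map_one, colVal_colX,
    colVal_inverse_colX]

include h hU in
theorem colX_mul_inverse_apply (i : Fin n) (u : Fin n → U) :
    colX b i u * (Ring.inverse (colX b i) : Col n U) u = 1 :=
  congrFun (Ring.mul_inverse_cancel _ (isUnit_colX h hU i)) u

include h hU in
theorem isUnit_colDenom {r : Fin (n - 1)} {u : Fin n → U} (hu : u (lo r) ≠ u (hi r)) :
    IsUnit (colDenom b r u) := by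
  refine Pi.isUnit_iff.2 fun v => ?_
  by_cases hv : v = u
  · subst hv
    have hinv := colX_mul_inverse_apply h hU (hi r) v
    have e : colDenom b r v v * colX b (hi r) v = colX b (hi r) v - colX b (lo r) v := by
      simp only [colDenom, Pi.add_apply, Pi.mul_apply, Pi.sub_apply, Pi.one_apply, colE_self]
      linear_combination -colX b (lo r) v * hinv
    refine isUnit_of_mul_isUnit_left (y := colX b (hi r) v) ?_
    rw [e]
    exact isUnit_of_constantCoeff (constantCoeff_colX_sub h hu.symm)
  · simp [colDenom, colE_of_ne hv]

theorem isUnit_denom {r : Fin (n - 1)} {u : Fin n → U} (hu : u (lo r) ≠ u (hi r)) :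
    IsUnit (denom Q n U (fun u => colVal Q h hU (colE u)) r u) := by
  rw [← colVal_colDenom]
  exact (isUnit_colDenom h hU hu).map _

/-- The correction terms in the intertwiner `Φ_r` form the coloured power series `-B_r`. -/
theorem Phi_eq (r : Fin (n - 1)) : Phi Q n U (fun u => colVal Q h hU (colE u)) r =
    hgen Q n U (.T r) - colVal Q h hU (colB Q b r) := by
  classical
  have hc : CompleteOrthogonalIdempotents fun u => colVal Q h hU (colE u) :=
    complete_orthogonal_colE.map (colVal Q h hU)
  rw [Phi, sub_eq_add_neg (hgen Q n U (.T r)), ← map_neg,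
    ← mul_one (colVal Q h hU (-_)), ← hc.complete, Finset.mul_sum]
  congr 1
  refine Finset.sum_congr rfl fun u _ => ?_
  change _ = _ * colVal Q h hU (colE u)
  split_ifs with hu
  · rw [← map_mul]
    congr 1
    ext1 v
    by_cases hv : v = u
    · subst hv
      rw [Pi.mul_apply, Pi.neg_apply, colB_apply, if_pos hu, neg_neg, one_mul]
    · rw [Pi.mul_apply, colE_of_ne hv, mul_zero]
  · have hD := isUnit_colDenom h hU hu
    have hDinv : Ring.inverse (denom Q n U (fun u => colVal Q h hU (colE u)) r u) =
        colVal Q h hU (Ring.inverse (colDenom b r u)) := by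
      rw [← colVal_colDenom]
      refine ((hD.map (colVal Q h hU)).mul_right_inj).1 ?_
      rw [Ring.mul_inverse_cancel _ (hD.map _), ← map_mul, Ring.mul_inverse_cancel _ hD, map_one]
    rw [hDinv, Algebra.smul_def, ← colVal_scal Q h hU, ← map_mul, ← map_mul, ← map_mul]
    congr 1
    refine hD.mul_right_cancel ?_
    have e1 : scal (1 - Q) * (Ring.inverse (colDenom b r u) * colE u) * colDenom b r u =
        scal (1 - Q) * colE u := by
      linear_combination scal (1 - Q) * colE u * Ring.inverse_mul_cancel _ hD
    rw [e1]
    ext1 v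
    by_cases hv : v = u
    · subst hv
      have h1 := colX_mul_inverse_apply h hU (hi r) v
      have h2 := MvPowerSeries.mul_inv_cancel _ (constantCoeff_colX_sub h (Ne.symm hu))
      simp only [Pi.mul_apply, Pi.neg_apply, colB_apply, if_neg hu, colDenom, Pi.add_apply,
        Pi.sub_apply, Pi.one_apply, colE_self, map_sub, map_one]
      linear_combination (scal Q v - 1) * h2 -
        (scal Q v - 1) * (colX b (hi r) v - colX b (lo r) v)⁻¹ * colX b (lo r) v * h1
    · simp [colE_of_ne hv]

end Hecke

end Weights

/-! ### Homomorphisms out of the two algebras -/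

section Universal

variable {k : Type*} [Field k] {n : ℕ} {U : Finset k} {B : Type*} [Ring B]
  [Algebra (PowerSeries k) B]

open KLR

namespace Hecke

variable {Q : PowerSeries k}

theorem algHom_ext {f g : Hecke Q n →ₐ[PowerSeries k] B}
    (h : ∀ x, f (gen Q n x) = g (gen Q n x)) : f = g :=
  RingQuot.ringQuot_ext' _ _ _ (FreeAlgebra.hom_ext (funext h))

variable {q : k} {b c d : PowerSeries k} {A : Fin (n - 1) → Col n U} {ι : Col n U →+* B}
  {T : Fin (n - 1) → B}

variable (b ι T) in
/-- The images of the generators of the affine Hecke algebra in a ring with an action of coloured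
power series. -/
def genVal : HGen n → B
  | .X i => ι (colX b i)
  | .Xinv i => ι (Ring.inverse (colX b i))
  | .T r => T r

theorem lift_rel (hι : ∀ R, ι (scal R) = algebraMap _ _ R) (hT : IsHecke Q A (colB Q b) ι T)
    (hA : IsTransition q c Q b A) (h : IsAdmissible n b c d) (hU : (0 : k) ∉ U)
    {x y : FreeAlgebra (PowerSeries k) (HGen n)} (hxy : HRel Q n x y) :
    FreeAlgebra.lift (PowerSeries k) (genVal b ι T) x =
      FreeAlgebra.lift (PowerSeries k) (genVal b ι T) y := by
  have hX := fun i => Ring.mul_inverse_cancel _ (isUnit_colX (U := U) h hU i)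
  induction hxy with
  | X_Xinv i =>
    simp only [map_mul, FreeAlgebra.lift_ι_apply, genVal, map_one]
    rw [← map_mul, hX, map_one]
  | Xinv_X i =>
    simp only [map_mul, FreeAlgebra.lift_ι_apply, genVal, map_one]
    rw [← map_mul, mul_comm, hX, map_one]
  | X_comm i j =>
    simp only [map_mul, FreeAlgebra.lift_ι_apply, genVal]
    rw [← map_mul, mul_comm, map_mul]
  | T_sq r =>
    simp only [map_mul, map_add, FreeAlgebra.lift_ι_apply, genVal, AlgHom.commutes]
    rw [hT.sq, hι, hι]
  | T_X_T r =>
    simp only [map_mul, FreeAlgebra.lift_ι_apply, genVal, AlgHom.commutes]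
    rw [hT.comm, act_colX, adj_lo, heckeD_colX_lo h hU hA, add_mul, mul_assoc, hT.sq, mul_add,
      ← mul_assoc, ← map_mul, ← map_mul, ← hι, ← map_mul, map_neg, neg_mul, mul_comm (colX b _),
      mul_comm (colX b _), add_right_comm, add_neg_cancel, zero_add]
  | braid r s hrs =>
    simp only [map_mul, FreeAlgebra.lift_ι_apply, genVal]
    rw [hT.braid r s hrs, map_zero, add_zero]
  | T_X_comm r i h₁ h₂ =>
    simp only [map_mul, FreeAlgebra.lift_ι_apply, genVal]
    rw [hT.comm, act_colX, adj_of_ne h₁ h₂, heckeD_eq_zero h hU hA, map_zero, add_zero]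
    rw [act_colX, adj_of_ne h₁ h₂]
  | T_comm r s h₁ h₂ =>
    simp only [map_mul, FreeAlgebra.lift_ι_apply, genVal]
    exact hT.far r s h₁ h₂

/-- The homomorphism from the affine Hecke algebra to a ring with the same relations over coloured
power series. -/
def ofCol (hι : ∀ R, ι (scal R) = algebraMap _ _ R) (hT : IsHecke Q A (colB Q b) ι T)
    (hA : IsTransition q c Q b A) (h : IsAdmissible n b c d) (hU : (0 : k) ∉ U) :
    Hecke Q n →ₐ[PowerSeries k] B :=
  RingQuot.liftAlgHom (PowerSeries k) ⟨FreeAlgebra.lift (PowerSeries k) (genVal b ι T),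
    fun _ _ hxy => lift_rel hι hT hA h hU hxy⟩

theorem ofCol_gen (hι : ∀ R, ι (scal R) = algebraMap _ _ R) (hT : IsHecke Q A (colB Q b) ι T)
    (hA : IsTransition q c Q b A) (h : IsAdmissible n b c d) (hU : (0 : k) ∉ U) (x : HGen n) :
    ofCol hι hT hA h hU (gen Q n x) = genVal b ι T x :=
  (RingQuot.liftAlgHom_mkAlgHom_apply _ _ _ _).trans (FreeAlgebra.lift_ι_apply _ _)

end Hecke

namespace KLR

variable {q : k} {c : PowerSeries k} {ι : Col n U →+* B} {ψ : Fin (n - 1) → B}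

theorem algHom_ext {f g : KLR q c U n →ₐ[PowerSeries k] B}
    (h : ∀ x, f (gen q c U n x) = g (gen q c U n x)) : f = g :=
  RingQuot.ringQuot_ext' _ _ _ (FreeAlgebra.hom_ext (funext h))

variable (ι ψ) in
/-- The images of the generators of the KLR algebra in a ring with an action of coloured power
series. -/
def genVal : KGen U n → B
  | .e u => ι (colE u)
  | .y i => ι (colY i)
  | .psi r => ψ r

theorem lift_rel (hι : ∀ R, ι (scal R) = algebraMap _ _ R) (hψ : IsKLR q c ι ψ)
    {x y : FreeAlgebra (PowerSeries k) (KGen U n)} (hxy : KRel q c U n x y) :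
    FreeAlgebra.lift (PowerSeries k) (genVal ι ψ) x =
      FreeAlgebra.lift (PowerSeries k) (genVal ι ψ) y := by
  classical
  have hlift : ∀ x, FreeAlgebra.lift (PowerSeries k) (genVal ι ψ) (kg U n x) = genVal ι ψ x :=
    fun x => FreeAlgebra.lift_ι_apply _ _
  have hψ_hi : ∀ r u, ψ r * ι (colY (hi r)) * ι (colE u) =
      (ι (colY (lo r)) * ψ r - if u (lo r) = u (hi r) then 1 else 0) * ι (colE u) := by
    intro r u
    rw [hψ.comm, act_colY, adj_hi, klrD_colY_hi, add_mul, ← map_mul, mul_colE_congr (g := -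
      if u (lo r) = u (hi r) then 1 else 0), sub_mul, sub_eq_add_neg, neg_mul, map_neg, map_mul]
    · split_ifs <;> simp
    · split_ifs <;> simp
  have hψ_lo : ∀ r u, ι (colY (hi r)) * ψ r * ι (colE u) =
      (ψ r * ι (colY (lo r)) - if u (lo r) = u (hi r) then 1 else 0) * ι (colE u) := by
    intro r u
    rw [hψ.comm, act_colY, adj_lo, klrD_colY_lo, sub_mul, add_mul, ← map_mul _ _ (colE u),
      mul_colE_congr (g := if u (lo r) = u (hi r) then 1 else 0)]
    · split_ifs <;> simp
    · split_ifs <;> simp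
  induction hxy with
  | e_mul_e u v =>
    rw [map_mul, hlift, hlift, genVal, genVal, ← map_mul, colE_mul_colE]
    split_ifs
    · rw [hlift, genVal]
    · rw [map_zero, map_zero]
  | sum_e =>
    simp only [map_sum, hlift, genVal, map_one]
    rw [← map_sum, complete_orthogonal_colE.complete, map_one]
  | y_e i u =>
    simp only [map_mul, hlift, genVal]
    rw [← map_mul, mul_comm, map_mul]
  | psi_e r u =>
    simp only [map_mul, hlift, genVal]
    rw [hψ.comm, act_colE, klrD_colE, map_zero, add_zero]
  | y_comm i j =>
    simp only [map_mul, hlift, genVal]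
    rw [← map_mul, mul_comm, map_mul]
  | psi_y_comm r i h₁ h₂ =>
    simp only [map_mul, hlift, genVal]
    rw [hψ.comm, act_colY, adj_of_ne h₁ h₂, klrD_eq_zero, map_zero, add_zero]
    rw [act_colY, adj_of_ne h₁ h₂]
  | psi_comm r s h₁ h₂ =>
    simp only [map_mul, hlift, genVal]
    exact hψ.far r s h₁ h₂
  | psi_y_hi r u =>
    simp only [map_mul, map_sub, hlift, genVal, apply_ite (FreeAlgebra.lift (PowerSeries k) _),
      map_one, map_zero]
    exact hψ_hi r u
  | y_hi_psi r u =>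
    simp only [map_mul, map_sub, hlift, genVal, apply_ite (FreeAlgebra.lift (PowerSeries k) _),
      map_one, map_zero]
    exact hψ_lo r u
  | psi_sq r u =>
    simp only [map_mul, map_Qpol, hlift, genVal]
    rw [hψ.sq, map_zero, zero_mul, zero_add, ← map_mul, mul_colE_congr
      (g := if u (lo r) = u (hi r) then 0 else
        (if (u (hi r) : k) = q * u (lo r) then colY (lo r) - colY (hi r) + scal c else 1) *
        (if (u (lo r) : k) = q * u (hi r) then colY (hi r) - colY (lo r) + scal c else 1)),
      map_mul, Qpol]
    · simp only [Subtype.coe_inj]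
      split_ifs <;> simp only [map_mul, map_add, map_sub, map_one, map_zero, hι]
    · rw [klrQ]
      split_ifs <;> rfl
  | braid r s hrs u =>
    have e := fun (v w z : k) (x y t : FreeAlgebra (PowerSeries k) (KGen U n)) => map_Bpol q
      ((FreeAlgebra.lift (PowerSeries k) (genVal ι ψ)).toRingHom) v w z x y t
    simp only [AlgHom.toRingHom_eq_coe, RingHom.coe_coe] at e
    simp only [map_mul, map_add, e, hlift, genVal]
    rw [hψ.braid r s hrs, add_mul, add_mul, ← map_mul, mul_colE_congr
      (g := Bpol q (u (lo r) : k) (u (hi r)) (u (hi s)) (colY (lo r)) (colY (hi r)) (colY (hi s))),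
      map_mul, map_Bpol]
    rw [← Pi.evalRingHom_apply (fun _ : Fin n → U => Ser k n) u (Bpol q _ _ _ _ _ _), map_Bpol]
    rfl

/-- The homomorphism from the KLR algebra to a ring with the same relations over coloured power
series. -/
def ofCol (hι : ∀ R, ι (scal R) = algebraMap _ _ R) (hψ : IsKLR q c ι ψ) :
    KLR q c U n →ₐ[PowerSeries k] B :=
  RingQuot.liftAlgHom (PowerSeries k) ⟨FreeAlgebra.lift (PowerSeries k) (genVal ι ψ),
    fun _ _ hxy => lift_rel hι hψ hxy⟩

theorem ofCol_gen (hι : ∀ R, ι (scal R) = algebraMap _ _ R) (hψ : IsKLR q c ι ψ)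
    (x : KGen U n) : ofCol hι hψ (gen q c U n x) = genVal ι ψ x :=
  (RingQuot.liftAlgHom_mkAlgHom_apply _ _ _ _).trans (FreeAlgebra.lift_ι_apply _ _)

end KLR

section filtered

variable {A : Type*} [Ring A] [Algebra (PowerSeries k) A] {G : Set A}
  {A' : Type*} [Ring A'] [Algebra (PowerSeries k) A'] {G' : Set A'}

/-- A homomorphism respects the filtrations if it sends the generators of the ideal to coloured
power series without constant terms. -/
theorem IsFiltered.map_pow_mem_lev {ι : Col n U →+* Compl (PowerSeries k) G'} (h : IsFiltered ι)
    {f : A →ₐ[PowerSeries k] Compl (PowerSeries k) G'}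
    (hf : ∀ x ∈ G, ∃ g ∈ colVanish 1, f x = ι g) (m : ℕ) :
    ∀ x ∈ G ^ m, f x ∈ Compl.lev (PowerSeries k) G' m := by
  have key : ∀ x ∈ G ^ m, ∃ g ∈ colVanish m, f x = ι g := by
    induction m with
    | zero =>
      intro x hx
      rw [pow_zero, Set.mem_one] at hx
      subst hx
      exact ⟨1, fun u => by simp [mem_vanish], by rw [map_one, map_one]⟩
    | succ m ih =>
      intro x hx
      rw [pow_succ] at hx
      obtain ⟨y, hy, z, hz, rfl⟩ := Set.mem_mul.1 hx
      obtain ⟨g, hg, e⟩ := ih y hy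
      obtain ⟨g', hg', e'⟩ := hf z hz
      exact ⟨g * g', fun u => mul_mem_vanish (hg u) (hg' u), by rw [map_mul, map_mul, e, e']⟩
  intro x hx
  obtain ⟨g, hg, e⟩ := key x hx
  rw [e]
  exact h m g hg

theorem KLR.ofCol_idealGens {q : k} {c : PowerSeries k} {ι : Col n U →+* B} {ψ : Fin (n - 1) → B}
    (hι : ∀ R, ι (scal R) = algebraMap _ _ R) (hψ : IsKLR q c ι ψ) :
    ∀ x ∈ KLR.idealGens q c U n, ∃ g ∈ colVanish 1, KLR.ofCol hι hψ x = ι g := by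
  rintro _ (rfl | ⟨i, rfl⟩)
  · exact ⟨_, scal_X_mem, by rw [AlgHom.commutes, hι]⟩
  · exact ⟨colY i, fun u => mem_vanish_one.2 (by simp [colY]), KLR.ofCol_gen hι hψ _⟩

theorem Hecke.ofCol_idealGens {q : k} {Q b c d : PowerSeries k} {A : Fin (n - 1) → Col n U}
    {ι : Col n U →+* B} {T : Fin (n - 1) → B} (hι : ∀ R, ι (scal R) = algebraMap _ _ R)
    (hT : IsHecke Q A (colB Q b) ι T) (hA : IsTransition q c Q b A) (h : IsAdmissible n b c d)
    (hU : (0 : k) ∉ U) :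
    ∀ x ∈ Hecke.idealGens Q n U, ∃ g ∈ colVanish 1, Hecke.ofCol hι hT hA h hU x = ι g := by
  rintro _ (rfl | ⟨i, rfl⟩)
  · exact ⟨_, scal_X_mem, by rw [AlgHom.commutes, hι]⟩
  · refine ⟨∏ v ∈ U, (colX b i - scal (PowerSeries.C v)), fun u => mem_vanish_one.2 ?_, ?_⟩
    · rw [Finset.prod_apply, map_prod]
      refine Finset.prod_eq_zero (u i).2 ?_
      rw [Pi.sub_apply, map_sub, constantCoeff_colX h, scal_C, MvPowerSeries.constantCoeff_C,
        sub_self]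
    · rw [← Polynomial.aeval_algHom_apply, Hecke.ofCol_gen, Hecke.genVal]
      have : (Polynomial.aeval (R := PowerSeries k) (ι (colX b i)) : _ →+* B).comp
          (Polynomial.mapRingHom (PowerSeries.C (R := k))) =
          ι.comp (Polynomial.eval₂RingHom (scal.comp PowerSeries.C) (colX b i)) := by
        refine Polynomial.ringHom_ext (fun t => ?_) ?_
        · simp [hι]
        · simp
      refine (RingHom.congr_fun this _).trans ?_
      simp only [RingHom.comp_apply, map_prod, map_sub, Polynomial.coe_eval₂RingHom,
        Polynomial.eval₂_X, Polynomial.eval₂_C]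

end filtered

end Universal

/-! ### Isomorphisms of completed cyclic modules -/

section CyclicMaps

variable {K : Type*} [CommRing K] {A A' : Type*} [Ring A] [Algebra K A] [Ring A'] [Algebra K A']
  {G : Set A} {G' : Set A'} {L : Submodule A A} {L' : Submodule A' A'}

theorem toCyclic_surjective : Function.Surjective (toCyclic K G L) :=
  Submodule.mkQ_surjective _

theorem map_mem_complIdeal {s : Set A} (f : Compl K G →ₐ[K] Compl K G')
    (hf : ∀ x ∈ s, f (toCompl K G x) ∈ complIdeal K G' L') {x : Compl K G}
    (hx : x ∈ complIdeal K G (Submodule.span A s)) : f x ∈ complIdeal K G' L' := by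
  rw [complIdeal_span] at hx
  induction hx using Submodule.span_induction with
  | mem x hx =>
    obtain ⟨y, hy, rfl⟩ := hx
    exact hf y hy
  | zero =>
    rw [map_zero]
    exact zero_mem _
  | add x y _ _ hx hy =>
    rw [map_add]
    exact add_mem hx hy
  | smul a x _ hx =>
    rw [smul_eq_mul, map_mul]
    exact Submodule.smul_mem _ _ hx

/-- The map of completed cyclic modules that is induced by a homomorphism of completed algebras. -/
def cyclicMap (f : Compl K G →ₐ[K] Compl K G')
    (hf : ∀ x ∈ complIdeal K G L, f x ∈ complIdeal K G' L') :
    ComplCyclic K G L →ₗ[K] ComplCyclic K G' L' :=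
  let g : ComplCyclic K G L →ₛₗ[(f : Compl K G →+* Compl K G')] ComplCyclic K G' L' :=
    (complIdeal K G L).mapQ (complIdeal K G' L') (f : Compl K G →+* Compl K G').toSemilinearMap hf
  { toFun := g
    map_add' := map_add g
    map_smul' := fun t v => by
      obtain ⟨x, rfl⟩ := toCyclic_surjective v
      exact congrArg (toCyclic K G' L') (map_smul f t x) }

/-- The isomorphism of completed cyclic modules that is induced by an isomorphism of completed
algebras. -/
def cyclicEquiv (f : Compl K G ≃ₐ[K] Compl K G')
    (hf : ∀ x ∈ complIdeal K G L, f x ∈ complIdeal K G' L')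
    (hf' : ∀ x ∈ complIdeal K G' L', f.symm x ∈ complIdeal K G L) :
    ComplCyclic K G L ≃ₗ[K] ComplCyclic K G' L' :=
  LinearEquiv.ofLinearMap (cyclicMap (f : Compl K G →ₐ[K] Compl K G') hf)
    (cyclicMap (f.symm : Compl K G' →ₐ[K] Compl K G) hf')
    (LinearMap.ext fun v => by
      obtain ⟨x, rfl⟩ := toCyclic_surjective v
      exact congrArg _ (f.apply_symm_apply x))
    (LinearMap.ext fun v => by
      obtain ⟨x, rfl⟩ := toCyclic_surjective v
      exact congrArg _ (f.symm_apply_apply x))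

end CyclicMaps

/-! ### The isomorphism of the completed algebras -/

section Isomorphism

variable {k : Type*} [Field k] {n : ℕ} {U : Finset k} {q : k} {Q b c d : PowerSeries k}
  {A : Fin (n - 1) → Col n U}

open KLR

section maps

variable (hA : IsTransition q c Q b A) (h : IsAdmissible n b c d) (hU : (0 : k) ∉ U)

/-- The homomorphism from the completed affine Hecke algebra to the completed KLR algebra with
`T_r ↦ A_r ψ_r + B_r`. -/
def heckeToKLR : Hecke.Hat Q n U →ₐ[PowerSeries k] KLR.Hat q c U n :=
  Compl.lift (Hecke.ofCol (colEv_scal q c U) ((isKLR_colEv q c U).isHecke hA h hU) hA h hU)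
    ((isFiltered_colEv q c U).map_pow_mem_lev (Hecke.ofCol_idealGens _ _ hA h hU))

theorem heckeToKLR_hgen (x : HGen n) : heckeToKLR hA h hU (Hecke.hgen Q n U x) =
    Hecke.genVal b (colEv q c U) (fun r => colEv q c U (A r) * kgen q c U n (.psi r) +
      colEv q c U (colB Q b r)) x := Hecke.ofCol_gen _ _ _ _ _ x

theorem heckeToKLR_mem_lev {m : ℕ} {x : Hecke.Hat Q n U}
    (hx : x ∈ Compl.lev (PowerSeries k) (Hecke.idealGens Q n U) m) :
    heckeToKLR hA h hU x ∈ Compl.lev (PowerSeries k) (KLR.idealGens q c U n) m :=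
  Compl.lift_mem_lev _ _ hx

/-- By continuity, as this holds for `h` and the `X_i`. -/
theorem heckeToKLR_colVal (f : Col n U) :
    heckeToKLR hA h hU (Hecke.colVal Q h hU f) = colEv q c U f := by
  have : (heckeToKLR hA h hU : Hecke.Hat Q n U →+* KLR.Hat q c U n).comp
      (Hecke.colVal Q h hU) = colEv q c U := by
    refine IsFiltered.ext (fun m f hf => heckeToKLR_mem_lev hA h hU
      (Hecke.isFiltered_colVal Q h hU m f hf)) (isFiltered_colEv q c U)
      (Hecke.exists_sub_mem_of_colX h hU _ (fun R => ?_) fun i => ?_)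
    · change heckeToKLR hA h hU (Hecke.colVal Q h hU _) = _
      rw [Hecke.colVal_scal, AlgHom.commutes, colEv_scal]
    · change heckeToKLR hA h hU (Hecke.colVal Q h hU _) = _
      rw [Hecke.colVal_colX, heckeToKLR_hgen]
      rfl
  exact RingHom.congr_fun this f

variable (hQ : IsUnit Q) (hP : ∀ i j, i ≠ j → ∀ u : Fin n → U, heckeP Q b i j u ≠ 0)

/-- The homomorphism from the completed KLR algebra to the completed affine Hecke algebra with
`ψ_r ↦ A_r⁻¹ T_r - A_r⁻¹ B_r`. -/
def klrToHecke : KLR.Hat q c U n →ₐ[PowerSeries k] Hecke.Hat Q n U :=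
  Compl.lift (KLR.ofCol (Hecke.colVal_scal Q h hU)
      ((Hecke.isHecke_colVal h hU hQ hA).isKLR hA h hU hP))
    ((Hecke.isFiltered_colVal Q h hU).map_pow_mem_lev (KLR.ofCol_idealGens _ _))

theorem klrToHecke_kgen (x : KGen U n) : klrToHecke hA h hU hQ hP (kgen q c U n x) =
    KLR.genVal (Hecke.colVal Q h hU) (fun r =>
      Hecke.colVal Q h hU (Ring.inverse (A r)) * Hecke.hgen Q n U (.T r) +
        Hecke.colVal Q h hU (-(Ring.inverse (A r) * colB Q b r))) x := KLR.ofCol_gen _ _ x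

theorem klrToHecke_mem_lev {m : ℕ} {x : KLR.Hat q c U n}
    (hx : x ∈ Compl.lev (PowerSeries k) (KLR.idealGens q c U n) m) :
    klrToHecke hA h hU hQ hP x ∈ Compl.lev (PowerSeries k) (Hecke.idealGens Q n U) m :=
  Compl.lift_mem_lev _ _ hx

/-- By continuity, as this holds for `h`, the `y_i` and the idempotents. -/
theorem klrToHecke_colEv (f : Col n U) :
    klrToHecke hA h hU hQ hP (colEv q c U f) = Hecke.colVal Q h hU f := by
  have : (klrToHecke hA h hU hQ hP : KLR.Hat q c U n →+* Hecke.Hat Q n U).comp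
      (colEv q c U) = Hecke.colVal Q h hU := by
    refine IsFiltered.ext (fun m f hf => klrToHecke_mem_lev hA h hU hQ hP
      (isFiltered_colEv q c U m f hf)) (Hecke.isFiltered_colVal Q h hU)
      (exists_sub_mem_of_colY _ (fun R => ?_) (fun i => ?_) fun u => ⟨colE u, ?_, fun v => ?_⟩)
    · change klrToHecke hA h hU hQ hP (colEv q c U _) = _
      rw [Hecke.colVal_scal, colEv_scal, AlgHom.commutes]
    · change klrToHecke hA h hU hQ hP (colEv q c U _) = _
      rw [colEv_colY, klrToHecke_kgen]
      rfl
    · change klrToHecke hA h hU hQ hP (colEv q c U _) = _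
      rw [colE, colEv_single, klrToHecke_kgen]
      rfl
    · split_ifs with hv
      · rw [hv, colE_self]
      · exact colE_of_ne hv
  exact RingHom.congr_fun this f

theorem heckeToKLR_klrToHecke (x : KLR.Hat q c U n) :
    heckeToKLR hA h hU (klrToHecke hA h hU hQ hP x) = x := by
  refine Compl.eq_of_toCompl (f := (heckeToKLR hA h hU).comp (klrToHecke hA h hU hQ hP))
    (g := AlgHom.id _ _) (fun m x hx => heckeToKLR_mem_lev hA h hU
      (klrToHecke_mem_lev hA h hU hQ hP hx)) (fun m x hx => hx) (fun a => ?_) x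
  have : ((heckeToKLR hA h hU).comp (klrToHecke hA h hU hQ hP)).comp (toCompl _ _) =
      toCompl (PowerSeries k) (KLR.idealGens q c U n) := by
    refine KLR.algHom_ext fun g => ?_
    change heckeToKLR hA h hU (klrToHecke hA h hU hQ hP (kgen q c U n g)) = kgen q c U n g
    rw [klrToHecke_kgen]
    cases g with
    | e u => rw [KLR.genVal, heckeToKLR_colVal, colE, colEv_single]
    | y i => rw [KLR.genVal, heckeToKLR_colVal, colEv_colY]
    | psi r =>
      rw [KLR.genVal, map_add, map_mul, heckeToKLR_colVal, heckeToKLR_colVal, heckeToKLR_hgen,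
        Hecke.genVal, mul_add, ← mul_assoc, ← map_mul, ← map_mul, hA.inverse_mul, map_one, one_mul,
        map_neg, add_neg_cancel_right]
  exact DFunLike.congr_fun this a

theorem klrToHecke_heckeToKLR (x : Hecke.Hat Q n U) :
    klrToHecke hA h hU hQ hP (heckeToKLR hA h hU x) = x := by
  refine Compl.eq_of_toCompl (f := (klrToHecke hA h hU hQ hP).comp (heckeToKLR hA h hU))
    (g := AlgHom.id _ _) (fun m x hx => klrToHecke_mem_lev hA h hU hQ hP
      (heckeToKLR_mem_lev hA h hU hx)) (fun m x hx => hx) (fun a => ?_) x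
  have : ((klrToHecke hA h hU hQ hP).comp (heckeToKLR hA h hU)).comp (toCompl _ _) =
      toCompl (PowerSeries k) (Hecke.idealGens Q n U) := by
    refine Hecke.algHom_ext fun g => ?_
    change klrToHecke hA h hU hQ hP (heckeToKLR hA h hU (Hecke.hgen Q n U g)) = Hecke.hgen Q n U g
    rw [heckeToKLR_hgen]
    cases g with
    | X i => rw [Hecke.genVal, klrToHecke_colEv, Hecke.colVal_colX]
    | Xinv i => rw [Hecke.genVal, klrToHecke_colEv, Hecke.colVal_inverse_colX]
    | T r =>
      rw [Hecke.genVal, map_add, map_mul, klrToHecke_colEv, klrToHecke_colEv, klrToHecke_kgen,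
        KLR.genVal, mul_add, ← mul_assoc, ← map_mul, ← map_mul, mul_comm (A r), hA.inverse_mul,
        map_one, one_mul, mul_neg, ← mul_assoc, mul_comm (A r), hA.inverse_mul, one_mul, map_neg,
        neg_add_cancel_right]
  exact DFunLike.congr_fun this a

/-- The isomorphism of the completed algebras. -/
def heckeEquivKLR : Hecke.Hat Q n U ≃ₐ[PowerSeries k] KLR.Hat q c U n :=
  AlgEquiv.ofAlgHom (heckeToKLR hA h hU) (klrToHecke hA h hU hQ hP)
    (AlgHom.ext (heckeToKLR_klrToHecke hA h hU hQ hP))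
    (AlgHom.ext (klrToHecke_heckeToKLR hA h hU hQ hP))

theorem continuous_heckeEquivKLR : Continuous (heckeEquivKLR hA h hU hQ hP) :=
  Compl.continuous_lift _ _

theorem continuous_heckeEquivKLR_symm : Continuous (heckeEquivKLR hA h hU hQ hP).symm :=
  Compl.continuous_lift _ _

theorem heckeToKLR_Phi (r : Fin (n - 1)) :
    heckeToKLR hA h hU (Hecke.Phi Q n U (fun u => Hecke.colVal Q h hU (colE u)) r) =
      ∑ u : Fin n → U, ev q c U (A r (swp r u)) * kgen q c U n (.psi r) * kgen q c U n (.e u) := by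
  rw [Hecke.Phi_eq, map_sub, heckeToKLR_colVal, heckeToKLR_hgen, Hecke.genVal, add_sub_cancel_right,
    ← mul_one (_ * _), ← (kgen_complete_orthogonal q c U n).complete, Finset.mul_sum]
  refine Finset.sum_congr rfl fun u _ => ?_
  rw [mul_assoc, kgen_psi_e, ← mul_assoc, colEv_mul_e, mul_assoc, ← kgen_psi_e, mul_assoc]

section PolynomialRepresentation

/-- The relations of the polynomial representation of the KLR algebra say that `ψ_r` acts on the
generator as `κ_r`. -/
theorem toCompl_psi_sub_psiOne (r : Fin (n - 1)) (u : Fin n → U) :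
    toCompl (PowerSeries k) (KLR.idealGens q c U n)
        (KLR.gen q c U n (.psi r) * KLR.gen q c U n (.e u) - psiOne q c U n r u) =
      kgen q c U n (.e (swp r u)) * (kgen q c U n (.psi r) - colEv q c U (colKappa q c r)) := by
  have hlo : swp r u (lo r) = u (hi r) := congrArg u (adj_lo r)
  have hhi : swp r u (hi r) = u (lo r) := congrArg u (adj_hi r)
  have e1 : kgen q c U n (.e (swp r u)) * colEv q c U (colKappa q c r) =
      colEv q c U (colKappa q c r) * kgen q c U n (.e (swp r u)) := by
    classical
    rw [← colEv_single, ← map_mul, mul_comm, map_mul]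
  rw [map_sub, map_mul, kgen_psi_e, mul_sub, e1, colEv_mul_e, colKappa, hlo, hhi, psiOne,
    ← evHom_apply]
  congr 1
  by_cases h1 : u (lo r) = u (hi r)
  · rw [if_pos h1, if_pos h1.symm, map_zero, map_zero, zero_mul]
  · rw [if_neg h1, if_neg (Ne.symm h1)]
    split_ifs
    · rw [map_mul, map_add, map_add, map_sub, map_sub, evHom_colY, evHom_colY, evHom_scal,
        AlgHom.commutes]
    · rw [map_one, one_mul]

/-- Summing the relations of the polynomial representation over all weights yields
`ψ_r 𝟙 = κ_r 𝟙`. -/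
theorem psi_sub_colKappa_mem (r : Fin (n - 1)) :
    kgen q c U n (.psi r) - colEv q c U (colKappa q c r) ∈
      complIdeal (PowerSeries k) (KLR.idealGens q c U n) (polyIdeal q c U n) := by
  have hinv : Function.Involutive (swp r : (Fin n → U) → _) := fun u => by
    rw [swp, swp, Function.comp_assoc, ← Equiv.coe_trans, Equiv.swap_swap]
    rfl
  rw [← one_mul (_ - _), ← (kgen_complete_orthogonal q c U n).complete, Finset.sum_mul]
  refine sum_mem fun u _ => ?_
  rw [← hinv u, ← toCompl_psi_sub_psiOne]
  exact Submodule.subset_span ⟨_, Submodule.subset_span ⟨(r, _), rfl⟩, rfl⟩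

/-- The image of `T_r + 1` is `A_r (ψ_r - κ_r)`. -/
theorem heckeToKLR_mem {x : Hecke.Hat Q n U}
    (hx : x ∈ complIdeal (PowerSeries k) (Hecke.idealGens Q n U) (Hecke.signIdeal Q n)) :
    heckeToKLR hA h hU x ∈
      complIdeal (PowerSeries k) (KLR.idealGens q c U n) (polyIdeal q c U n) := by
  refine map_mem_complIdeal _ ?_ hx
  rintro _ ⟨r, rfl⟩
  have : heckeToKLR hA h hU (toCompl (PowerSeries k) (Hecke.idealGens Q n U)
      (Hecke.gen Q n (.T r) + 1)) =
      colEv q c U (A r) * (kgen q c U n (.psi r) - colEv q c U (colKappa q c r)) := by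
    have e := congrArg (colEv q c U) (hA.mul_colKappa h hU r)
    rw [map_add, map_add, map_mul, map_one, map_zero, add_assoc] at e
    rw [map_add, map_add, map_one, map_one, heckeToKLR_hgen, Hecke.genVal, mul_sub, add_assoc,
      ← sub_eq_zero, ← e]
    abel
  rw [this]
  exact Submodule.smul_mem _ _ (psi_sub_colKappa_mem r)

/-- The image of `ψ_r - κ_r` is `A_r⁻¹ (T_r + 1)`. -/
theorem klrToHecke_mem {x : KLR.Hat q c U n}
    (hx : x ∈ complIdeal (PowerSeries k) (KLR.idealGens q c U n) (polyIdeal q c U n)) :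
    klrToHecke hA h hU hQ hP x ∈
      complIdeal (PowerSeries k) (Hecke.idealGens Q n U) (Hecke.signIdeal Q n) := by
  refine map_mem_complIdeal _ ?_ hx
  rintro _ ⟨⟨r, u⟩, rfl⟩
  have : klrToHecke hA h hU hQ hP (kgen q c U n (.psi r) - colEv q c U (colKappa q c r)) =
      Hecke.colVal Q h hU (Ring.inverse (A r)) *
        toCompl (PowerSeries k) (Hecke.idealGens Q n U) (Hecke.gen Q n (.T r) + 1) := by
    have e : colKappa q c r = -(Ring.inverse (A r) * colB Q b r) - Ring.inverse (A r) := by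
      linear_combination Ring.inverse (A r) * hA.mul_colKappa h hU r -
        colKappa q c r * hA.inverse_mul r
    rw [map_sub, klrToHecke_colEv, klrToHecke_kgen, KLR.genVal, e, map_sub, map_add, map_one,
      mul_add, mul_one]
    abel
  rw [toCompl_psi_sub_psiOne, map_mul, this]
  exact Submodule.smul_mem _ _ (Submodule.smul_mem _ _
    (Submodule.subset_span ⟨_, Submodule.subset_span ⟨r, rfl⟩, rfl⟩))

/-- The isomorphism of the completed polynomial representations. -/
def polyEquiv : Hecke.PolyHat Q n U ≃ₗ[PowerSeries k] KLR.PolyHat q c U n :=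
  cyclicEquiv (heckeEquivKLR hA h hU hQ hP) (fun _ hx => heckeToKLR_mem hA h hU hx)
    fun _ hx => klrToHecke_mem hA h hU hQ hP hx

end PolynomialRepresentation

end maps

section LaurentMonomials

theorem map_zpw {M N : Type*} [Monoid M] [Monoid N] (f : M →* N) (x y : M) (m : ℤ) :
    f (zpw x y m) = zpw (f x) (f y) m := by
  cases m <;> simp [zpw]

theorem zpw_mul {M : Type*} [CommMonoid M] (x y x' y' : M) (m : ℤ) :
    zpw (x * y) (x' * y') m = zpw x x' m * zpw y y' m := by
  cases m <;> simp [zpw, mul_pow]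

theorem zpw_inv {M : Type*} [DivisionMonoid M] (x : M) (m : ℤ) : zpw x x⁻¹ m = x ^ m := by
  cases m <;> simp [zpw]

variable (b) in
/-- The Laurent monomial `X_1 ^ a_1 ⋯ X_n ^ a_n` as a coloured power series. -/
def colXpow (a : Fin n → ℤ) : Col n U :=
  ∏ i, zpw (colX b i) (Ring.inverse (colX b i)) (a i)

theorem colVal_colXpow (h : IsAdmissible n b c d) (hU : (0 : k) ∉ U) (a : Fin n → ℤ) :
    Hecke.colVal Q h hU (colXpow b a) = Hecke.Xpow Q n U a := by
  rw [colXpow, ← List.prod_ofFn, map_list_prod, List.map_ofFn, Hecke.Xpow]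
  congr 2
  ext1 i
  have := map_zpw (Hecke.colVal Q h hU : Col n U →* Hecke.Hat Q n U) (colX b i)
    (Ring.inverse (colX b i)) (a i)
  simp only [MonoidHom.coe_coe, Hecke.colVal_colX, Hecke.colVal_inverse_colX] at this
  exact this

theorem colXpow_apply (h : IsAdmissible n b c d) (hU : (0 : k) ∉ U) (a : Fin n → ℤ)
    (u : Fin n → U) : (colXpow b a : Col n U) u =
      MvPowerSeries.C (∏ i, (u i : k) ^ a i) * ∏ i, atY (zpw b b⁻¹ (a i)) i := by
  rw [map_prod, ← Finset.prod_mul_distrib, colXpow, Finset.prod_apply]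
  refine Finset.prod_congr rfl fun i _ => ?_
  have hb : b * b⁻¹ = 1 := PowerSeries.mul_inv_cancel _ (by
    rw [← PowerSeries.coeff_zero_eq_constantCoeff_apply, h.b0]
    exact one_ne_zero)
  have hi : (Ring.inverse (colX b i) : Col n U) u = MvPowerSeries.C (u i : k)⁻¹ * atY b⁻¹ i := by
    have h1 := Hecke.colX_mul_inverse_apply h hU i u
    have h2 : colX b i u * (MvPowerSeries.C (u i : k)⁻¹ * atY b⁻¹ i) = 1 := by
      have h3 := congrArg (fun t => (atY t i : Ser k n)) hb
      have h4 : (MvPowerSeries.C (u i : k) * MvPowerSeries.C (u i : k)⁻¹ : Ser k n) = 1 := by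
        rw [← map_mul, mul_inv_cancel₀ (coe_ne_zero hU _), map_one]
      simp only [atY_eq, map_mul, map_one] at h3
      simp only [colX, eigen, atY_eq]
      linear_combination h3 + h4 * (PowerSeries.substAlgHom (hasSubst_var (some i)) b *
        PowerSeries.substAlgHom (hasSubst_var (some i)) b⁻¹)
    linear_combination (MvPowerSeries.C (u i : k)⁻¹ * atY b⁻¹ i) * h1 -
      (Ring.inverse (colX b i) : Col n U) u * h2
  have e1 := map_zpw (Pi.evalMonoidHom (fun _ : Fin n → U => Ser k n) u) (colX b i)
    (Ring.inverse (colX b i)) (a i)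
  have e2 := map_zpw ((MvPowerSeries.C : k →+* Ser k n) : k →* Ser k n) (u i : k)
    (u i : k)⁻¹ (a i)
  have e3 := map_zpw ((PowerSeries.substAlgHom (R := k) (hasSubst_var (k := k) (some i)) :
    PowerSeries k →ₐ[k] Ser k n) : PowerSeries k →* Ser k n) b b⁻¹ (a i)
  simp only [Pi.evalMonoidHom_apply, hi, MonoidHom.coe_coe, ← atY_eq,
    zpw_inv] at e1 e2 e3
  rw [e1, e2, e3, ← zpw_mul]
  rfl

theorem heckeToKLR_Xpow (hA : IsTransition q c Q b A) (h : IsAdmissible n b c d) (hU : (0 : k) ∉ U)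
    (a : Fin n → ℤ) (u : Fin n → U) :
    heckeToKLR hA h hU (Hecke.Xpow Q n U a * Hecke.colVal Q h hU (colE u)) =
      PowerSeries.C (∏ i, (u i : k) ^ a i) •
        (ev q c U (∏ i, atY (zpw b b⁻¹ (a i)) i) * kgen q c U n (.e u)) := by
  classical
  rw [← colVal_colXpow h hU, ← map_mul, heckeToKLR_colVal, map_mul, colE, colEv_single,
    colEv_mul_e, colXpow_apply h hU, ← evHom_apply, map_mul, evHom_C, Algebra.smul_def, mul_assoc,
    evHom_apply]

end LaurentMonomials

end Isomorphism

end TypeO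

end

theorem mainTheorem2 {k : Type*} [Field k] (q : k) (hq0 : q ≠ 0) (hq1 : q ≠ 1)
    (U : Finset k) (hU : (0 : k) ∉ U) (n : ℕ) (d b c : PowerSeries k)
    (hb0 : PowerSeries.coeff 0 b = 1) (hb1 : PowerSeries.coeff 1 b = 1)
    (hcase : (d = 1 ∧ c = 0) ∨
      (∃ _ : CharZero k, d = PowerSeries.exp k ∧ b = PowerSeries.exp k ∧ c = PowerSeries.X)) :
    ∃ e : (Fin n → U) → TypeO.Hecke.Hat (PowerSeries.C q * d) n U,
      TypeO.Hecke.IsWeightIdempotents (PowerSeries.C q * d) n U e ∧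
      (∀ r u, u (TypeO.lo r) ≠ u (TypeO.hi r) →
        IsUnit (TypeO.Hecke.denom (PowerSeries.C q * d) n U e r u)) ∧
      ∃ A : Fin (n - 1) → (Fin n → U) → TypeO.KLR.Ser k n,
        (∀ r u, algebraMap _ (FractionRing (TypeO.KLR.Ser k n)) (A r u) =
          TypeO.KLR.AFrac q c (PowerSeries.C q * d) b r u) ∧
        ∃ (γp : TypeO.Hecke.PolyHat (PowerSeries.C q * d) n U ≃ₗ[PowerSeries k]
              TypeO.KLR.PolyHat q c U n)
          (γ : TypeO.Hecke.Hat (PowerSeries.C q * d) n U ≃ₐ[PowerSeries k]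
              TypeO.KLR.Hat q c U n),
          (∀ (a : Fin n → ℤ) (u : Fin n → U),
            γp (TypeO.Hecke.toPoly (PowerSeries.C q * d) n U
                (TypeO.Hecke.Xpow (PowerSeries.C q * d) n U a * e u)) =
              PowerSeries.C (∏ i, (u i : k) ^ a i) • TypeO.KLR.toPoly q c U n
                (TypeO.KLR.ev q c U (∏ i, TypeO.KLR.atY (TypeO.zpw b b⁻¹ (a i)) i) *
                  TypeO.KLR.kgen q c U n (.e u))) ∧
          (∀ x v, γp (x • v) = γ x • γp v) ∧
          Continuous γ ∧ Continuous γ.symm ∧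
          (∀ i, γ (TypeO.Hecke.hgen (PowerSeries.C q * d) n U (.X i)) =
            ∑ u : Fin n → U, TypeO.KLR.ev q c U (TypeO.KLR.eigen b u i) *
              TypeO.KLR.kgen q c U n (.e u)) ∧
          (∀ r, γ (TypeO.Hecke.Phi (PowerSeries.C q * d) n U e r) =
            ∑ u : Fin n → U, TypeO.KLR.ev q c U (A r (TypeO.swp r u)) *
              TypeO.KLR.kgen q c U n (.psi r) * TypeO.KLR.kgen q c U n (.e u)) := by
  have h : TypeO.IsAdmissible n b c d := by
    rcases hcase with ⟨rfl, rfl⟩ | ⟨_, rfl, rfl, rfl⟩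
    · exact TypeO.isAdmissible_one hb0 hb1
    · exact TypeO.isAdmissible_exp
  have hQ : IsUnit (PowerSeries.C q * d) := by
    rw [PowerSeries.isUnit_iff_constantCoeff, map_mul, h.d0, PowerSeries.constantCoeff_C, mul_one]
    exact isUnit_iff_ne_zero.2 hq0
  have hP := fun i j (hij : i ≠ j) (u : Fin n → U) =>
    TypeO.heckeP_ne (q := q) h hU hij u
  obtain ⟨A, hA⟩ := TypeO.exists_isTransition (n := n) (U := U) h hq1 hU
  refine ⟨_, TypeO.Hecke.isWeightIdempotents_colVal h hU,
    fun r u => TypeO.Hecke.isUnit_denom h hU, A, hA.frac, TypeO.polyEquiv hA h hU hQ hP,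
    TypeO.heckeEquivKLR hA h hU hQ hP, fun a u => ?_, fun x v => ?_,
    TypeO.continuous_heckeEquivKLR hA h hU hQ hP, TypeO.continuous_heckeEquivKLR_symm hA h hU hQ hP,
    fun i => TypeO.heckeToKLR_hgen hA h hU (.X i), fun r => TypeO.heckeToKLR_Phi hA h hU r⟩
  · exact congrArg (TypeO.KLR.toPoly q c U n) (TypeO.heckeToKLR_Xpow hA h hU a u)
  · obtain ⟨y, rfl⟩ := TypeO.toCyclic_surjective v
    exact congrArg (TypeO.KLR.toPoly q c U n) (map_mul (TypeO.heckeEquivKLR hA h hU hQ hP) x y)
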